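/- **Theorem.** The $k$-Balanced Connected Subgraph problem ($k$-BCS) can be solved in time $2^{O(k)}n^2\log n$, so it is fixed-parameter tractable with parameter $k$. Here an instance consists of a finite simple graph $G$ on $n$ vertices (labelled $0,\dots,n-1$), each vertex coloured either red or blue, and an integer $k\ge 1$. The task is to output a set $U$ of exactly $k$ vertices, with equally many red and blue ones, such that the induced subgraph $G[U]$ is connected, or to report correctly that no such set exists; in particular, the existence of such a set is decided. Precisely: there are a constant $c$ and one deterministic word-RAM program (unit-cost arithmetic, comparison, bitwise, load, store and branching operations on words of $O(k+\log(n+1))$ bits, namely on the numbers below $(2^k(n+1))^c$, with no overflow ever occurring) that, for all $n\ge 0$, $k\ge 1$, given $n$, $k$, the colours and the adjacency matrix of $G$ in memory, halts with a correct output after at most $2^{ck}\max\{1,\,n^2\log n\}$ steps. (The maximum only matters for $n\le 1$, where $n^2\log n$ is $0$ or undefined.) -/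

import Mathlib

/-! ### Balanced connected subgraphs -/

/-- `U` is the vertex set of a balanced connected induced subgraph of `G` on `k` vertices, where the
red vertices of `G` are those in `red` and the blue ones are all the others. -/
def IsBalancedConnected {n : ℕ} (G : SimpleGraph (Fin n)) (red : Finset (Fin n)) (k : ℕ)
    (U : Finset (Fin n)) : Prop :=
  U.card = k ∧ (U ∩ red).card = (U \ red).card ∧ (G.induce (U : Set (Fin n))).Connected

/-! ### The word RAM -/

namespace WordRAM

/-- The binary word operations. -/
inductive Op where
  | add | sub | mul | div | mod | land | lor | xor | shl | shr | lt | eq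

/-- The value of an operation: subtraction is truncated at `0`, division is rounded down (and
`x / 0 = 0`, `x % 0 = x`), comparisons return `0` or `1`. -/
def Op.eval : Op → ℕ → ℕ → ℕ
  | .add, x, y => x + y
  | .sub, x, y => x - y
  | .mul, x, y => x * y
  | .div, x, y => x / y
  | .mod, x, y => x % y
  | .land, x, y => x &&& y
  | .lor, x, y => x ||| y
  | .xor, x, y => x ^^^ y
  | .shl, x, y => x <<< y
  | .shr, x, y => x >>> y
  | .lt, x, y => if x < y then 1 else 0
  | .eq, x, y => if x = y then 1 else 0

/-- Programs. Registers are named by natural numbers; a program mentions finitely many of them. -/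
inductive Prog where
  /-- do nothing -/
  | skip
  /-- `reg d := a` -/
  | const (d a : ℕ)
  /-- `reg d := o (reg a) (reg b)` -/
  | op (o : Op) (d a b : ℕ)
  /-- `reg d := mem (reg a)` -/
  | load (d a : ℕ)
  /-- `mem (reg a) := reg s` -/
  | store (a s : ℕ)
  /-- first `p`, then `q` -/
  | seq (p q : Prog)
  /-- if `reg a ≠ 0` then `p` else `q` -/
  | cond (a : ℕ) (p q : Prog)
  /-- while `reg a ≠ 0` do `p` -/
  | loop (a : ℕ) (p : Prog)

/-- A state of the machine: the contents of the registers and of the random access memory. -/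
structure State where
  reg : ℕ → ℕ
  mem : ℕ → ℕ

/-- Write a value into a register. -/
def State.setReg (s : State) (d v : ℕ) : State := ⟨Function.update s.reg d v, s.mem⟩

/-- Write a value into a memory cell. -/
def State.setMem (s : State) (a v : ℕ) : State := ⟨s.reg, Function.update s.mem a v⟩

/-- `Exec W p s t s'`: on a machine whose words are the numbers below `W`, the program `p`, started
in the state `s`, halts in the state `s'` after exactly `t` steps. Every basic instruction and
every evaluation of a test takes one step. There is no execution in which a computed value
overflows. -/
inductive Exec (W : ℕ) : Prog → State → ℕ → State → Prop where
  | skip (s : State) : Exec W .skip s 1 s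
  | const (s : State) (d a : ℕ) (h : a < W) : Exec W (.const d a) s 1 (s.setReg d a)
  | op (s : State) (o : Op) (d a b : ℕ) (h : o.eval (s.reg a) (s.reg b) < W) :
      Exec W (.op o d a b) s 1 (s.setReg d (o.eval (s.reg a) (s.reg b)))
  | load (s : State) (d a : ℕ) : Exec W (.load d a) s 1 (s.setReg d (s.mem (s.reg a)))
  | store (s : State) (a b : ℕ) : Exec W (.store a b) s 1 (s.setMem (s.reg a) (s.reg b))
  | seq {s s₁ s₂ : State} {p q : Prog} {t₁ t₂ : ℕ} (hp : Exec W p s t₁ s₁)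
      (hq : Exec W q s₁ t₂ s₂) : Exec W (.seq p q) s (t₁ + t₂) s₂
  | condTrue {s s₁ : State} {a : ℕ} {p q : Prog} {t : ℕ} (h : s.reg a ≠ 0)
      (hp : Exec W p s t s₁) : Exec W (.cond a p q) s (t + 1) s₁
  | condFalse {s s₁ : State} {a : ℕ} {p q : Prog} {t : ℕ} (h : s.reg a = 0)
      (hq : Exec W q s t s₁) : Exec W (.cond a p q) s (t + 1) s₁
  | loopDone {s : State} {a : ℕ} {p : Prog} (h : s.reg a = 0) : Exec W (.loop a p) s 1 s
  | loopStep {s s₁ s₂ : State} {a : ℕ} {p : Prog} {t₁ t₂ : ℕ} (h : s.reg a ≠ 0)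
      (hp : Exec W p s t₁ s₁) (hl : Exec W (.loop a p) s₁ t₂ s₂) :
      Exec W (.loop a p) s (t₁ + t₂ + 1) s₂

end WordRAM

/-! ### Input and output of the algorithm -/

open Classical in
/-- The memory that holds an instance: cell `0` holds the number `n` of vertices, cell `1` holds
`k`, cell `2 + v` is `1` if `v` is blue and `0` if `v` is red, the cell `2 + n + (n * u + v)` is
the entry `(u, v)` of the adjacency matrix, and all the other cells are `0`. -/
noncomputable def instanceMem {n : ℕ} (G : SimpleGraph (Fin n)) (red : Finset (Fin n)) (k : ℕ)
    (i : ℕ) : ℕ :=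
  if i = 0 then n
  else if i = 1 then k
  else if ∃ v : Fin n, i = 2 + (v : ℕ) ∧ v ∉ red then 1
  else if ∃ u v : Fin n, i = 2 + n + (n * (u : ℕ) + (v : ℕ)) ∧ G.Adj u v then 1
  else 0

/-- The initial state: the instance is in the memory and all the registers are `0`. -/
noncomputable def initialState {n : ℕ} (G : SimpleGraph (Fin n)) (red : Finset (Fin n)) (k : ℕ) :
    WordRAM.State :=
  ⟨fun _ => 0, instanceMem G red k⟩

/-- The memory holds a correct answer: either cell `0` holds `1` and the cells `1, …, k` list the
vertices of a balanced connected subgraph on `k` vertices, or cell `0` holds `0` and there is no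
such subgraph. -/
def IsCorrectAnswer {n : ℕ} (G : SimpleGraph (Fin n)) (red : Finset (Fin n)) (k : ℕ)
    (mem : ℕ → ℕ) : Prop :=
  (mem 0 = 1 ∧ ∃ f : Fin k → Fin n, IsBalancedConnected G red k (Finset.univ.image f) ∧
      ∀ i : Fin k, mem (1 + (i : ℕ)) = (f i : ℕ)) ∨
    (mem 0 = 0 ∧ ¬ ∃ U : Finset (Fin n), IsBalancedConnected G red k U)

/-! The algorithm is dynamic programming over representative families. Fix a root v, a size p and a
number r, and consider the connected sets X of p vertices, r of them red, that contain v. It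
suffices to keep a subfamily with this property: for every such X and every set Y of k - p vertices
disjoint from X, some kept X' is disjoint from Y (`Complete`). Whatever extends X to a solution then
extends X' too.

Small subfamilies come from linear algebra. Let q > n be prime and let P_X be the product of the T +
a over a in X, a polynomial in T over `ZMod q`. Then X and Y are disjoint iff the product of the
values P_X(-y), y in Y, is nonzero. For fixed Y this product is a linear form in the monomials of
degree k - p in the coefficients c_0, ..., c_p of P_X. Such a monomial is a multiset of k - p
indices, which k bits can encode (`exists_bitMonomial_eq`, `exists_linear_form`). So X has a vector
of length 2^k, and it is enough to keep sets whose vectors span all the others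
(`Represented.exists_disjoint`). Gaussian elimination keeps at most one set per pivot
(`insertCmd_spec`).

A connected set with root v and at least two vertices splits along an edge vu into connected sets
with roots v and u (`SimpleGraph.exists_connected_partition`). Replacing the two parts one after the
other by representatives shows that merging disjoint kept sets over all edges passes from size t to
size t + 1 (`Complete.succ`). After k rounds, an answer exists iff some kept set of size k has
exactly half of its vertices red.

A round visits n^2 pairs of vertices and, for each edge, 2^O(k) pairs of slots. To transfer this to
the word RAM, the algorithm is written in a language of for-loops. Overflow and running time are
checked there syntactically, by bounds D^a N^b with D = 2^k and N = n + 1. `Cmd.exec` proves the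
compiler correct, and `decide` evaluates the check and the cost. The result is 2^O(k) (n + 1)^2
steps, so the logarithm is not even needed. -/

set_option linter.unusedSimpArgs false
/-! ### A small imperative language on top of the word RAM -/

namespace Imp

open WordRAM

/-- The bound `D ^ a * N ^ b` described by a pair of exponents. -/
def scale (D N : ℕ) (e : ℕ × ℕ) : ℕ := D ^ e.1 * N ^ e.2

/-- Variables and arrays. Array `0` is an initial segment of length `base` of the memory. -/
structure Store where
  base : ℕ
  var : ℕ → ℕ
  arr : ℕ → ℕ → ℕ

def Store.setVar (S : Store) (x v : ℕ) : Store := ⟨S.base, Function.update S.var x v, S.arr⟩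

def Store.setArr (S : Store) (a i v : ℕ) : Store :=
  ⟨S.base, S.var, Function.update S.arr a (Function.update (S.arr a) i v)⟩

section SimpLemmas
variable (S : Store) (x y v a i b j : ℕ)
@[simp] theorem Store.base_setVar : (S.setVar x v).base = S.base := rfl
@[simp] theorem Store.base_setArr : (S.setArr a i v).base = S.base := rfl
@[simp] theorem Store.arr_setVar : (S.setVar x v).arr = S.arr := rfl
@[simp] theorem Store.var_setArr : (S.setArr a i v).var = S.var := rfl
@[simp] theorem Store.var_setVar : (S.setVar x v).var y = if y = x then v else S.var y := by
  simp [Store.setVar, Function.update_apply]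
@[simp] theorem Store.arr_setArr :
    (S.setArr a i v).arr b j = if b = a ∧ j = i then v else S.arr b j := by
  by_cases h : b = a
  · subst h; simp [Store.setArr, Function.update_apply]
  · simp [Store.setArr, Function.update_apply, h]
end SimpLemmas

/-- The cell of array `a` that is addressed by the index `i`. -/
def cell (base a i : ℕ) : ℕ := if a = 0 then i % base else i

/-- The memory address of a cell of an array. -/
def addr (base a i : ℕ) : ℕ := if a = 0 then i else base + (16 * i + a)

inductive Expr where
  | const (c : ℕ)
  | var (x : ℕ)
  | read (a : ℕ) (e : Expr)
  | bin (o : Op) (e f : Expr)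
  /-- the remainder modulo the successor of the second argument -/
  | modSucc (e f : Expr)

namespace Expr

def eval (S : Store) : Expr → ℕ
  | const c => c
  | var x => S.var x
  | read a e => S.arr a (cell S.base a (e.eval S))
  | bin o e f => o.eval (e.eval S) (f.eval S)
  | modSucc e f => e.eval S % (f.eval S + 1)

end Expr

/-- Turn the index in the temporary register `2 * d + 1` into an address. -/
def addrCode (a d : ℕ) : Prog :=
  -- Register 0 holds the base, register 2x + 2 the variable x, and the odd registers are a stack of
  -- temporaries. Reduction modulo the base keeps array 0 away from the other arrays, which are
  -- interleaved with stride 16 beyond the base.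
  if a = 0 then .op .mod (2 * d + 1) (2 * d + 1) 0
  else .seq (.const (2 * d + 3) 16) (.seq (.op .mul (2 * d + 1) (2 * d + 1) (2 * d + 3))
    (.seq (.const (2 * d + 3) a) (.seq (.op .add (2 * d + 1) (2 * d + 1) (2 * d + 3))
      (.op .add (2 * d + 1) 0 (2 * d + 1)))))

def addrTime (a : ℕ) : ℕ := if a = 0 then 1 else 5

namespace Expr

/-- Code that computes the value of an expression in the register `2 * d + 1`. -/
def compile : Expr → ℕ → Prog
  | const c, d => .const (2 * d + 1) c
  -- The conjunction of a register with itself is a copy.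
  | var x, d => .op .land (2 * d + 1) (2 * x + 2) (2 * x + 2)
  | read a e, d => .seq (e.compile d) (.seq (addrCode a d) (.load (2 * d + 1) (2 * d + 1)))
  | bin o e f, d => .seq (e.compile d) (.seq (f.compile (d + 1))
      (.op o (2 * d + 1) (2 * d + 1) (2 * d + 3)))
  | modSucc e f, d => .seq (e.compile d) (.seq (f.compile (d + 1))
      (.seq (.const (2 * d + 5) 1) (.seq (.op .add (2 * d + 3) (2 * d + 3) (2 * d + 5))
        (.op .mod (2 * d + 1) (2 * d + 1) (2 * d + 3)))))

def time : Expr → ℕ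
  | const _ => 1
  | var _ => 1
  | read a e => e.time + (addrTime a + 1)
  | bin _ e f => e.time + (f.time + 1)
  | modSucc e f => e.time + (f.time + 3)

end Expr

/-- Exponents of bounds on the variables and the entries of the arrays. -/
structure Table where
  var : ℕ → ℕ × ℕ
  arr : ℕ → ℕ × ℕ

structure Bounded (D N : ℕ) (B : Table) (S : Store) : Prop where
  base_pos : 0 < S.base
  base_le : S.base ≤ scale D N (3, 2)
  var_le : ∀ x, S.var x ≤ scale D N (B.var x)
  arr_le : ∀ a i, S.arr a i ≤ scale D N (B.arr a)

/-- Excluded are the operations for which `opExps` gives no valid bound. -/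
def opLegal : Op → Bool
  | .lor | .xor | .shl => false
  | _ => true

def opExps : Op → ℕ × ℕ → ℕ × ℕ → ℕ × ℕ
  | .add, a, b => (max a.1 b.1 + 1, max a.2 b.2)
  | .mul, a, b => (a.1 + b.1, a.2 + b.2)
  | .lt, _, _ => (0, 0)
  | .eq, _, _ => (0, 0)
  | _, a, _ => a

/-- Exponents of a bound on the value of an expression. -/
def Expr.exps (B : Table) : Expr → ℕ × ℕ
  | const c => (c, 0)
  | var x => B.var x
  | read a _ => B.arr a
  | bin o e f => opExps o (e.exps B) (f.exps B)
  -- This is the purpose of the successor: the remainder is at most the value of `f`, with no proof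
  -- needed that the modulus is nonzero.
  | modSucc _ f => f.exps B

/-- The slack pays for address arithmetic: for an index bounded by `e`, the address has exponents at
most `(max 3 (e.1 + 5) + 1, max 2 e.2)`. -/
def small (c : ℕ) (e : ℕ × ℕ) : Bool := e.1 + 9 < c && e.2 + 2 ≤ c

/-- The syntactic check that no overflow occurs in the evaluation of an expression. -/
def Expr.legal (c : ℕ) (B : Table) : Expr → Bool
  | const a => small c (a, 0)
  | var x => small c (B.var x)
  | read a e => e.legal c B && (a < 16 && (small c (e.exps B) && small c (B.arr a)))
  | bin o e f => e.legal c B && (f.legal c B && (opLegal o && small c (opExps o (e.exps B) (f.exps B))))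
  | modSucc e f => e.legal c B && (f.legal c B && (small c (e.exps B) && small c (f.exps B)))

section Scale
variable {D N : ℕ}

theorem scale_pos (hD : 2 ≤ D) (hN : 1 ≤ N) (e : ℕ × ℕ) : 1 ≤ scale D N e :=
  Nat.one_le_iff_ne_zero.2 (by unfold scale; positivity)

theorem scale_mono (hD : 2 ≤ D) (hN : 1 ≤ N) {e f : ℕ × ℕ} (h1 : e.1 ≤ f.1) (h2 : e.2 ≤ f.2) :
    scale D N e ≤ scale D N f :=
  Nat.mul_le_mul (Nat.pow_le_pow_right (by lia) h1) (Nat.pow_le_pow_right hN h2)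

theorem scale_mul (e f : ℕ × ℕ) : scale D N e * scale D N f = scale D N (e.1 + f.1, e.2 + f.2) := by
  simp only [scale, pow_add]; ring

theorem two_pow_mul_scale_le (hD : 2 ≤ D) (m : ℕ) (e : ℕ × ℕ) :
    2 ^ m * scale D N e ≤ scale D N (e.1 + m, e.2) := by
  have : 2 ^ m ≤ D ^ m := Nat.pow_le_pow_left hD m
  calc 2 ^ m * scale D N e ≤ D ^ m * scale D N e := Nat.mul_le_mul_right _ this
    _ = scale D N (e.1 + m, e.2) := by simp only [scale, pow_add]; ring

theorem scale_add_le (hD : 2 ≤ D) (hN : 1 ≤ N) (e f : ℕ × ℕ) :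
    scale D N e + scale D N f ≤ scale D N (max e.1 f.1 + 1, max e.2 f.2) := by
  have h1 := scale_mono hD hN (e := e) (f := (max e.1 f.1, max e.2 f.2)) (by simp) (by simp)
  have h2 := scale_mono hD hN (e := f) (f := (max e.1 f.1, max e.2 f.2)) (by simp) (by simp)
  have h3 := two_pow_mul_scale_le (N := N) hD 1 (max e.1 f.1, max e.2 f.2)
  simp only at h3
  lia

theorem le_scale_self (hD : 2 ≤ D) (m : ℕ) : m ≤ scale D N (m, 0) := by
  have h1 : m < 2 ^ m := Nat.lt_two_pow_self
  have h2 : 2 ^ m ≤ D ^ m := Nat.pow_le_pow_left hD m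
  simp only [scale, pow_zero, mul_one]
  lia

theorem scale_lt (hD : 2 ≤ D) (hN : 1 ≤ N) {c : ℕ} {e : ℕ × ℕ} (h1 : e.1 < c) (h2 : e.2 ≤ c) :
    scale D N e < (D * N) ^ c := by
  rw [mul_pow]
  have h3 : D ^ e.1 < D ^ c := Nat.pow_lt_pow_right (by lia) h1
  have h4 : N ^ e.2 ≤ N ^ c := Nat.pow_le_pow_right hN h2
  have h5 : 0 < N ^ e.2 := by positivity
  exact Nat.mul_lt_mul_of_lt_of_le h3 h4 (by positivity)

theorem small_iff {c : ℕ} {e : ℕ × ℕ} : small c e = true ↔ e.1 + 9 < c ∧ e.2 + 2 ≤ c := by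
  simp [small]

theorem lt_of_small (hD : 2 ≤ D) (hN : 1 ≤ N) {c m : ℕ} {e : ℕ × ℕ} (h : small c e = true)
    (hm : m ≤ scale D N e) : m < (D * N) ^ c := by
  rw [small_iff] at h
  exact hm.trans_lt (scale_lt hD hN (by lia) (by lia))

theorem opEval_le (hD : 2 ≤ D) (hN : 1 ≤ N) {o : Op} (ho : opLegal o = true) {x y : ℕ}
    {e f : ℕ × ℕ} (hx : x ≤ scale D N e) (hy : y ≤ scale D N f) :
    o.eval x y ≤ scale D N (opExps o e f) := by
  have h1 := scale_pos hD hN (0, 0)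
  cases o <;> simp only [opLegal, Bool.false_eq_true] at ho <;> simp only [Op.eval, opExps]
  · exact (Nat.add_le_add hx hy).trans (scale_add_le hD hN e f)
  · exact (Nat.sub_le _ _).trans hx
  · exact (Nat.mul_le_mul hx hy).trans (scale_mul e f).le
  · exact (Nat.div_le_self _ _).trans hx
  · exact (Nat.mod_le _ _).trans hx
  · exact Nat.and_le_left.trans hx
  · rw [Nat.shiftRight_eq_div_pow]; exact (Nat.div_le_self _ _).trans hx
  · split_ifs <;> lia
  · split_ifs <;> lia

theorem Expr.small_exps {c : ℕ} {B : Table} {e : Expr} (hl : e.legal c B = true) :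
    small c (e.exps B) = true := by
  cases e with
  | const a => exact hl
  | var x => exact hl
  | read a e => simp only [legal, Bool.and_eq_true] at hl; exact hl.2.2.2
  | bin o e f => simp only [legal, Bool.and_eq_true] at hl; exact hl.2.2.2
  | modSucc e f => simp only [legal, Bool.and_eq_true] at hl; exact hl.2.2.2

theorem Expr.eval_le (hD : 2 ≤ D) (hN : 1 ≤ N) {c : ℕ} {B : Table} {S : Store}
    (hS : Bounded D N B S) (e : Expr) (hl : e.legal c B = true) :
    e.eval S ≤ scale D N (e.exps B) := by
  induction e with
  | const a => exact le_scale_self hD a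
  | var x => exact hS.var_le x
  | read a e _ => exact hS.arr_le a _
  | bin o e f ihe ihf =>
    simp only [legal, Bool.and_eq_true] at hl
    exact opEval_le hD hN hl.2.2.1 (ihe hl.1) (ihf hl.2.1)
  | modSucc e f _ ihf =>
    simp only [legal, Bool.and_eq_true] at hl
    exact (Nat.lt_succ_iff.1 (Nat.mod_lt _ (Nat.succ_pos _))).trans (ihf hl.2.1)

end Scale

/-! ### Execution of compiled expressions -/

/-- The state of the machine represents the variables and the arrays. -/
structure Rep (S : Store) (s : State) : Prop where
  base : s.reg 0 = S.base
  var : ∀ x, s.reg (2 * x + 2) = S.var x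
  arr : ∀ a i, a < 16 → (a = 0 → i < S.base) → s.mem (addr S.base a i) = S.arr a i

/-- Temporaries have odd numbers, so evaluating an expression leaves the represented store intact.
-/
theorem Rep.congr {S : Store} {s s' : State} (h : Rep S s) (hm : s'.mem = s.mem)
    (hr : ∀ r, r % 2 = 0 → s'.reg r = s.reg r) : Rep S s' :=
  ⟨by rw [hr _ rfl, h.base], fun x => by rw [hr _ (by lia), h.var],
    fun a i h1 h2 => by rw [hm, h.arr a i h1 h2]⟩

theorem addrCode_exec {D N c : ℕ} (hD : 2 ≤ D) (hN : 1 ≤ N) {S : Store} {s : State}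
    (hb : 0 < S.base) (hb' : S.base ≤ scale D N (3, 2))
    (hR : Rep S s) {a d i : ℕ} {e : ℕ × ℕ} (ha : a < 16)
    (hi : s.reg (2 * d + 1) = i) (hie : i ≤ scale D N e) (he : small c e = true) :
    ∃ s', Exec ((D * N) ^ c) (addrCode a d) s (addrTime a) s' ∧
      s'.reg (2 * d + 1) = addr S.base a (cell S.base a i) ∧ s'.mem = s.mem ∧
      ∀ r, r % 2 = 0 ∨ r < 2 * d + 1 → s'.reg r = s.reg r := by
  have hc := small_iff.1 he
  by_cases h0 : a = 0
  · subst h0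
    simp only [addrCode, addrTime, if_true]
    refine ⟨_, Exec.op s .mod (2 * d + 1) (2 * d + 1) 0 ?_, ?_, rfl, ?_⟩
    · simp only [Op.eval, hi]
      exact (Nat.mod_le _ _).trans_lt (lt_of_small hD hN he hie)
    · simp [State.setReg, Op.eval, hi, hR.base, addr, cell]
    · intro r hr
      simp only [State.setReg]
      rw [Function.update_of_ne]
      lia
  · have hbig : S.base + (16 * i + a) < (D * N) ^ c := by
      -- Since a ≤ 15, the offset 16 i + a is at most 31 times the bound on i.
      have h1 : 2 ^ 5 * scale D N e ≤ _ := two_pow_mul_scale_le (N := N) hD 5 e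
      have h2 := scale_pos hD hN e
      have h3 := scale_add_le hD hN (3, 2) (e.1 + 5, e.2)
      refine lt_of_le_of_lt (b := scale D N (max 3 (e.1 + 5) + 1, max 2 e.2)) (by simp only at h3; lia)
        (scale_lt hD hN ?_ ?_) <;> simp only <;> lia
    have h16 : 16 * i < (D * N) ^ c := by lia
    have hsum : 16 * i + a < (D * N) ^ c := by lia
    have hc16 : 16 < (D * N) ^ c := by
      refine lt_of_le_of_lt (b := scale D N (4, 0)) ?_ (scale_lt hD hN ?_ ?_)
      · have := Nat.pow_le_pow_left hD 4
        simpa [scale] using this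
      · simp only; lia
      · simp only; lia
    simp only [addrCode, addrTime, if_neg h0]
    refine ⟨_, Exec.seq (t₁ := 1) (t₂ := 4) (Exec.const _ _ _ hc16)
        (Exec.seq (t₁ := 1) (t₂ := 3) (Exec.op _ _ _ _ _ ?_)
          (Exec.seq (t₁ := 1) (t₂ := 2) (Exec.const _ _ _ (by lia))
            (Exec.seq (t₁ := 1) (t₂ := 1) (Exec.op _ _ _ _ _ ?_) (Exec.op _ _ _ _ _ ?_)))),
      ?_, rfl, ?_⟩
    · simpa [State.setReg, Op.eval, hi, mul_comm i 16] using h16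
    · simpa [State.setReg, Op.eval, hi, mul_comm i 16] using hsum
    · simpa [State.setReg, Op.eval, hi, mul_comm i 16, hR.base] using hbig
    · simp [State.setReg, Op.eval, hi, mul_comm i 16, hR.base, addr, cell, h0]
    · intro r hr
      have h1 : r ≠ 2 * d + 1 := by lia
      have h3 : r ≠ 2 * d + 3 := by lia
      simp [State.setReg, Function.update_apply, h1, h3]

theorem Expr.exec {D N c : ℕ} (hD : 2 ≤ D) (hN : 1 ≤ N) {B : Table} {S : Store}
    (hS : Bounded D N B S) (e : Expr) (hl : e.legal c B = true) (d : ℕ) (s : State)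
    (hR : Rep S s) :
    ∃ s', Exec ((D * N) ^ c) (e.compile d) s e.time s' ∧ s'.reg (2 * d + 1) = e.eval S ∧
      s'.mem = s.mem ∧ ∀ r, r % 2 = 0 ∨ r < 2 * d + 1 → s'.reg r = s.reg r := by
  induction e generalizing d s with
  | const a =>
    refine ⟨_, Exec.const s _ _ (lt_of_small hD hN hl (le_scale_self hD a)), ?_, rfl, ?_⟩
    · simp [State.setReg, eval]
    · intro r hr
      have h1 : r ≠ 2 * d + 1 := by lia
      simp [State.setReg, Function.update_apply, h1]
  | var x =>
    refine ⟨_, Exec.op s _ _ _ _ ?_, ?_, rfl, ?_⟩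
    · simp only [Op.eval, Nat.and_self, hR.var]
      exact lt_of_small hD hN hl (hS.var_le x)
    · simp [State.setReg, eval, Op.eval, hR.var]
    · intro r hr
      have h1 : r ≠ 2 * d + 1 := by lia
      simp [State.setReg, Function.update_apply, h1]
  | read a e ih =>
    simp only [legal, Bool.and_eq_true, decide_eq_true_eq] at hl
    obtain ⟨s1, h1, h1v, h1m, h1r⟩ := ih hl.1 d s hR
    have hR1 : Rep S s1 := hR.congr h1m fun r hr => h1r r (Or.inl hr)
    obtain ⟨s2, h2, h2v, h2m, h2r⟩ := addrCode_exec hD hN hS.base_pos hS.base_le hR1 hl.2.1 h1v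
      (e.eval_le hD hN hS hl.1) hl.2.2.1
    refine ⟨_, Exec.seq h1 (Exec.seq h2 (Exec.load _ _ _)), ?_, h2m.trans h1m, ?_⟩
    · simp only [State.setReg, Function.update_self, h2v, h2m, eval]
      refine hR1.arr _ _ hl.2.1 fun h => ?_
      simp only [cell, h, if_true]
      exact Nat.mod_lt _ hS.base_pos
    · intro r hr
      have : r ≠ 2 * d + 1 := by lia
      simp [State.setReg, Function.update_apply, this, h2r r hr, h1r r hr]
  | bin o e f ihe ihf =>
    have hlt := lt_of_small hD hN (Expr.small_exps hl)
      (Expr.eval_le hD hN hS (bin o e f) hl)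
    simp only [legal, Bool.and_eq_true] at hl
    obtain ⟨s1, h1, h1v, h1m, h1r⟩ := ihe hl.1 d s hR
    have hR1 : Rep S s1 := hR.congr h1m fun r hr => h1r r (Or.inl hr)
    obtain ⟨s2, h2, h2v, h2m, h2r⟩ := ihf hl.2.1 (d + 1) s1 hR1
    have h2v' : s2.reg (2 * d + 3) = f.eval S := h2v
    have h2w : s2.reg (2 * d + 1) = e.eval S := by rw [h2r _ (by lia), h1v]
    refine ⟨_, Exec.seq h1 (Exec.seq h2 (Exec.op _ _ _ _ _ ?_)), ?_, h2m.trans h1m, ?_⟩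
    · rw [h2v', h2w]; exact hlt
    · simp [State.setReg, h2v', h2w, eval]
    · intro r hr
      have : r ≠ 2 * d + 1 := by lia
      simp [State.setReg, Function.update_apply, this, h2r r (by lia), h1r r hr]
  | modSucc e f ihe ihf =>
    simp only [legal, Bool.and_eq_true] at hl
    have hle := Expr.eval_le hD hN hS e hl.1
    have hlf := Expr.eval_le hD hN hS f hl.2.1
    obtain ⟨s1, h1, h1v, h1m, h1r⟩ := ihe hl.1 d s hR
    have hR1 : Rep S s1 := hR.congr h1m fun r hr => h1r r (Or.inl hr)
    obtain ⟨s2, h2, h2v, h2m, h2r⟩ := ihf hl.2.1 (d + 1) s1 hR1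
    have h2v' : s2.reg (2 * d + 3) = f.eval S := h2v
    have h2w : s2.reg (2 * d + 1) = e.eval S := by rw [h2r _ (by lia), h1v]
    have hsf := small_iff.1 hl.2.2.2
    have hf1 : f.eval S + 1 < (D * N) ^ c := by
      have h1 := scale_pos hD hN (f.exps B)
      have h2 := two_pow_mul_scale_le (N := N) hD 1 (f.exps B)
      refine lt_of_le_of_lt (b := scale D N ((f.exps B).1 + 1, (f.exps B).2)) (by lia)
        (scale_lt hD hN ?_ ?_) <;> simp only <;> lia
    refine ⟨_, Exec.seq h1 (Exec.seq h2 (Exec.seq (t₁ := 1) (t₂ := 2) (Exec.const _ _ _ (by lia))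
      (Exec.seq (t₁ := 1) (t₂ := 1) (Exec.op _ _ _ _ _ ?_) (Exec.op _ _ _ _ _ ?_)))),
      ?_, h2m.trans h1m, ?_⟩
    · simpa [State.setReg, Op.eval, h2v'] using hf1
    · simp only [Op.eval]
      refine (Nat.mod_le _ _).trans_lt ?_
      simpa [State.setReg, h2w] using lt_of_small hD hN hl.2.2.1 hle
    · simp [State.setReg, h2v', h2w, eval, Op.eval]
    · intro r hr
      have g1 : r ≠ 2 * d + 1 := by lia
      have g2 : r ≠ 2 * d + 3 := by lia
      have g3 : r ≠ 2 * d + 5 := by lia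
      simp [State.setReg, Function.update_apply, g1, g2, g3, h2r r (by lia), h1r r hr]

end Imp

/-! ### Commands: semantics, compilation, static check and cost -/

namespace Imp
open WordRAM

inductive Cmd where
  | skip
  /-- assignment to a variable -/
  | set (x : ℕ) (e : Expr)
  /-- assignment of the value of `f` to the cell of the array `a` with the index `e` -/
  | write (a : ℕ) (e f : Expr)
  | seq (p q : Cmd)
  | ite (e : Expr) (p q : Cmd)
  /-- for `x` from `0` to `y - 1` do `p` -/
  | forTo (x y : ℕ) (p : Cmd)

namespace Cmd

def run : Cmd → Store → Store
  | skip, S => S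
  | set x e, S => S.setVar x (e.eval S)
  | write a e f, S => S.setArr a (cell S.base a (e.eval S)) (f.eval S)
  | seq p q, S => q.run (p.run S)
  | ite e p q, S => if e.eval S ≠ 0 then p.run S else q.run S
  -- The limit is read once and the counter is set by force after each pass. This agrees with the
  -- compiled while-loop because `legal` forbids the body to modify either variable.
  | forTo x y p, S =>
      Nat.rec (S.setVar x 0) (fun j S' => (p.run S').setVar x (j + 1)) (S.var y)

/-- Does the command contain an assignment to the variable `x`? -/
def mods : Cmd → ℕ → Bool
  | skip, _ => false
  | set y _, x => x == y
  | write _ _ _, _ => false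
  | seq p q, x => p.mods x || q.mods x
  | ite _ p q, x => p.mods x || q.mods x
  | forTo y _ p, x => x == y || p.mods x

/-- Does the command contain an assignment to the array `a`? -/
def amods : Cmd → ℕ → Bool
  | skip, _ => false
  | set _ _, _ => false
  | write b _ _, a => a == b
  | seq p q, a => p.amods a || q.amods a
  | ite _ p q, a => p.amods a || q.amods a
  | forTo _ _ p, a => p.amods a

def compile : Cmd → Prog
  | skip => .skip
  | set x e => .seq (e.compile 0) (.op .land (2 * x + 2) 1 1)
  | write a e f => .seq (e.compile 0) (.seq (addrCode a 0) (.seq (f.compile 1) (.store 1 3)))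
  | seq p q => .seq p.compile q.compile
  | ite e p q => .seq (e.compile 0) (.cond 1 p.compile q.compile)
  | forTo x y p => .seq (.const (2 * x + 2) 0) (.seq (.op .lt 1 (2 * x + 2) (2 * y + 2))
      (.loop 1 (.seq p.compile (.seq (.const 3 1) (.seq (.op .add (2 * x + 2) (2 * x + 2) 3)
        (.op .lt 1 (2 * x + 2) (2 * y + 2)))))))

/-- Exponents of a bound on the running time. -/
def cost (B : Table) : Cmd → ℕ × ℕ
  | skip => (0, 0)
  | set _ e => (e.time + 1, 0)
  | write a e f => (e.time + (addrTime a + (f.time + 1)), 0)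
  | seq p q => (max (p.cost B).1 (q.cost B).1 + 1, max (p.cost B).2 (q.cost B).2)
  | ite e p q => (max (e.time + 1) (max (p.cost B).1 (q.cost B).1) + 1,
      max (p.cost B).2 (q.cost B).2)
  | forTo _ y p => ((B.var y).1 + (p.cost B).1 + 6, (B.var y).2 + (p.cost B).2)

def le (e f : ℕ × ℕ) : Bool := e.1 ≤ f.1 && e.2 ≤ f.2

/-- The syntactic check that no overflow occurs, that the bounds in the table are respected, and
that loops modify neither their counters nor their limits. -/
def legal (c : ℕ) (B : Table) : Cmd → Bool
  | skip => true
  | set x e => e.legal c B && le (e.exps B) (B.var x)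
  | write a e f => e.legal c B && (f.legal c B && (a < 16 && (small c (e.exps B) &&
      le (f.exps B) (B.arr a))))
  | seq p q => p.legal c B && q.legal c B
  | ite e p q => e.legal c B && (p.legal c B && q.legal c B)
  | forTo x y p => p.legal c B && (!p.mods x && (!p.mods y && (x != y &&
      (le (B.var y) (B.var x) && small c (B.var x)))))

theorem run_base (p : Cmd) (S : Store) : (p.run S).base = S.base := by
  induction p generalizing S with
  | skip => rfl
  | set x e => rfl
  | write a e f => rfl
  | seq p q ihp ihq => simp only [run, ihp, ihq]
  | ite e p q ihp ihq => simp only [run]; split_ifs <;> simp [ihp, ihq]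
  | forTo x y p ih =>
    simp only [run]
    induction S.var y with
    | zero => rfl
    | succ j ihj => simpa [ih] using ihj

/-- Frame rule: for a concrete command the hypothesis is a computation on its syntax, usually
settled by `decide`. -/
theorem run_var (p : Cmd) {x : ℕ} (h : p.mods x = false) (S : Store) :
    (p.run S).var x = S.var x := by
  induction p generalizing S with
  | skip => rfl
  | set y e => simp only [mods, beq_eq_false_iff_ne] at h; simp [run, h]
  | write a e f => rfl
  | seq p q ihp ihq =>
    simp only [mods, Bool.or_eq_false_iff] at h
    simp only [run, ihp h.1, ihq h.2]
  | ite e p q ihp ihq =>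
    simp only [mods, Bool.or_eq_false_iff] at h
    simp only [run]; split_ifs <;> simp [ihp h.1, ihq h.2]
  | forTo z y p ih =>
    simp only [mods, Bool.or_eq_false_iff, beq_eq_false_iff_ne] at h
    simp only [run]
    induction S.var y with
    | zero => simp [h.1]
    | succ j ihj => simpa [ih h.2, h.1] using ihj

theorem run_arr (p : Cmd) {a : ℕ} (h : p.amods a = false) (S : Store) :
    (p.run S).arr a = S.arr a := by
  induction p generalizing S with
  | skip => rfl
  | set y e => rfl
  | write b e f =>
    simp only [amods, beq_eq_false_iff_ne] at h
    funext i; simp [run, h]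
  | seq p q ihp ihq =>
    simp only [amods, Bool.or_eq_false_iff] at h
    simp only [run, ihp h.1, ihq h.2]
  | ite e p q ihp ihq =>
    simp only [amods, Bool.or_eq_false_iff] at h
    simp only [run]; split_ifs <;> simp [ihp h.1, ihq h.2]
  | forTo z y p ih =>
    simp only [amods] at h
    simp only [run]
    induction S.var y with
    | zero => simp
    | succ j ihj => simpa [ih h] using ihj

/-- The invariant rule for loops. -/
theorem run_forTo {x y : ℕ} {p : Cmd} {S : Store} (N : ℕ) (hN : S.var y = N)
    (I : ℕ → Store → Prop) (h0 : I 0 (S.setVar x 0))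
    (hstep : ∀ j < N, ∀ S', I j S' → S'.var x = j → I (j + 1) ((p.run S').setVar x (j + 1))) :
    I N ((forTo x y p).run S) := by
  subst hN
  have key : ∀ m ≤ S.var y, I m (Nat.rec (S.setVar x 0)
      (fun j S' => (p.run S').setVar x (j + 1)) m : Store) ∧
      (Nat.rec (S.setVar x 0) (fun j S' => (p.run S').setVar x (j + 1)) m : Store).var x = m := by
    intro m hm
    induction m with
    | zero => exact ⟨h0, by simp⟩
    | succ j ih =>
      obtain ⟨h1, h2⟩ := ih (by lia)
      exact ⟨hstep j (by lia) _ h1 h2, by simp⟩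
  exact (key _ le_rfl).1

end Cmd

theorem Cmd.le_iff {e f : ℕ × ℕ} : Cmd.le e f = true ↔ e.1 ≤ f.1 ∧ e.2 ≤ f.2 := by simp [Cmd.le]

theorem Rep.setVar {S : Store} {s s' : State} (h : Rep S s) (x v : ℕ) (hm : s'.mem = s.mem)
    (hr : ∀ r, r % 2 = 0 → s'.reg r = if r = 2 * x + 2 then v else s.reg r) :
    Rep (S.setVar x v) s' := by
  refine ⟨?_, fun y => ?_, fun a i h1 h2 => ?_⟩
  · rw [hr _ rfl, if_neg (by lia)]; exact h.base
  · rw [hr _ (by lia), S.var_setVar]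
    have := h.var y
    split_ifs <;> lia
  · rw [hm]; exact h.arr a i h1 h2

theorem Rep.setArr {S : Store} {s : State} (h : Rep S s) {a i : ℕ} (ha : a < 16)
    (hi : a = 0 → i < S.base) (v : ℕ) :
    Rep (S.setArr a i v) (s.setMem (addr S.base a i) v) := by
  refine ⟨h.base, h.var, fun b j h1 h2 => ?_⟩
  simp only [State.setMem, Store.arr_setArr, Function.update_apply, Store.base_setArr]
  simp only [Store.base_setArr] at h2
  have key : addr S.base b j = addr S.base a i ↔ b = a ∧ j = i := by
    constructor
    · unfold addr
      split_ifs with h3 h4 h4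
      · lia
      · have := h2 h3; lia
      · have := hi h4; lia
      · lia
    · rintro ⟨rfl, rfl⟩; rfl
  rw [h.arr b j h1 h2]
  simp only [key]

section
variable {D N : ℕ} {B : Table} {S : Store}

theorem Bounded.setVar (h : Bounded D N B S) {x v : ℕ} (hv : v ≤ scale D N (B.var x)) :
    Bounded D N B (S.setVar x v) := by
  refine ⟨h.base_pos, h.base_le, fun y => ?_, h.arr_le⟩
  rw [S.var_setVar]
  split_ifs with hy
  · rw [hy]; exact hv
  · exact h.var_le y

theorem Bounded.setArr (h : Bounded D N B S) {a i v : ℕ} (hv : v ≤ scale D N (B.arr a)) :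
    Bounded D N B (S.setArr a i v) := by
  refine ⟨h.base_pos, h.base_le, h.var_le, fun b j => ?_⟩
  rw [S.arr_setArr]
  split_ifs with hy
  · rw [hy.1]; exact hv
  · exact h.arr_le b j

/-- Commands that pass the check run without overflow within the computed time. -/
theorem Cmd.exec {c : ℕ} (hD : 2 ≤ D) (hN : 1 ≤ N) (p : Cmd) (hl : p.legal c B = true)
    (hS : Bounded D N B S) (s : State) (hR : Rep S s) :
    ∃ t s', Exec ((D * N) ^ c) p.compile s t s' ∧ t ≤ scale D N (p.cost B) ∧
      Rep (p.run S) s' ∧ Bounded D N B (p.run S) := by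
  induction p generalizing S s with
  | skip => exact ⟨1, s, .skip s, scale_pos hD hN _, hR, hS⟩
  | set x e =>
    simp only [legal, Bool.and_eq_true, le_iff] at hl
    obtain ⟨s1, h1, h1v, h1m, h1r⟩ := e.exec hD hN hS hl.1 0 s hR
    have hle := e.eval_le hD hN hS hl.1
    refine ⟨_, _, .seq h1 (.op _ .land _ 1 1 ?_), le_scale_self hD (e.time + 1), ?_,
      hS.setVar (hle.trans (scale_mono hD hN hl.2.1 hl.2.2))⟩
    · simp only [Op.eval, Nat.and_self]
      have : s1.reg 1 = _ := h1v
      rw [this]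
      exact lt_of_small hD hN (Expr.small_exps hl.1) hle
    · refine hR.setVar x (e.eval S) h1m fun r hr => ?_
      have : s1.reg 1 = _ := h1v
      simp [State.setReg, Function.update_apply, Op.eval, this, h1r r (Or.inl hr)]
  | write a e f =>
    simp only [legal, Bool.and_eq_true, le_iff, decide_eq_true_eq] at hl
    obtain ⟨s1, h1, h1v, h1m, h1r⟩ := e.exec hD hN hS hl.1 0 s hR
    have hR1 : Rep S s1 := hR.congr h1m fun r hr => h1r r (Or.inl hr)
    obtain ⟨s2, h2, h2v, h2m, h2r⟩ := addrCode_exec hD hN hS.base_pos hS.base_le hR1 hl.2.2.1 h1v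
      (e.eval_le hD hN hS hl.1) hl.2.2.2.1
    have hR2 : Rep S s2 := hR1.congr h2m fun r hr => h2r r (Or.inl hr)
    obtain ⟨s3, h3, h3v, h3m, h3r⟩ := f.exec hD hN hS hl.2.1 1 s2 hR2
    have hR3 : Rep S s3 := hR2.congr h3m fun r hr => h3r r (Or.inl hr)
    have hle := f.eval_le hD hN hS hl.2.1
    refine ⟨_, _, .seq h1 (.seq h2 (.seq h3 (.store _ 1 3))), le_scale_self hD _, ?_,
      hS.setArr (hle.trans (scale_mono hD hN hl.2.2.2.2.1 hl.2.2.2.2.2))⟩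
    have h4 : s3.reg 1 = addr S.base a (cell S.base a (e.eval S)) := by
      rw [h3r 1 (by lia)]; exact h2v
    have h5 : s3.reg 3 = f.eval S := h3v
    rw [h4, h5]
    refine hR3.setArr hl.2.2.1 (fun h => ?_) _
    simp only [cell, h, if_true]
    exact Nat.mod_lt _ hS.base_pos
  | seq p q ihp ihq =>
    simp only [legal, Bool.and_eq_true] at hl
    obtain ⟨t1, s1, h1, h1t, hR1, hS1⟩ := ihp hl.1 hS s hR
    obtain ⟨t2, s2, h2, h2t, hR2, hS2⟩ := ihq hl.2 hS1 s1 hR1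
    exact ⟨_, s2, .seq h1 h2, (Nat.add_le_add h1t h2t).trans (scale_add_le hD hN _ _), hR2, hS2⟩
  | ite e p q ihp ihq =>
    simp only [legal, Bool.and_eq_true] at hl
    obtain ⟨s1, h1, h1v, h1m, h1r⟩ := e.exec hD hN hS hl.1 0 s hR
    have hR1 : Rep S s1 := hR.congr h1m fun r hr => h1r r (Or.inl hr)
    have h1v' : s1.reg 1 = e.eval S := h1v
    have hcost : ∀ t, t ≤ scale D N (p.cost B) ∨ t ≤ scale D N (q.cost B) →
        e.time + (t + 1) ≤ scale D N (cost B (ite e p q)) := by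
      intro t ht
      have g1 := le_scale_self (N := N) hD (e.time + 1)
      have g2 : t ≤ scale D N (max (p.cost B).1 (q.cost B).1, max (p.cost B).2 (q.cost B).2) := by
        rcases ht with ht | ht
        · exact ht.trans (scale_mono hD hN (le_max_left _ _) (le_max_left _ _))
        · exact ht.trans (scale_mono hD hN (le_max_right _ _) (le_max_right _ _))
      have g3 := scale_add_le hD hN (e.time + 1, 0)
        (max (p.cost B).1 (q.cost B).1, max (p.cost B).2 (q.cost B).2)
      simp only [cost]
      simp only [Nat.zero_max] at g3
      lia
    simp only [run]
    by_cases h0 : e.eval S = 0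
    · obtain ⟨t2, s2, h2, h2t, hR2, hS2⟩ := ihq hl.2.2 hS s1 hR1
      rw [if_neg (by simpa using h0)]
      exact ⟨_, s2, .seq h1 (.condFalse (h1v'.trans h0) h2), hcost _ (Or.inr h2t), hR2, hS2⟩
    · obtain ⟨t2, s2, h2, h2t, hR2, hS2⟩ := ihp hl.2.1 hS s1 hR1
      rw [if_pos h0]
      exact ⟨_, s2, .seq h1 (.condTrue (by rwa [h1v']) h2), hcost _ (Or.inl h2t), hR2, hS2⟩
  | forTo x y p ih =>
    simp only [legal, Bool.and_eq_true, le_iff, Bool.not_eq_true', bne_iff_ne] at hl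
    obtain ⟨hlp, hx, hy, hxy, hle, hsm⟩ := hl
    set W := (D * N) ^ c with hW
    set M := S.var y with hM
    have hMle : M ≤ scale D N (B.var x) :=
      (hS.var_le y).trans (scale_mono hD hN hle.1 hle.2)
    have hMW : M < W := lt_of_small hD hN hsm hMle
    have h1W : 1 < W := by
      refine lt_of_le_of_lt (b := scale D N (1, 0)) (le_scale_self hD 1) (scale_lt hD hN ?_ ?_) <;>
        rw [small_iff] at hsm <;> simp only <;> lia
    -- `F m` is the store after m passes; `key` runs the i passes that remain after pass j.
    set F : ℕ → Store :=
      fun m => Nat.rec (S.setVar x 0) (fun j S' => (p.run S').setVar x (j + 1)) m with hF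
    have hFx : ∀ m, (F m).var x = m := by rintro (_ | m) <;> simp [hF]
    have hFy : ∀ m, (F m).var y = M := by
      intro m
      induction m with
      | zero => simp [hF, Ne.symm hxy, hM]
      | succ m ihm =>
        simp only [hF] at ihm ⊢
        simp [Ne.symm hxy, p.run_var hy, ihm]
    set T := scale D N (p.cost B) with hT
    have hT1 : 1 ≤ T := scale_pos hD hN _
    have key : ∀ i j, i + j = M → ∀ s1, Rep (F j) s1 → Bounded D N B (F j) →
        s1.reg 1 = (if j < M then 1 else 0) →
        ∃ t s2, Exec W (.loop 1 (.seq p.compile (.seq (.const 3 1)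
          (.seq (.op .add (2 * x + 2) (2 * x + 2) 3)
          (.op .lt 1 (2 * x + 2) (2 * y + 2)))))) s1 t s2 ∧ t ≤ i * (T + 4) + 1 ∧ Rep (F M) s2 ∧
          Bounded D N B (F M) := by
      intro i
      induction i with
      | zero =>
        intro j hj s1 h1 h2 h3
        have : j = M := by lia
        subst this
        exact ⟨1, s1, .loopDone (by simpa using h3), by lia, h1, h2⟩
      | succ i ihi =>
        intro j hj s1 h1 h2 h3
        obtain ⟨t2, s2, e2, ht2, hR2, hB2⟩ := ih hlp h2 s1 h1
        have hxj : s2.reg (2 * x + 2) = j := by rw [hR2.var, p.run_var hx, hFx]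
        have hyj : s2.reg (2 * y + 2) = M := by rw [hR2.var, p.run_var hy, hFy]
        have hyx : 2 * y + 2 ≠ 2 * x + 2 := by lia
        obtain ⟨t3, s3, e3, ht3, hR3, hB3⟩ := ihi (j + 1) (by lia)
          (((s2.setReg 3 1).setReg (2 * x + 2) (j + 1)).setReg 1 (if j + 1 < M then 1 else 0))
          (by
            refine hR2.setVar x (j + 1) rfl fun r hr => ?_
            have g1 : r ≠ 1 := by lia
            have g3 : r ≠ 3 := by lia
            simp [State.setReg, Function.update_apply, g1, g3])
          (hB2.setVar (by lia))
          (by simp [State.setReg])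
        refine ⟨_, s3, .loopStep (by rw [h3, if_pos (by lia)]; exact one_ne_zero)
          (.seq e2 (.seq (t₁ := 1) (t₂ := 2) (.const _ _ _ h1W)
            (.seq (t₁ := 1) (t₂ := 1) (.op _ .add (2 * x + 2) (2 * x + 2) 3 ?_) ?_))) e3, ?_,
          hR3, hB3⟩
        · simp only [State.setReg, Op.eval]
          simp [Function.update_apply, hxj]
          lia
        · have e4 := Exec.op (W := W) ((s2.setReg 3 1).setReg (2 * x + 2) (j + 1)) .lt 1
            (2 * x + 2) (2 * y + 2) (by simp only [Op.eval]; split_ifs <;> lia)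
          have g1 : ((s2.setReg 3 1).setReg (2 * x + 2) (j + 1)).reg (2 * x + 2) = j + 1 := by
            simp [State.setReg]
          have g2 : ((s2.setReg 3 1).setReg (2 * x + 2) (j + 1)).reg (2 * y + 2) = M := by
            simp [State.setReg, Function.update_apply, hyx, hyj, Ne.symm hxy]
          have g3 : Op.add.eval ((s2.setReg 3 1).reg (2 * x + 2)) ((s2.setReg 3 1).reg 3) = j + 1 := by
            simp [State.setReg, Function.update_apply, hxj, Op.eval]
          rw [g1, g2] at e4
          rw [g3]
          exact e4
        · have : (i + 1) * (T + 4) = i * (T + 4) + (T + 4) := by ring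
          lia
    have hR0 : Rep (F 0) ((s.setReg (2 * x + 2) 0).setReg 1 (if 0 < M then 1 else 0)) := by
      refine hR.setVar x 0 rfl fun r hr => ?_
      have g1 : r ≠ 1 := by lia
      simp [State.setReg, Function.update_apply, g1]
    have hB0 : Bounded D N B (F 0) := hS.setVar (Nat.zero_le _)
    obtain ⟨t, s2, e2, ht, hR2, hB2⟩ := key M 0 (by lia) _ hR0 hB0 (by simp [State.setReg])
    have hyx : 2 * y + 2 ≠ 2 * x + 2 := by lia
    refine ⟨_, s2, .seq (.const _ _ _ (by lia)) (.seq (t₁ := 1) ?_ e2), ?_, hR2, hB2⟩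
    · have e4 := Exec.op (W := W) (s.setReg (2 * x + 2) 0) .lt 1
        (2 * x + 2) (2 * y + 2) (by simp only [Op.eval]; split_ifs <;> lia)
      have g1 : (s.setReg (2 * x + 2) 0).reg (2 * x + 2) = 0 := by simp [State.setReg]
      have g2 : (s.setReg (2 * x + 2) 0).reg (2 * y + 2) = M := by
        simp [State.setReg, Function.update_apply, hyx, hR.var, hM, Ne.symm hxy]
      rw [g1, g2] at e4
      exact e4
    · have g1 : M * T ≤ scale D N ((B.var y).1 + (p.cost B).1, (B.var y).2 + (p.cost B).2) :=
        (Nat.mul_le_mul_right _ (hS.var_le y)).trans (scale_mul _ _).le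
      have g2 := scale_pos hD hN ((B.var y).1 + (p.cost B).1, (B.var y).2 + (p.cost B).2)
      have g3 := two_pow_mul_scale_le (N := N) hD 6
        ((B.var y).1 + (p.cost B).1, (B.var y).2 + (p.cost B).2)
      -- As T ≥ 1, the whole loop takes at most 5MT + 3 steps, which the factor 2^6 in the cost
      -- covers.
      have g4 : M * (T + 4) ≤ 5 * (M * T) := by nlinarith [Nat.zero_le M, Nat.zero_le T]
      simp only [cost]
      simp only at g3
      lia

end

end Imp

/-! ### Connected sets of vertices -/

namespace SimpleGraph

variable {V : Type*} {G : SimpleGraph V}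

theorem connected_induce_singleton (v : V) : (G.induce {v}).Connected := by
  have : Nonempty ({v} : Set V) := ⟨⟨v, rfl⟩⟩
  refine ⟨fun a b => ?_⟩
  have : a = b := Subtype.ext (a.2.trans b.2.symm)
  rw [this]

theorem Connected.exists_adj_boundary {X S : Set V} (hX : (G.induce X).Connected) {a b : V}
    (ha : a ∈ X) (haS : a ∈ S) (hb : b ∈ X) (hbS : b ∉ S) :
    ∃ x ∈ S, ∃ y ∈ X, y ∉ S ∧ G.Adj x y := by
  obtain ⟨p⟩ := hX.preconnected ⟨a, ha⟩ ⟨b, hb⟩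
  obtain ⟨d, -, h1, h2⟩ := p.exists_boundary_dart {x | x.1 ∈ S} haS hbS
  exact ⟨_, h1, _, d.toProd.2.2, h2, d.adj⟩

/-- A connected set with a root `v` and at least one further vertex splits along an edge at the
root into two connected sets. -/
theorem exists_connected_partition [DecidableEq V] {X : Finset V} {v : V} (hv : v ∈ X)
    (hX : (G.induce (X : Set V)).Connected) (h2 : 2 ≤ X.card) :
    ∃ A B : Finset V, ∃ u, v ∈ A ∧ u ∈ B ∧ G.Adj v u ∧ Disjoint A B ∧ A ∪ B = X ∧
      (G.induce (A : Set V)).Connected ∧ (G.induce (B : Set V)).Connected := by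
  classical
  obtain ⟨b, hb, hbv⟩ := Finset.exists_mem_ne h2 v
  obtain ⟨v', hv', u, huX, huv, hadj⟩ := hX.exists_adj_boundary (S := {v}) hv rfl hb hbv
  rw [Set.mem_singleton_iff.1 hv'] at hadj
  -- Among the disjoint connected pairs with v in one part and u in the other, one with the largest
  -- union is taken. If it missed a vertex of X, an edge would leave the union, and its endpoint
  -- could be added to the part that it is attached to.
  set P : Finset V × Finset V → Prop := fun p => v ∈ p.1 ∧ u ∈ p.2 ∧ Disjoint p.1 p.2 ∧
    p.1 ∪ p.2 ⊆ X ∧ (G.induce (p.1 : Set V)).Connected ∧ (G.induce (p.2 : Set V)).Connected with hP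
  have hne : ((X.powerset ×ˢ X.powerset).filter P).Nonempty := by
    refine ⟨({v}, {u}), Finset.mem_filter.2 ⟨?_, ?_⟩⟩
    · simpa using ⟨hv, huX⟩
    · refine ⟨by simp, by simp, by simpa using hadj.ne, ?_, ?_, ?_⟩
      · intro x; simp only [Finset.mem_union, Finset.mem_singleton]
        rintro (rfl | rfl) <;> assumption
      · rw [Finset.coe_singleton]; exact connected_induce_singleton (G := G) v
      · rw [Finset.coe_singleton]; exact connected_induce_singleton (G := G) u
  obtain ⟨⟨A, B⟩, hAB, hmax⟩ := Finset.exists_max_image _ (fun p => (p.1 ∪ p.2).card) hne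
  simp only [Finset.mem_filter, hP] at hAB
  obtain ⟨-, hvA, huB, hdis, hsub, hA, hB⟩ := hAB
  refine ⟨A, B, u, hvA, huB, hadj, hdis, ?_, hA, hB⟩
  by_contra hneq
  obtain ⟨w, hwX, hw⟩ : ∃ w ∈ X, w ∉ A ∪ B := by
    by_contra! h
    exact hneq (Finset.Subset.antisymm hsub h)
  obtain ⟨x, hx, y, hyX, hy, hxy⟩ := hX.exists_adj_boundary (S := ((A ∪ B : Finset V) : Set V))
    hv (by simp [hvA]) hwX (by simpa using hw)
  have hyA : y ∉ A := fun h => hy (by simp [h])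
  have hyB : y ∉ B := fun h => hy (by simp [h])
  have hgrow : ∀ C : Finset V, (G.induce (C : Set V)).Connected → x ∈ C →
      (G.induce ((insert y C : Finset V) : Set V)).Connected := by
    intro C hC hxC
    have := connected_induce_union hC.preconnected
      (connected_induce_singleton (G := G) y).preconnected hxC rfl hxy
    rw [Finset.coe_insert, Set.insert_eq, Set.union_comm]
    exact this
  have hcontra : ∀ A' B' : Finset V, P (A', B') → A' ∪ B' = insert y (A ∪ B) → False := by
    intro A' B' h1 h2
    have h3 := hmax (A', B') (Finset.mem_filter.2 ⟨?_, h1⟩)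
    · simp only [h2] at h3
      rw [Finset.card_insert_of_notMem (by simpa using hy)] at h3
      lia
    · simp only [Finset.mem_product, Finset.mem_powerset]
      exact ⟨Finset.subset_union_left.trans h1.2.2.2.1, Finset.subset_union_right.trans h1.2.2.2.1⟩
  have hins : insert y (A ∪ B) ⊆ X := Finset.insert_subset hyX hsub
  rcases (by simpa using hx : x ∈ A ∨ x ∈ B) with hxA | hxB
  · refine hcontra (insert y A) B ⟨by simp [hvA], huB, ?_, ?_, hgrow A hA hxA, hB⟩ ?_
    · simpa [Finset.disjoint_insert_left] using ⟨hyB, hdis⟩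
    · simpa [Finset.insert_union] using hins
    · simp
  · refine hcontra A (insert y B) ⟨hvA, by simp [huB], ?_, ?_, hA, hgrow B hB hxB⟩ ?_
    · simpa [Finset.disjoint_insert_right] using ⟨hyA, hdis⟩
    · simpa [Finset.union_insert] using hins
    · simp

end SimpleGraph

/-! ### A bilinear form that detects disjointness -/

section Monomials
variable {R : Type*} [CommRing R]

/-- Reading `m` bits of `b`, starting with the index `i`: a bit `1` contributes the factor `c i`,
and a bit `0` increments the index. -/
def bitMonomial (c : ℕ → R) : ℕ → ℕ → ℕ → R
  | 0, _, _ => 1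
  | m + 1, i, b => if b % 2 = 1 then c i * bitMonomial c m i (b / 2)
      else bitMonomial c m (i + 1) (b / 2)

/-- The elements of s are emitted in increasing order: a bit 1 for each copy of the current index, a
bit 0 to advance it. This takes `s.card` ones and p - i zeros, and the code does not depend on c. -/
theorem exists_bitMonomial_eq (p m : ℕ) : ∀ (i : ℕ) (s : Multiset ℕ), (∀ x ∈ s, i ≤ x ∧ x ≤ p) →
    i ≤ p → s.card + (p - i) = m →
    ∃ b < 2 ^ m, ∀ c : ℕ → R, bitMonomial c m i b = (s.map c).prod := by
  induction m with
  | zero =>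
    intro i s _ _ hm
    have : s = 0 := by rw [← Multiset.card_eq_zero]; lia
    exact ⟨0, by simp, fun c => by simp [bitMonomial, this]⟩
  | succ m ih =>
    intro i s hs hi hm
    by_cases his : i ∈ s
    · obtain ⟨s', rfl⟩ := Multiset.exists_cons_of_mem his
      obtain ⟨b, hb, h⟩ := ih i s' (fun x hx => hs x (by simp [hx])) hi
        (by rw [Multiset.card_cons] at hm; lia)
      refine ⟨2 * b + 1, by rw [pow_succ]; lia, fun c => ?_⟩
      have h1 : (2 * b + 1) % 2 = 1 := by lia
      have h2 : (2 * b + 1) / 2 = b := by lia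
      simp [bitMonomial, h1, h2, h]
    · have hip : i < p := by
        by_contra hip
        have : s = 0 := Multiset.eq_zero_of_forall_notMem fun x hx => by
          have := hs x hx
          have : x = i := by lia
          exact his (this ▸ hx)
        simp [this] at hm
        lia
      obtain ⟨b, hb, h⟩ := ih (i + 1) s (fun x hx => by
        have := hs x hx
        have : x ≠ i := fun h => his (h ▸ hx)
        lia) hip (by lia)
      refine ⟨2 * b, by rw [pow_succ]; lia, fun c => ?_⟩
      simp [bitMonomial, h]

open Polynomial in
/-- The product of the values of a polynomial at `k - p` points is a linear form in the vector of
its bit monomials. -/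
theorem exists_linear_form {p k : ℕ} (hpk : p ≤ k) {ι : Type*} (Y : Finset ι)
    (hY : Y.card = k - p) (y : ι → R) :
    ∃ l : ℕ → R, ∀ P : R[X], P.natDegree ≤ p →
      ∑ b ∈ Finset.range (2 ^ k), l b * bitMonomial P.coeff k 0 b = ∏ j ∈ Y, P.eval (y j) := by
  classical
  have hmask : ∀ f : (j : ι) → j ∈ Y → ℕ, f ∈ Y.pi (fun _ => Finset.range (p + 1)) →
      ∃ b < 2 ^ k, ∀ c : ℕ → R, bitMonomial c k 0 b = ∏ j ∈ Y.attach, c (f j.1 j.2) := by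
    intro f hf
    obtain ⟨b, hb, h⟩ := exists_bitMonomial_eq (R := R) p k 0
      (Y.attach.1.map fun j : {j // j ∈ Y} => f j.1 j.2) (by
        intro x hx
        obtain ⟨j, -, rfl⟩ := Multiset.mem_map.1 hx
        have := Finset.mem_pi.1 hf j.1 j.2
        simp at this
        lia) (Nat.zero_le _) (by
        rw [Multiset.card_map, Finset.card_val, Finset.card_attach]
        lia)
    exact ⟨b, hb, fun c => by rw [h c, Multiset.map_map]; rfl⟩
  choose! B hB hBc using hmask
  -- Expanding the product chooses an exponent `f j` for every point of Y. The form collects the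
  -- resulting powers of the points according to the mask `B f` of the monomial in the coefficients;
  -- none of this depends on P.
  refine ⟨fun b => ∑ f ∈ Y.pi (fun _ => Finset.range (p + 1)),
    if B f = b then ∏ j ∈ Y.attach, y j.1 ^ f j.1 j.2 else 0, fun P hP => ?_⟩
  have h1 : ∏ j ∈ Y, P.eval (y j) =
      ∏ j ∈ Y, ∑ i ∈ Finset.range (p + 1), P.coeff i * y j ^ i :=
    Finset.prod_congr rfl fun j _ => Polynomial.eval_eq_sum_range' (by lia) _
  rw [h1, Finset.prod_sum]
  simp only [Finset.sum_mul]
  rw [Finset.sum_comm]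
  refine Finset.sum_congr rfl fun f hf => ?_
  simp only [ite_mul, zero_mul]
  rw [Finset.sum_ite_eq, if_pos (Finset.mem_range.2 (hB f hf)), hBc f hf, Finset.prod_mul_distrib,
    mul_comm]

end Monomials

/-! ### The program -/

namespace Imp
open WordRAM Imp.Expr Imp.Cmd

instance : Add Expr := ⟨bin .add⟩
instance : Sub Expr := ⟨bin .sub⟩
instance : Mul Expr := ⟨bin .mul⟩
instance : Div Expr := ⟨bin .div⟩

section Eval
variable (S : Store) (e f : Expr) (m x a : ℕ)
@[simp] theorem Expr.eval_add : (e + f).eval S = e.eval S + f.eval S := rfl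
@[simp] theorem Expr.eval_sub : (e - f).eval S = e.eval S - f.eval S := rfl
@[simp] theorem Expr.eval_mul : (e * f).eval S = e.eval S * f.eval S := rfl
@[simp] theorem Expr.eval_div : (e / f).eval S = e.eval S / f.eval S := rfl
@[simp] theorem Expr.eval_const : (const m).eval S = m := rfl
@[simp] theorem Expr.eval_var : (var x).eval S = S.var x := rfl
@[simp] theorem Expr.eval_modSucc : (modSucc e f).eval S = e.eval S % (f.eval S + 1) := rfl
@[simp] theorem Expr.eval_lt :
    (bin .lt e f).eval S = if e.eval S < f.eval S then 1 else 0 := rfl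
@[simp] theorem Expr.eval_eq :
    (bin .eq e f).eval S = if e.eval S = f.eval S then 1 else 0 := rfl
theorem Expr.eval_read : (read a e).eval S = S.arr a (cell S.base a (e.eval S)) := rfl
@[simp] theorem Expr.eval_read_ofNat (a : ℕ) [a.AtLeastTwo] :
    (read ofNat(a) e).eval S = S.arr ofNat(a) (e.eval S) := by
  have : (OfNat.ofNat a : ℕ) ≠ 0 := NeZero.ne (OfNat.ofNat a : ℕ)
  simp [eval, cell, this]
@[simp] theorem Expr.eval_read_one : (read 1 e).eval S = S.arr 1 (e.eval S) := rfl
@[simp] theorem cell_one (b i : ℕ) : cell b 1 i = i := rfl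
@[simp] theorem cell_ofNat (b a i : ℕ) [a.AtLeastTwo] : cell b ofNat(a) i = i := by
  have : (OfNat.ofNat a : ℕ) ≠ 0 := NeZero.ne (OfNat.ofNat a : ℕ)
  simp [cell, this]
end Eval

section Run
variable (S : Store) (p q : Cmd) (e f : Expr) (x a : ℕ)
@[simp] theorem Cmd.run_skip : Cmd.skip.run S = S := rfl
@[simp] theorem Cmd.run_set : (Cmd.set x e).run S = S.setVar x (e.eval S) := rfl
@[simp] theorem Cmd.run_write :
    (write a e f).run S = S.setArr a (cell S.base a (e.eval S)) (f.eval S) := rfl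
@[simp] theorem Cmd.run_seq : (Cmd.seq p q).run S = q.run (p.run S) := rfl
theorem Cmd.run_ite_pos {e : Expr} {S : Store} (h : e.eval S ≠ 0) :
    (Cmd.ite e p q).run S = p.run S := by
  simp [run, h]
theorem Cmd.run_ite_neg {e : Expr} {S : Store} (h : e.eval S = 0) :
    (Cmd.ite e p q).run S = q.run S := by
  simp [run, h]
end Run

infixr:60 " ;; " => Cmd.seq

-- `vQ` holds q - 1, the second argument that `modSucc` wants for reduction modulo q. `vD` is 2^k,
-- `vT` = 8^k is the number of slots of one root, and `vNT` that of all roots. `vN1` and `vK1` hold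
-- n + 1 and k + 1, because loop limits must be variables.
notation "vN" => 0
notation "vK" => 1
notation "vD" => 2
notation "vT" => 3
notation "vNT" => 4
notation "vN1" => 5
notation "vQ" => 6
notation "vK1" => 7
notation "vC" => 8
notation "vCand" => 9
notation "vIsPrime" => 10
notation "vDiv" => 11
notation "vV" => 12
notation "vU" => 13
notation "vS1" => 14
notation "vS2" => 15
notation "vA1" => 16
notation "vA2" => 17
notation "vP1" => 18
notation "vP2" => 19
notation "vP" => 20
notation "vR" => 21
notation "vOk" => 22
notation "vRound" => 23
notation "vI" => 24
notation "vJ" => 25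
notation "vPrev" => 26
notation "vCur" => 27
notation "vB" => 28
notation "vBits" => 29
notation "vProd" => 30
notation "vIdx" => 31
notation "vSlot" => 32
notation "vX" => 33
notation "vY" => 34
notation "vS" => 35

-- `aSize`, `aRed`, `aList` and `aRow` describe the slots; size 0 marks a free slot. `aBuf` is the
-- set being inserted, and `aCoef` and `aVec` are its polynomial and its vector.
notation "aMem" => 0
notation "aSize" => 1
notation "aRed" => 2
notation "aList" => 3
notation "aRow" => 4
notation "aBuf" => 5
notation "aCoef" => 6
notation "aVec" => 7

def zeroCoef : Cmd := .forTo vJ vK1 (.write aCoef (var vJ) (const 0))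

/-- Multiplication by X + a in place: c_j becomes c_(j-1) + a c_j, where `vPrev` remembers the old
c_(j-1). -/
def mulCoefInner : Cmd := .forTo vJ vK1 (.set vCur (read aCoef (var vJ)) ;;
  .write aCoef (var vJ) ((var vPrev + read aBuf (var vI) * var vCur).modSucc (var vQ)) ;;
  .set vPrev (var vCur))

def mulCoef : Cmd := .forTo vI vP (.set vPrev (const 0) ;; mulCoefInner)

/-- Compute the coefficients of the polynomial whose roots are the negatives of the vertices in the
buffer. -/
def coefCmd : Cmd := zeroCoef ;; .write aCoef (const 0) (const 1) ;; mulCoef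

def bitsCmd : Cmd := .forTo vJ vK (.ite ((var vBits).modSucc (const 1))
    (.set vProd ((var vProd * read aCoef (var vIdx)).modSucc (var vQ)))
    (.set vIdx ((var vIdx + const 1).modSucc (var vK))) ;;
  .set vBits (var vBits / const 2))

/-- Compute the vector of bit monomials. -/
def vecCmd : Cmd := .forTo vB vD (.set vProd (const 1) ;; .set vIdx (const 0) ;;
  .set vBits (var vB) ;; bitsCmd ;; .write aVec (var vB) ((var vProd).modSucc (var vQ)))

/-- Cross-multiplication of the vector and the row cancels the pivot without inverses modulo q; q -
x stands for -x. -/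
def eliminateCmd : Cmd := .forTo vJ vD (.write aVec (var vJ)
  ((read aVec (var vJ) * var vY +
    (var vQ + const 1 - var vX) * read aRow (var vSlot * var vD + var vJ)).modSucc (var vQ)))

def storeCmd : Cmd := .write aSize (var vSlot) (var vP) ;; .write aRed (var vSlot) (var vR) ;;
  .forTo vI vP (.write aList (var vSlot * var vK + var vI) (read aBuf (var vI))) ;;
  .forTo vJ vD (.write aRow (var vSlot * var vD + var vJ) (read aVec (var vJ))) ;;
  -- Clearing the vector turns the remaining elimination steps into no-ops.
  .forTo vJ vD (.write aVec (var vJ) (const 0))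

/-- The pivot is part of the address, so no search is needed and a family has at most 2^k members.
-/
def reduceStep : Cmd := .ite (read aVec (var vB))
  (.set vSlot (((var vV * var vD + var vP) * var vD + var vR) * var vD + var vB) ;;
    .ite (read aSize (var vSlot))
      (.set vX (read aVec (var vB)) ;; .set vY (read aRow (var vSlot * var vD + var vB)) ;;
        eliminateCmd)
      storeCmd)
  .skip

/-- Insert the set in the buffer into the family of the root unless it is represented already. -/
def insertCmd : Cmd := coefCmd ;; vecCmd ;; .forTo vB vD reduceStep

/-- The candidates n + 2, ..., 2n + 2 include a prime by Bertrand's postulate; the last prime found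
is kept. Trial division by all smaller numbers is affordable, as time quadratic in n is allowed. -/
def primeCmd : Cmd := .forTo vC vN1 (.set vCand (var vN1 + const 1 + var vC) ;;
  .set vIsPrime (const 1) ;;
  .forTo vDiv vCand (.ite (bin .lt (var vDiv + const 2) (var vCand) *
      bin .eq ((var vCand).modSucc (var vDiv + const 1)) (const 0))
    (.set vIsPrime (const 0)) .skip) ;;
  .ite (var vIsPrime) (.set vQ (var vCand - const 1)) .skip)

def setupCmd : Cmd := .set vT (var vD * var vD * var vD) ;; .set vNT (var vN * var vT) ;;
  .set vN1 (var vN + const 1) ;; .set vK1 (var vK + const 1) ;; primeCmd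

def singletonsCmd : Cmd := .forTo vV vN (.write aBuf (const 0) (var vV) ;; .set vP (const 1) ;;
  .set vR (const 1 - read aMem (const 2 + var vV)) ;; insertCmd)

def copyCmd : Cmd := .forTo vI vP1 (.write aBuf (var vI) (read aList (var vA1 * var vK + var vI))) ;;
  .forTo vI vP2 (.write aBuf (var vP1 + var vI) (read aList (var vA2 * var vK + var vI)))

def disjointCmd : Cmd := .set vOk (const 1) ;; .forTo vI vP1 (.forTo vJ vP2
  (.ite (bin .eq (read aList (var vA1 * var vK + var vI)) (read aList (var vA2 * var vK + var vJ)))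
    (.set vOk (const 0)) .skip))

/-- Insert the union of two sets if they are disjoint and the union is not too large. -/
def mergeCmd : Cmd := .set vA1 (var vV * var vT + var vS1) ;; .set vA2 (var vU * var vT + var vS2) ;;
  .set vP1 (read aSize (var vA1)) ;; .set vP2 (read aSize (var vA2)) ;;
  .ite (bin .lt (const 0) (var vP1) * bin .lt (const 0) (var vP2) *
      bin .lt (var vP1 + var vP2) (var vK1))
    (disjointCmd ;; .ite (var vOk)
      -- The remainders modulo k + 1 change nothing, since both values are at most k; they only
      -- provide the static bounds.
      (copyCmd ;; .set vP ((var vP1 + var vP2).modSucc (var vK)) ;;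
        .set vR ((read aRed (var vA1) + read aRed (var vA2)).modSucc (var vK)) ;; insertCmd)
      .skip)
    .skip

def roundCmd : Cmd := .forTo vV vN (.forTo vU vN
  (.ite (read aMem (const 2 + var vN + (var vN * var vV + var vU)))
    (.forTo vS1 vT (.forTo vS2 vT mergeCmd)) .skip))

def outputCmd : Cmd := .write aMem (const 0) (const 0) ;; .forTo vS vNT
  (.ite (bin .eq (read aSize (var vS)) (var vK) *
      bin .eq (read aRed (var vS) + read aRed (var vS)) (var vK))
    (.write aMem (const 0) (const 1) ;;
      .forTo vI vK (.write aMem (const 1 + var vI) (read aList (var vS * var vK + var vI))))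
    .skip)

def mainCmd : Cmd := setupCmd ;; singletonsCmd ;; .forTo vRound vK roundCmd ;; outputCmd

/-- Exponents of bounds on the variables and the entries of the arrays of the program. -/
def mainTable : Table where
  var x := ([(0, 1), (1, 0), (1, 0), (3, 0), (3, 1), (2, 1), (4, 1), (2, 0), (2, 1), (4, 1), (1, 0),
    (4, 1), (0, 1), (0, 1), (3, 0), (3, 0), (4, 1), (4, 1), (1, 0), (1, 0), (1, 0), (1, 0), (1, 0),
    (1, 0), (1, 0), (2, 0), (4, 1), (4, 1), (1, 0), (1, 0), (4, 1), (1, 0), (6, 1), (4, 1), (4, 1),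
    (3, 1)] : List (ℕ × ℕ)).getD x (0, 0)
  arr a := ([(1, 1), (1, 0), (1, 0), (1, 1), (4, 1), (1, 1), (4, 1), (4, 1)] :
    List (ℕ × ℕ)).getD a (0, 0)

/-- The check depends on the program text alone; neither n nor k occurs in it. -/
theorem mainCmd_legal : mainCmd.legal 200 mainTable = true := by
  decide

/-- The exponent 2 of N reflects that at most two nested loops have limits that grow with n. -/
theorem mainCmd_cost : (mainCmd.cost mainTable).1 ≤ 196 ∧ (mainCmd.cost mainTable).2 = 2 := by
  decide

end Imp

/-! ### Computing the vector of a set -/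

namespace Imp
open WordRAM Imp.Expr Imp.Cmd Polynomial

/-- The premise of `hstep` that cells not yet reached keep their old values allows a loop to read
the very cell that it overwrites, as `eliminateCmd` does. -/
theorem run_fill {x y a : ℕ} {e f : Expr} {S : Store} (N : ℕ) (hN : S.var y = N)
    (g h : ℕ → ℕ) (hg : ∀ i < N, ∀ j < N, g i = g j → i = j)
    (hstep : ∀ j < N, ∀ S' : Store, (∀ z, z ≠ x → S'.var z = S.var z) → S'.var x = j →
      (∀ b, b ≠ a → S'.arr b = S.arr b) → (∀ m, (∀ i < j, m ≠ g i) → S'.arr a m = S.arr a m) →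
      cell S.base a (e.eval S') = g j ∧ f.eval S' = h j) :
    (∀ i < N, ((forTo x y (write a e f)).run S).arr a (g i) = h i) ∧
      ∀ m, (∀ i < N, m ≠ g i) → ((forTo x y (write a e f)).run S).arr a m = S.arr a m := by
  have key := Cmd.run_forTo (x := x) (y := y) (p := write a e f) (S := S) N hN
    (fun j S' => S'.base = S.base ∧ (∀ z, z ≠ x → S'.var z = S.var z) ∧ (∀ b, b ≠ a → S'.arr b = S.arr b) ∧
      (j ≤ N → ∀ i < j, S'.arr a (g i) = h i) ∧
      ∀ m, (∀ i < j, m ≠ g i) → S'.arr a m = S.arr a m)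
    ⟨rfl, fun z hz => by simp [hz], fun b _ => rfl, fun _ i hi => by lia, fun m _ => rfl⟩
    (by
      rintro j hj S' ⟨h0, h1, h2, h3, h4⟩ hx
      obtain ⟨he, hf⟩ := hstep j hj S' h1 hx h2 h4
      refine ⟨by simpa using h0, fun z hz => by simp [hz, h1 z hz], fun b hb => ?_, fun _ i hi => ?_, fun m hm => ?_⟩
      · funext m; simp [hb, h2 b hb]
      · simp only [run_write, h0, he, hf, Store.arr_setVar, Store.arr_setArr, true_and]
        split_ifs with hij
        · rw [hg i (by lia) j hj hij]
        · exact h3 (by lia) i (by rcases Nat.lt_succ_iff_lt_or_eq.1 hi with h | rfl; exacts [h, absurd rfl hij])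
      · simp only [run_write, h0, he, hf, Store.arr_setVar, Store.arr_setArr, true_and,
          if_neg (hm j (by lia))]
        exact h4 m fun i hi => hm i (by lia))
  exact ⟨key.2.2.2.1 le_rfl, key.2.2.2.2⟩

/-- The polynomial whose roots are the negatives of the first `p` values of `x`. -/
noncomputable def polyOf (q : ℕ) (x : ℕ → ℕ) (p : ℕ) : (ZMod q)[X] :=
  ∏ i ∈ Finset.range p, (X + C (x i : ZMod q))

noncomputable def vecOf (q k : ℕ) (x : ℕ → ℕ) (p b : ℕ) : ZMod q :=
  bitMonomial (polyOf q x p).coeff k 0 b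

theorem polyOf_congr {q p : ℕ} {x y : ℕ → ℕ} (h : ∀ i < p, x i = y i) :
    polyOf q x p = polyOf q y p :=
  Finset.prod_congr rfl fun i hi => by rw [h i (Finset.mem_range.1 hi)]

theorem vecOf_congr {q k p : ℕ} {x y : ℕ → ℕ} (h : ∀ i < p, x i = y i) :
    vecOf q k x p = vecOf q k y p := by
  funext b; rw [vecOf, vecOf, polyOf_congr h]

theorem mulCoefInner_spec {q k i x : ℕ} {S : Store} {P : (ZMod q)[X]} (hq : S.var vQ + 1 = q)
    (hk : S.var vK1 = k + 1) (hi : S.var vI = i) (hx : S.arr aBuf i = x)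
    (hprev : S.var vPrev = 0) (hP : ∀ j ≤ k, (S.arr aCoef j : ZMod q) = P.coeff j) :
    ∀ j ≤ k, ((mulCoefInner.run S).arr aCoef j : ZMod q) = (P * (X + C (x : ZMod q))).coeff j := by
  have key := Cmd.run_forTo (x := vJ) (y := vK1) (p := .set vCur (read aCoef (var vJ)) ;;
    .write aCoef (var vJ) ((var vPrev + read aBuf (var vI) * var vCur).modSucc (var vQ)) ;;
    .set vPrev (var vCur)) (S := S) (k + 1) hk
    -- Below j the coefficients are new, from j on they are old, and `vPrev` is the old coefficient
    -- before j.
    (fun j S' => S'.var vQ + 1 = q ∧ S'.var vI = i ∧ S'.arr aBuf i = x ∧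
      ((S'.var vPrev : ZMod q) = if j = 0 then 0 else P.coeff (j - 1)) ∧
      (∀ m < j, (S'.arr aCoef m : ZMod q) = (P * (X + C (x : ZMod q))).coeff m) ∧
      ∀ m, j ≤ m → m ≤ k → (S'.arr aCoef m : ZMod q) = P.coeff m)
    (by simp [hq, hi, hx, hprev]; exact hP)
    (by
      rintro j hj S' ⟨h1, h2, h3, h4, h5, h6⟩ hx
      have h7 := h6 j le_rfl (by lia)
      simp only [run_seq, run_set, run_write, eval_read_ofNat, eval_var, eval_modSucc, eval_add,
        eval_mul, cell_ofNat]
      simp only [Store.var_setVar, Store.arr_setVar, Store.var_setArr, Store.arr_setArr, hx, h1, h2,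
        h3, OfNat.ofNat_eq_ofNat, Nat.reduceEqDiff, if_false, if_true, true_and, false_and,
        Nat.add_eq_zero_iff, one_ne_zero, and_false, Nat.add_sub_cancel]
      refine ⟨h7, fun m hm => ?_, fun m hm hm' => ?_⟩
      · split_ifs with hmj
        · subst hmj
          rw [ZMod.natCast_mod]
          push_cast
          rw [h4, h7, mul_add, coeff_add, coeff_mul_C]
          rcases m with _ | m
          · simp; ring
          · simp [coeff_mul_X]; ring
        · exact h5 m (by lia)
      · rw [if_neg (by lia)]
        exact h6 m (by lia) hm')
  intro j hj
  exact key.2.2.2.2.1 j (by lia)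

theorem coefCmd_spec {q k : ℕ} {S : Store} (hq : S.var vQ + 1 = q) (hk : S.var vK1 = k + 1) :
    ∀ j ≤ k, ((coefCmd.run S).arr aCoef j : ZMod q) =
      (polyOf q (S.arr aBuf) (S.var vP)).coeff j := by
  set S1 := (zeroCoef ;; .write aCoef (const 0) (const 1)).run S with hS1
  have h0 : ∀ j ≤ k, ((S1.arr aCoef j : ℕ) : ZMod q) = (1 : (ZMod q)[X]).coeff j := by
    intro j hj
    have : (zeroCoef.run S).arr aCoef j = 0 := (run_fill (x := vJ) (y := vK1) (a := aCoef) (e := var vJ) (f := const 0) (S := S)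
      (k + 1) hk id (fun _ => 0) (fun i _ j _ h => h)
      (fun j _ S' _ h _ _ => ⟨h, rfl⟩)).1 j (by lia)
    rw [hS1, run_seq, run_write, Store.arr_setArr, coeff_one]
    simp only [cell_ofNat, eval_const, true_and]
    split_ifs with h
    · simp
    · simp [this]
  have hv : ∀ z, z ≠ vJ → S1.var z = S.var z := fun z hz =>
    Cmd.run_var _ (by simp [zeroCoef, mods, hz]) S
  have hb : S1.arr aBuf = S.arr aBuf := Cmd.run_arr _ (by decide) S
  have key := Cmd.run_forTo (x := vI) (y := vP) (p := .set vPrev (const 0) ;; mulCoefInner) (S := S1)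
    (S.var vP) (hv _ (by decide))
    (fun i S' => S'.var vQ + 1 = q ∧ S'.var vK1 = k + 1 ∧ S'.arr aBuf = S.arr aBuf ∧
      ∀ j ≤ k, (S'.arr aCoef j : ZMod q) = (polyOf q (S.arr aBuf) i).coeff j)
    (by
      refine ⟨by simpa [hv] using hq, by simpa [hv] using hk, hb, fun j hj => ?_⟩
      simpa [polyOf] using h0 j hj)
    (by
      rintro i hi S' ⟨h1, h2, h3, h4⟩ hx
      refine ⟨?_, ?_, ?_, ?_⟩
      · rw [Store.var_setVar, if_neg (by decide), Cmd.run_var _ (by decide), h1]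
      · rw [Store.var_setVar, if_neg (by decide), Cmd.run_var _ (by decide), h2]
      · rw [Store.arr_setVar, Cmd.run_arr _ (by decide), h3]
      · rw [polyOf, Finset.prod_range_succ]
        exact mulCoefInner_spec (S := S'.setVar vPrev 0) (by simpa using h1) (by simpa using h2)
          (by simpa using hx) (by simp [h3]) (by simp) h4)
  exact key.2.2.2

theorem bitsCmd_spec {q k b : ℕ} {c : ℕ → ZMod q} {S : Store} (hq : S.var vQ + 1 = q)
    (hk : S.var vK = k) (hc : ∀ j ≤ k, (S.arr aCoef j : ZMod q) = c j) (hp : S.var vProd = 1)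
    (hi : S.var vIdx = 0) (hb : S.var vBits = b) :
    ((bitsCmd.run S).var vProd : ZMod q) = bitMonomial c k 0 b := by
  have key := Cmd.run_forTo (x := vJ) (y := vK)
    (p := .ite ((var vBits).modSucc (const 1))
    (.set vProd ((var vProd * read aCoef (var vIdx)).modSucc (var vQ)))
    (.set vIdx ((var vIdx + const 1).modSucc (var vK))) ;;
    .set vBits (var vBits / const 2)) (S := S) k hk
    -- The product so far times the monomial of the unread bits is the whole monomial. The index is
    -- at most the number of bits read, so its reduction modulo k + 1 is harmless and only
    -- coefficients up to k are used.
    (fun j S' => S'.var vQ + 1 = q ∧ S'.var vK = k ∧ S'.arr aCoef = S.arr aCoef ∧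
      S'.var vIdx ≤ j ∧ (S'.var vProd : ZMod q) * bitMonomial c (k - j) (S'.var vIdx) (S'.var vBits)
        = bitMonomial c k 0 b)
    (by simp [hq, hk, hp, hi, hb])
    (by
      rintro j hj S' ⟨h1, h2, h3, h4, h5⟩ hx
      have h6 := hc (S'.var vIdx) (by lia)
      obtain ⟨m, hm⟩ : ∃ m, k - j = m + 1 := ⟨k - j - 1, by lia⟩
      have hm' : k - (j + 1) = m := by lia
      rw [hm, bitMonomial] at h5
      rw [hm']
      rw [run_seq]
      by_cases hbit : S'.var vBits % 2 = 1
      · rw [if_pos hbit] at h5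
        rw [run_ite_pos _ _ (by simp [hbit])]
        simp only [run_set, eval_modSucc, eval_mul, eval_var, eval_read_ofNat, h1, h3, eval_div, eval_const, Store.var_setVar,
          Store.arr_setVar, OfNat.ofNat_eq_ofNat, Nat.reduceEqDiff, if_false, if_true]
        refine ⟨trivial, by simpa using h2, trivial, by lia, ?_⟩
        rw [ZMod.natCast_mod]
        push_cast
        rw [h6, mul_assoc, h5]
      · rw [if_neg hbit] at h5
        rw [run_ite_neg _ _ (by simp; lia)]
        have h7 : (S'.var vIdx + 1) % (k + 1) = S'.var vIdx + 1 := Nat.mod_eq_of_lt (by lia)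
        simp only [run_set, eval_modSucc, eval_add, eval_var, eval_div, eval_const, Store.var_setVar,
          Store.arr_setVar, OfNat.ofNat_eq_ofNat, Nat.reduceEqDiff, if_false, if_true, h1, h2, h7]
        refine ⟨trivial, by simp, h3, by lia, h5⟩)
  have := key.2.2.2.2
  rw [Nat.sub_self, bitMonomial, mul_one] at this
  exact this

theorem vecCmd_spec {q k : ℕ} {c : ℕ → ZMod q} {S : Store} (hq : S.var vQ + 1 = q)
    (hk : S.var vK = k) (hD : S.var vD = 2 ^ k)
    (hc : ∀ j ≤ k, (S.arr aCoef j : ZMod q) = c j) :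
    ∀ b < 2 ^ k, (vecCmd.run S).arr aVec b < q ∧
      ((vecCmd.run S).arr aVec b : ZMod q) = bitMonomial c k 0 b := by
  have key := Cmd.run_forTo (x := vB) (y := vD) (p := .set vProd (const 1) ;; .set vIdx (const 0) ;;
    .set vBits (var vB) ;; bitsCmd ;; .write aVec (var vB) ((var vProd).modSucc (var vQ)))
    (S := S) (2 ^ k) hD
    (fun i S' => S'.var vQ + 1 = q ∧ S'.var vK = k ∧ S'.arr aCoef = S.arr aCoef ∧
      ∀ b < i, S'.arr aVec b < q ∧ (S'.arr aVec b : ZMod q) = bitMonomial c k 0 b)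
    ⟨by simpa using hq, by simpa using hk, rfl, fun b hb => by lia⟩
    (by
      rintro i hi S' ⟨h1, h2, h3, h4⟩ hx
      set S2 := ((S'.setVar vProd 1).setVar vIdx 0).setVar vBits i with hS2
      have hrun : (Cmd.set vProd (const 1) ;; .set vIdx (const 0) ;;
        .set vBits (var vB) ;; bitsCmd ;; .write aVec (var vB) ((var vProd).modSucc (var vQ))).run S' =
        (bitsCmd.run S2).setArr aVec i ((bitsCmd.run S2).var vProd % q) := by
        have e1 : (bitsCmd.run S2).var vB = i := by
          rw [Cmd.run_var _ (by decide)]; simp [hS2, hx]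
        have e2 : (bitsCmd.run S2).var vQ + 1 = q := by
          rw [Cmd.run_var _ (by decide)]; simp [hS2, h1]
        simp only [run_seq, run_set, run_write, eval_const, eval_var, eval_modSucc, Store.var_setVar,
          OfNat.ofNat_eq_ofNat, Nat.reduceEqDiff, if_false, hx, cell_ofNat]
        rw [← hS2, e1, e2]
      have hbits := bitsCmd_spec (q := q) (k := k) (b := i) (c := c) (S := S2) (by simpa [hS2] using h1)
        (by simpa [hS2] using h2) (by simpa [hS2, h3] using hc) (by simp [hS2]) (by simp [hS2])
        (by simp [hS2])
      have hvec : (bitsCmd.run S2).arr aVec = S'.arr aVec := by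
        rw [Cmd.run_arr _ (by decide)]; simp [hS2]
      refine ⟨?_, ?_, ?_, ?_⟩
      · rw [Store.var_setVar, if_neg (by decide), Cmd.run_var _ (by decide), h1]
      · rw [Store.var_setVar, if_neg (by decide), Cmd.run_var _ (by decide), h2]
      · rw [Store.arr_setVar, Cmd.run_arr _ (by decide), h3]
      · intro b hb
        rw [hrun]
        simp only [Store.arr_setVar, Store.arr_setArr, true_and, hvec]
        split_ifs with hbi
        · subst hbi
          exact ⟨Nat.mod_lt _ (by lia), by rw [ZMod.natCast_mod, hbits]⟩
        · exact h4 b (by lia))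
  exact key.2.2.2

end Imp

/-! ### Families of sets and the invariant of Gaussian elimination -/

namespace Imp
open WordRAM Imp.Expr Imp.Cmd Polynomial

theorem mul_add_inj {k a b i j : ℕ} (hi : i < k) (hj : j < k) (h : a * k + i = b * k + j) :
    a = b ∧ i = j := by
  have h1 : (a * k + i) / k = a := by
    rw [mul_comm, Nat.mul_add_div (by lia), Nat.div_eq_of_lt hi, add_zero]
  have h2 : (b * k + j) / k = b := by
    rw [mul_comm, Nat.mul_add_div (by lia), Nat.div_eq_of_lt hj, add_zero]
  have h3 : a = b := by rw [← h1, h, h2]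
  subst h3
  exact ⟨rfl, by lia⟩

/-- The position of the family of sets of size `p` with `r` red vertices and the root `v`, and of
the pivot `b` within it. -/
def slot (D v p r b : ℕ) : ℕ := ((v * D + p) * D + r) * D + b

theorem slot_inj {D v p r b v' p' r' b' : ℕ} (hp : p < D) (hr : r < D) (hb : b < D) (hp' : p' < D)
    (hr' : r' < D) (hb' : b' < D) (h : slot D v p r b = slot D v' p' r' b') :
    v = v' ∧ p = p' ∧ r = r' ∧ b = b' := by
  obtain ⟨h1, h2⟩ := mul_add_inj hb hb' h
  obtain ⟨h3, h4⟩ := mul_add_inj hr hr' h1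
  obtain ⟨h5, h6⟩ := mul_add_inj hp hp' h3
  exact ⟨h5, h6, h4, h2⟩

/-- The first `p` values of `x` are the vertices in `X`, without repetition. -/
def Spells {n : ℕ} (x : ℕ → ℕ) (p : ℕ) (X : Finset (Fin n)) : Prop :=
  (∀ i < p, ∀ j < p, x i = x j → i = j) ∧ X.map Fin.valEmbedding = (Finset.range p).image x

theorem Spells.congr {n p : ℕ} {x y : ℕ → ℕ} {X : Finset (Fin n)} (h : Spells x p X)
    (hxy : ∀ i < p, x i = y i) : Spells y p X := by
  refine ⟨fun i hi j hj hij => h.1 i hi j hj (by rw [hxy i hi, hxy j hj, hij]), ?_⟩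
  rw [h.2]
  exact Finset.image_congr fun i hi => hxy i (by simpa using hi)

theorem Spells.polyOf_eq {n p q : ℕ} {x : ℕ → ℕ} {X : Finset (Fin n)} (h : Spells x p X) :
    polyOf q x p = ∏ a ∈ X, ((Polynomial.X : (ZMod q)[X]) + C ((a : ℕ) : ZMod q)) := by
  have h1 : ∏ a ∈ X, ((Polynomial.X : (ZMod q)[X]) + C ((a : ℕ) : ZMod q)) =
      ∏ a ∈ X.map Fin.valEmbedding, ((Polynomial.X : (ZMod q)[X]) + C (a : ZMod q)) := by
    rw [Finset.prod_map]; rfl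
  rw [h1, h.2, Finset.prod_image, polyOf]
  intro i hi j hj hij
  exact h.1 i (by simpa using hi) j (by simpa using hj) hij

/-- `X` is a connected set of `p` vertices, `r` of them red, that contains the root `v`. -/
structure IsRooted {n : ℕ} (G : SimpleGraph (Fin n)) (red : Finset (Fin n)) (v : Fin n) (p r : ℕ)
    (X : Finset (Fin n)) : Prop where
  mem : v ∈ X
  card : X.card = p
  red : (X ∩ red).card = r
  conn : (G.induce (X : Set (Fin n))).Connected

theorem IsRooted.red_le {n : ℕ} {G : SimpleGraph (Fin n)} {red : Finset (Fin n)} {v : Fin n}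
    {p r : ℕ} {X : Finset (Fin n)} (h : IsRooted G red v p r X) : r ≤ p := by
  rw [← h.red, ← h.card]; exact Finset.card_le_card Finset.inter_subset_left

/-- The parameters of the computation are in their variables. -/
structure Env (n k q base : ℕ) (mem : ℕ → ℕ) (S : Store) : Prop where
  base_eq : S.base = base
  mem_eq : S.arr aMem = mem
  var_n : S.var vN = n
  var_k : S.var vK = k
  var_D : S.var vD = 2 ^ k
  var_T : S.var vT = 2 ^ k * 2 ^ k * 2 ^ k
  var_nT : S.var vNT = n * (2 ^ k * 2 ^ k * 2 ^ k)
  var_q : S.var vQ + 1 = q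
  var_k1 : S.var vK1 = k + 1

theorem Env.setVar {n k q base : ℕ} {mem : ℕ → ℕ} {S : Store} (h : Env n k q base mem S) {x : ℕ}
    (hx : 8 ≤ x) (v : ℕ) : Env n k q base mem (S.setVar x v) := by
  have hx : ∀ y < 8, y ≠ x := by lia
  constructor <;> simp only [Store.base_setVar, Store.arr_setVar, Store.var_setVar]
  · exact h.base_eq
  · exact h.mem_eq
  all_goals rw [if_neg (hx _ (by decide))]
  · exact h.var_n
  · exact h.var_k
  · exact h.var_D
  · exact h.var_T
  · exact h.var_nT
  · exact h.var_q
  · exact h.var_k1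

theorem Env.run {n k q base : ℕ} {mem : ℕ → ℕ} {S : Store} (h : Env n k q base mem S) (p : Cmd)
    (hp : ∀ x < 8, p.mods x = false) (ha : p.amods aMem = false) :
    Env n k q base mem (p.run S) := by
  constructor
  · rw [p.run_base]; exact h.base_eq
  · rw [p.run_arr ha]; exact h.mem_eq
  all_goals rw [p.run_var (hp _ (by decide))]
  · exact h.var_n
  · exact h.var_k
  · exact h.var_D
  · exact h.var_T
  · exact h.var_nT
  · exact h.var_q
  · exact h.var_k1

/-- The vertices of the set in the slot `s`. -/
def slotList (k : ℕ) (S : Store) (s i : ℕ) : ℕ := S.arr aList (s * k + i)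

/-- The linear form `l` vanishes on the vectors of the sets in a family. -/
def Kills (k q : ℕ) (S : Store) (v p r : ℕ) (l : ℕ → ZMod q) : Prop :=
  ∀ b < 2 ^ k, S.arr aSize (slot (2 ^ k) v p r b) ≠ 0 →
    ∑ j ∈ Finset.range (2 ^ k), l j * vecOf q k (slotList k S (slot (2 ^ k) v p r b)) p j = 0

/-- The set in the slot `s` is what it should be, and the row of the slot is a nonzero vector in the
span of its family that vanishes before the pivot. -/
def ValidSlot {n : ℕ} (G : SimpleGraph (Fin n)) (red : Finset (Fin n)) (k q : ℕ) (S : Store)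
    (s : ℕ) : Prop :=
  ∃ v : Fin n, ∃ b < 2 ^ k, s = slot (2 ^ k) v (S.arr aSize s) (S.arr aRed s) b ∧
    (∃ X : Finset (Fin n), IsRooted G red v (S.arr aSize s) (S.arr aRed s) X ∧
      Spells (slotList k S s) (S.arr aSize s) X) ∧
    S.arr aSize s ≤ k ∧ (∀ j < 2 ^ k, S.arr aRow (s * 2 ^ k + j) < q) ∧
    (∀ j < b, S.arr aRow (s * 2 ^ k + j) = 0) ∧ S.arr aRow (s * 2 ^ k + b) ≠ 0 ∧
    ∀ l : ℕ → ZMod q, Kills k q S v (S.arr aSize s) (S.arr aRed s) l →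
      ∑ j ∈ Finset.range (2 ^ k), l j * (S.arr aRow (s * 2 ^ k + j) : ZMod q) = 0

def Valid {n : ℕ} (G : SimpleGraph (Fin n)) (red : Finset (Fin n)) (k q : ℕ) (S : Store) : Prop :=
  ∀ s, S.arr aSize s ≠ 0 → ValidSlot G red k q S s

/-- All the slots that are occupied in `S` have the same contents in `S'`. -/
def Ext (k : ℕ) (S S' : Store) : Prop :=
  ∀ s, S.arr aSize s ≠ 0 → S'.arr aSize s = S.arr aSize s ∧ S'.arr aRed s = S.arr aRed s ∧
    (∀ i < k, slotList k S' s i = slotList k S s i) ∧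
    ∀ j < 2 ^ k, S'.arr aRow (s * 2 ^ k + j) = S.arr aRow (s * 2 ^ k + j)

theorem Ext.of_arr {k : ℕ} {S S' : Store} (h1 : S'.arr aSize = S.arr aSize)
    (h2 : S'.arr aRed = S.arr aRed) (h3 : S'.arr aList = S.arr aList)
    (h4 : S'.arr aRow = S.arr aRow) : Ext k S S' := by
  intro s _
  simp [h1, h2, h3, h4, slotList]

theorem Ext.refl (k : ℕ) (S : Store) : Ext k S S := Ext.of_arr rfl rfl rfl rfl

theorem Ext.trans {k : ℕ} {S S' S'' : Store} (h : Ext k S S') (h' : Ext k S' S'') :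
    Ext k S S'' := by
  intro s hs
  obtain ⟨h1, h2, h3, h4⟩ := h s hs
  obtain ⟨g1, g2, g3, g4⟩ := h' s (by rwa [h1])
  exact ⟨g1.trans h1, g2.trans h2, fun i hi => (g3 i hi).trans (h3 i hi),
    fun j hj => (g4 j hj).trans (h4 j hj)⟩

/-- Spans are handled through their annihilators. Occupied slots are never overwritten, so families
only grow and fewer forms kill them; membership in a span therefore persists along `Ext`. -/
theorem Kills.of_ext {k q v p r : ℕ} {S S' : Store} {l : ℕ → ZMod q} (h : Kills k q S' v p r l)
    (hE : Ext k S S') (hp : p ≤ k) : Kills k q S v p r l := by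
  intro b hb hs
  obtain ⟨h1, -, h3, -⟩ := hE _ hs
  have := h b hb (by rwa [h1])
  rwa [vecOf_congr fun i hi => h3 i (by lia)] at this

theorem ValidSlot.of_ext {n k q : ℕ} {G : SimpleGraph (Fin n)} {red : Finset (Fin n)} {S S' : Store}
    {s : ℕ} (h : ValidSlot G red k q S s) (hs : S.arr aSize s ≠ 0) (hE : Ext k S S') :
    ValidSlot G red k q S' s := by
  obtain ⟨v, b, hb, hslot, ⟨X, hX, hsp⟩, hk, h1, h2, h3, h4⟩ := h
  obtain ⟨e1, e2, e3, e4⟩ := hE s hs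
  refine ⟨v, b, hb, ?_, ⟨X, ?_, ?_⟩, ?_, ?_, ?_, ?_, ?_⟩
  · rw [e1, e2]; exact hslot
  · rw [e1, e2]; exact hX
  · rw [e1]; exact hsp.congr fun i hi => (e3 i (by lia)).symm
  · rw [e1]; exact hk
  · intro j hj; rw [e4 j hj]; exact h1 j hj
  · intro j hj; rw [e4 j (by lia)]; exact h2 j hj
  · rw [e4 b hb]; exact h3
  · intro l hl
    rw [e1, e2] at hl
    rw [← h4 l (hl.of_ext hE hk)]
    exact Finset.sum_congr rfl fun j hj => by rw [e4 j (Finset.mem_range.1 hj)]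

theorem Valid.of_arr {n k q : ℕ} {G : SimpleGraph (Fin n)} {red : Finset (Fin n)} {S S' : Store}
    (h : Valid G red k q S) (h1 : S'.arr aSize = S.arr aSize)
    (h2 : S'.arr aRed = S.arr aRed) (h3 : S'.arr aList = S.arr aList)
    (h4 : S'.arr aRow = S.arr aRow) : Valid G red k q S' := fun s hs =>
  (h s (by rwa [← h1])).of_ext (by rwa [← h1]) (Ext.of_arr h1 h2 h3 h4)

/-- The invariant of the Gaussian elimination. -/
structure Reducing {n : ℕ} (G : SimpleGraph (Fin n)) (red : Finset (Fin n)) (k q base : ℕ)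
    (mem : ℕ → ℕ) (v p r : ℕ) (x : ℕ → ℕ) (S₀ : Store) (b : ℕ) (S : Store) : Prop where
  env : Env n k q base mem S
  var_v : S.var vV = v
  var_p : S.var vP = p
  var_r : S.var vR = r
  buf : S.arr aBuf = x
  valid : Valid G red k q S
  ext : Ext k S₀ S
  lt : ∀ j < 2 ^ k, S.arr aVec j < q
  zero : ∀ j < b, j < 2 ^ k → S.arr aVec j = 0
  -- In terms of annihilators: modulo the span of the family, the current vector is a nonzero
  -- multiple of the vector of x.
  iff : ∀ l : ℕ → ZMod q, Kills k q S v p r l →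
    (∑ j ∈ Finset.range (2 ^ k), l j * (S.arr aVec j : ZMod q) = 0 ↔
      ∑ j ∈ Finset.range (2 ^ k), l j * vecOf q k x p j = 0)

theorem Reducing.setVar {n : ℕ} {G : SimpleGraph (Fin n)} {red : Finset (Fin n)} {k q base : ℕ}
    {mem : ℕ → ℕ} {v p r : ℕ} {x : ℕ → ℕ} {S₀ : Store} {b : ℕ} {S : Store}
    (h : Reducing G red k q base mem v p r x S₀ b S) {y : ℕ} (hy : 22 ≤ y) (m : ℕ) :
    Reducing G red k q base mem v p r x S₀ b (S.setVar y m) :=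
  ⟨h.env.setVar (by lia) m, by rw [Store.var_setVar, if_neg (by lia), h.var_v],
    by rw [Store.var_setVar, if_neg (by lia), h.var_p], by rw [Store.var_setVar, if_neg (by lia), h.var_r],
    h.buf, h.valid, h.ext, h.lt, h.zero, h.iff⟩

theorem eliminateCmd_spec {D q x y s : ℕ} {S : Store} (hq : S.var vQ + 1 = q) (hD : S.var vD = D)
    (hx : S.var vX = x) (hy : S.var vY = y) (hs : S.var vSlot = s) :
    ∀ j < D, (eliminateCmd.run S).arr aVec j =
      (S.arr aVec j * y + (q - x) * S.arr aRow (s * D + j)) % q := by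
  refine (run_fill D hD id _ (fun i _ j _ h => h) ?_).1
  intro j hj S' h1 h2 h3 h4
  refine ⟨by simpa using h2, ?_⟩
  have h5 : S'.arr aVec j = S.arr aVec j := h4 j fun i hi => by simp only [id]; lia
  simp [h1, h2, h3, h5, hq, hD, hx, hy, hs]

theorem storeCmd_spec {k D p r s : ℕ} {S : Store} (hD : S.var vD = D) (hk : S.var vK = k)
    (hp : S.var vP = p) (hr : S.var vR = r) (hs : S.var vSlot = s) :
    (∀ m, (storeCmd.run S).arr aSize m = if m = s then p else S.arr aSize m) ∧
    (∀ m, (storeCmd.run S).arr aRed m = if m = s then r else S.arr aRed m) ∧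
    (∀ i < p, (storeCmd.run S).arr aList (s * k + i) = S.arr aBuf i) ∧
    (∀ m, (∀ i < p, m ≠ s * k + i) → (storeCmd.run S).arr aList m = S.arr aList m) ∧
    (∀ j < D, (storeCmd.run S).arr aRow (s * D + j) = S.arr aVec j) ∧
    (∀ m, (∀ j < D, m ≠ s * D + j) → (storeCmd.run S).arr aRow m = S.arr aRow m) ∧
    ∀ j < D, (storeCmd.run S).arr aVec j = 0 := by
  set S1 := (S.setArr aSize s p).setArr aRed s r with hS1
  set c1 : Cmd := .forTo vI vP (.write aList (var vSlot * var vK + var vI) (read aBuf (var vI)))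
    with hc1
  set c2 : Cmd := .forTo vJ vD (.write aRow (var vSlot * var vD + var vJ) (read aVec (var vJ)))
    with hc2
  set c3 : Cmd := .forTo vJ vD (.write aVec (var vJ) (const 0)) with hc3
  have hrun : storeCmd.run S = c3.run (c2.run (c1.run S1)) := by
    simp only [storeCmd, run_seq, run_write, eval_var, Store.var_setArr, cell_one, cell_ofNat, hs, hp,
      hr, hS1, hc1, hc2, hc3]
  have f1 := run_fill (x := vI) (y := vP) (a := aList) (e := var vSlot * var vK + var vI)
    (f := read aBuf (var vI)) (S := S1) p hp (fun i => s * k + i) (S.arr aBuf)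
    (fun i _ j _ h => by simpa using h) (fun j hj S' h1 h2 h3 h4 => by
      simp [h1, h2, h3, hs, hk, hS1])
  have f2 := run_fill (x := vJ) (y := vD) (a := aRow) (e := var vSlot * var vD + var vJ)
    (f := read aVec (var vJ)) (S := c1.run S1) D
    (by rw [Cmd.run_var _ (by decide)]; exact hD) (fun i => s * D + i) (S.arr aVec)
    (fun i _ j _ h => by simpa using h) (fun j hj S' h1 h2 h3 h4 => by
      have e1 : (c1.run S1).var vSlot = s := by rw [Cmd.run_var _ (by decide)]; exact hs
      have e2 : (c1.run S1).var vD = D := by rw [Cmd.run_var _ (by decide)]; exact hD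
      have e3 : (c1.run S1).arr aVec = S.arr aVec := by rw [Cmd.run_arr _ (by decide)]; simp [hS1]; rfl
      simp [h1, h2, h3, e1, e2, e3])
  have f3 := run_fill (x := vJ) (y := vD) (a := aVec) (e := var vJ)
    (f := const 0) (S := c2.run (c1.run S1)) D
    (by rw [Cmd.run_var _ (by decide), Cmd.run_var _ (by decide)]; exact hD) id (fun _ => 0)
    (fun i _ j _ h => h) (fun j hj S' h1 h2 h3 h4 => ⟨h2, rfl⟩)
  rw [hrun]
  refine ⟨fun m => ?_, fun m => ?_, fun i hi => ?_, fun m hm => ?_, fun j hj => ?_, fun m hm => ?_,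
    f3.1⟩
  · rw [c3.run_arr (by decide), c2.run_arr (by decide), c1.run_arr (by decide)]; simp [hS1]
  · rw [c3.run_arr (by decide), c2.run_arr (by decide), c1.run_arr (by decide)]; simp [hS1]
  · rw [c3.run_arr (by decide), c2.run_arr (by decide)]; exact f1.1 i hi
  · rw [c3.run_arr (by decide), c2.run_arr (by decide)]; exact (f1.2 m hm).trans (by simp [hS1])
  · rw [c3.run_arr (by decide)]; exact f2.1 j hj
  · rw [c3.run_arr (by decide)]
    refine (f2.2 m hm).trans ?_
    rw [c1.run_arr (by decide)]; simp [hS1]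

end Imp

/-! ### Insertion of a set into its family -/

namespace Imp
open WordRAM Imp.Expr Imp.Cmd Polynomial

section Insert
variable {n : ℕ} {G : SimpleGraph (Fin n)} {red : Finset (Fin n)} {k q base : ℕ}
  {mem : ℕ → ℕ} {v : Fin n} {p r : ℕ} {x : ℕ → ℕ} {X : Finset (Fin n)} {S₀ : Store}

/-- A form that kills the family kills the row. What remains of its value is the old value times the
pivot entry of the row, which is nonzero modulo q because it is nonzero and below q. -/
theorem Reducing.eliminate [Fact q.Prime] (hX : IsRooted G red v p r X) (hpk : p ≤ k)
    {b : ℕ} (hb : b < 2 ^ k) {S : Store} (h : Reducing G red k q base mem v p r x S₀ b S)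
    (hfull : S.arr aSize (slot (2 ^ k) v p r b) ≠ 0) (hs : S.var vSlot = slot (2 ^ k) v p r b)
    (hx : S.var vX = S.arr aVec b)
    (hy : S.var vY = S.arr aRow (slot (2 ^ k) v p r b * 2 ^ k + b)) :
    Reducing G red k q base mem v p r x S₀ (b + 1) (eliminateCmd.run S) := by
  set s := slot (2 ^ k) v p r b with hsdef
  have hkk : k < 2 ^ k := Nat.lt_two_pow_self
  have hrp := hX.red_le
  obtain ⟨v', b', hb', hslot, ⟨X', hX', -⟩, hsk, hlt, hz, hnz, hker⟩ := h.valid s hfull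
  have hr'p := hX'.red_le
  -- The address determines root, size, red count and pivot, so the data that validity provides
  -- belong to this family. The digits are in range because k < 2^k.
  obtain ⟨e1, e2, e3, e4⟩ := slot_inj (by lia) (by lia) hb (by lia) (by lia) hb'
    (hsdef.symm.trans hslot)
  rw [← e1, ← e2, ← e3] at hker
  subst e4
  have hvec := eliminateCmd_spec h.env.var_q h.env.var_D hx hy hs
  have hq0 : 0 < q := (Fact.out : q.Prime).pos
  have hxq := h.lt b hb
  have hcast : ∀ j < 2 ^ k, (((eliminateCmd.run S).arr aVec j : ℕ) : ZMod q) =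
      S.arr aRow (s * 2 ^ k + b) * S.arr aVec j - S.arr aVec b * S.arr aRow (s * 2 ^ k + j) := by
    intro j hj
    rw [hvec j hj, ZMod.natCast_mod]
    push_cast [Nat.cast_sub hxq.le]
    simp
    ring
  have a1 : (eliminateCmd.run S).arr aSize = S.arr aSize := Cmd.run_arr _ (by decide) S
  have a2 : (eliminateCmd.run S).arr aRed = S.arr aRed := Cmd.run_arr _ (by decide) S
  have a3 : (eliminateCmd.run S).arr aList = S.arr aList := Cmd.run_arr _ (by decide) S
  have a4 : (eliminateCmd.run S).arr aRow = S.arr aRow := Cmd.run_arr _ (by decide) S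
  have hE := Ext.of_arr (k := k) a1 a2 a3 a4
  refine ⟨h.env.run _ (by decide) (by decide), ?_, ?_, ?_, ?_, h.valid.of_arr a1 a2 a3 a4,
    h.ext.trans hE, ?_, ?_, ?_⟩
  · rw [Cmd.run_var _ (by decide), h.var_v]
  · rw [Cmd.run_var _ (by decide), h.var_p]
  · rw [Cmd.run_var _ (by decide), h.var_r]
  · rw [Cmd.run_arr _ (by decide), h.buf]
  · intro j hj
    rw [hvec j hj]
    exact Nat.mod_lt _ hq0
  · intro j hj hj'
    rw [hvec j hj']
    rcases Nat.lt_succ_iff_lt_or_eq.1 hj with hjb | rfl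
    · rw [h.zero j hjb hj', hz j hjb]; simp
    · rw [← Nat.add_mul, Nat.add_sub_cancel' hxq.le]; simp
  · intro l hl
    have hl' := hl.of_ext hE hpk
    rw [← h.iff l hl']
    have hsum : ∑ j ∈ Finset.range (2 ^ k), l j * (((eliminateCmd.run S).arr aVec j : ℕ) : ZMod q) =
        S.arr aRow (s * 2 ^ k + b) * ∑ j ∈ Finset.range (2 ^ k), l j * (S.arr aVec j : ZMod q) -
        S.arr aVec b * ∑ j ∈ Finset.range (2 ^ k), l j * (S.arr aRow (s * 2 ^ k + j) : ZMod q) := by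
      rw [Finset.mul_sum, Finset.mul_sum, ← Finset.sum_sub_distrib]
      refine Finset.sum_congr rfl fun j hj => ?_
      rw [hcast j (Finset.mem_range.1 hj)]
      ring
    rw [hsum, hker l hl', mul_zero, sub_zero, mul_eq_zero]
    have hy0 : (S.arr aRow (s * 2 ^ k + b) : ZMod q) ≠ 0 := by
      intro h0
      rw [ZMod.natCast_eq_zero_iff] at h0
      exact absurd (Nat.le_of_dvd (Nat.pos_of_ne_zero hnz) h0) (by have := hlt b hb; lia)
    simp [hy0]

/-- By the invariant before the insertion, the stored row lies in the span of the family enlarged by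
X. Afterwards the vector of X is that of a member and the working vector is 0, so both sides of the
equivalence hold. -/
theorem Reducing.store (hX : IsRooted G red v p r X) (hsp : Spells x p X) (hp1 : 1 ≤ p)
    (hpk : p ≤ k) {b : ℕ} (hb : b < 2 ^ k) {S : Store}
    (h : Reducing G red k q base mem v p r x S₀ b S)
    (hempty : S.arr aSize (slot (2 ^ k) v p r b) = 0) (hs : S.var vSlot = slot (2 ^ k) v p r b)
    (hxb : S.arr aVec b ≠ 0) :
    Reducing G red k q base mem v p r x S₀ (b + 1) (storeCmd.run S) := by
  set s := slot (2 ^ k) v p r b with hsdef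
  obtain ⟨f1, f2, f3, f4, f5, f6, f7⟩ := storeCmd_spec h.env.var_D h.env.var_k h.var_p h.var_r hs
  rw [h.buf] at f3
  set S' := storeCmd.run S with hS'
  have hE : Ext k S S' := by
    intro m hm
    have hne : m ≠ s := fun h => hm (h ▸ hempty)
    refine ⟨by rw [f1, if_neg hne], by rw [f2, if_neg hne], fun i hi => ?_, fun j hj => ?_⟩
    · exact f4 _ fun i' hi' heq => hne (mul_add_inj hi (by lia) heq).1
    · exact f6 _ fun j' hj' heq => hne (mul_add_inj hj hj' heq).1
  have hlist : ∀ i < p, slotList k S' s i = x i := f3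
  have hkill : ∀ l, Kills k q S' v p r l →
      ∑ j ∈ Finset.range (2 ^ k), l j * vecOf q k x p j = 0 := by
    intro l hl
    have := hl b hb (by rw [f1, if_pos rfl]; lia)
    rwa [vecOf_congr hlist] at this
  refine ⟨h.env.run _ (by decide) (by decide), ?_, ?_, ?_, ?_, ?_, h.ext.trans hE, ?_, ?_, ?_⟩
  · rw [Cmd.run_var _ (by decide), h.var_v]
  · rw [Cmd.run_var _ (by decide), h.var_p]
  · rw [Cmd.run_var _ (by decide), h.var_r]
  · rw [Cmd.run_arr _ (by decide), h.buf]
  · intro m hm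
    by_cases hms : m = s
    · rw [hms]
      have g1 : S'.arr aSize s = p := by rw [f1, if_pos rfl]
      have g2 : S'.arr aRed s = r := by rw [f2, if_pos rfl]
      refine ⟨v, b, hb, by rw [g1, g2], ⟨X, by rwa [g1, g2], ?_⟩, by rwa [g1], ?_, ?_, ?_, ?_⟩
      · rw [g1]; exact hsp.congr fun i hi => (hlist i hi).symm
      · intro j hj; rw [f5 j hj]; exact h.lt j hj
      · intro j hj; rw [f5 j (by lia)]; exact h.zero j hj (by lia)
      · rw [f5 b hb]; exact hxb
      · intro l hl
        rw [g1, g2] at hl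
        rw [← (h.iff l (hl.of_ext hE hpk)).2 (hkill l hl)]
        exact Finset.sum_congr rfl fun j hj => by rw [f5 j (Finset.mem_range.1 hj)]
    · have hm' : S.arr aSize m ≠ 0 := by rwa [f1, if_neg hms] at hm
      exact (h.valid m hm').of_ext hm' hE
  · intro j hj
    rw [f7 j hj]
    have := h.lt j hj
    lia
  · intro j _ hj; exact f7 j hj
  · intro l hl
    refine iff_of_true (Finset.sum_eq_zero fun j hj => ?_) (hkill l hl)
    rw [f7 j (Finset.mem_range.1 hj)]
    simp

theorem Reducing.reduceStep [Fact q.Prime] (hX : IsRooted G red v p r X) (hsp : Spells x p X)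
    (hp1 : 1 ≤ p) (hpk : p ≤ k) {b : ℕ} (hb : b < 2 ^ k) {S : Store}
    (h : Reducing G red k q base mem v p r x S₀ b S) (hvb : S.var vB = b) :
    Reducing G red k q base mem v p r x S₀ (b + 1) (reduceStep.run S) := by
  by_cases h0 : S.arr aVec b = 0
  · rw [Imp.reduceStep, run_ite_neg _ _ (by simp [hvb, h0]), run_skip]
    refine ⟨h.env, h.var_v, h.var_p, h.var_r, h.buf, h.valid, h.ext, h.lt, fun j hj hj' => ?_, h.iff⟩
    rcases Nat.lt_succ_iff_lt_or_eq.1 hj with hjb | rfl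
    · exact h.zero j hjb hj'
    · exact h0
  rw [Imp.reduceStep, run_ite_pos _ _ (by simp [hvb, h0]), run_seq, run_set]
  have hslot : (((var vV * var vD + var vP) * var vD + var vR) * var vD + var vB).eval S =
      slot (2 ^ k) v p r b := by
    simp [slot, hvb, h.var_v, h.var_p, h.var_r, h.env.var_D]
  rw [hslot]
  have h1 := h.setVar (y := vSlot) (by decide) (slot (2 ^ k) v p r b)
  by_cases hfull : S.arr aSize (slot (2 ^ k) v p r b) = 0
  · rw [run_ite_neg _ _ (by simp [hfull])]
    exact h1.store hX hsp hp1 hpk hb hfull (by simp) h0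
  · rw [run_ite_pos _ _ (by simp [hfull]), run_seq, run_seq, run_set, run_set]
    refine ((h1.setVar (y := vX) (by decide) _).setVar (y := vY) (by decide) _).eliminate hX hpk hb
      hfull (by simp) (by simp [hvb]) (by simp [hvb, h.env.var_D])

/-- The set `X` spelled by `x` is represented by its family. -/
def Represented (k q : ℕ) (S : Store) (v p r : ℕ) (x : ℕ → ℕ) : Prop :=
  ∀ l : ℕ → ZMod q, Kills k q S v p r l → ∑ j ∈ Finset.range (2 ^ k), l j * vecOf q k x p j = 0

theorem insertCmd_spec [Fact q.Prime] {S : Store} (hX : IsRooted G red v p r X)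
    (hsp : Spells (S.arr aBuf) p X) (hp1 : 1 ≤ p) (hpk : p ≤ k) (henv : Env n k q base mem S)
    (hval : Valid G red k q S) (hv : S.var vV = v) (hp : S.var vP = p) (hr : S.var vR = r) :
    Env n k q base mem (insertCmd.run S) ∧ Valid G red k q (insertCmd.run S) ∧
      Ext k S (insertCmd.run S) ∧ Represented k q (insertCmd.run S) v p r (S.arr aBuf) := by
  have hc := coefCmd_spec henv.var_q henv.var_k1
  rw [hp] at hc
  set S1 := coefCmd.run S with hS1
  have henv1 : Env n k q base mem S1 := henv.run _ (by decide) (by decide)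
  have hvec := vecCmd_spec henv1.var_q henv1.var_k henv1.var_D hc
  set S2 := vecCmd.run S1 with hS2
  have henv2 : Env n k q base mem S2 := henv1.run _ (by decide) (by decide)
  have hvar : ∀ y, coefCmd.mods y = false → vecCmd.mods y = false → S2.var y = S.var y :=
    fun y h1 h2 => (Cmd.run_var _ h2 S1).trans (Cmd.run_var _ h1 S)
  have harr : ∀ a, coefCmd.amods a = false → vecCmd.amods a = false → S2.arr a = S.arr a :=
    fun a h1 h2 => (Cmd.run_arr _ h2 S1).trans (Cmd.run_arr _ h1 S)
  have a1 := harr aSize (by decide) (by decide)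
  have a2 := harr aRed (by decide) (by decide)
  have a3 := harr aList (by decide) (by decide)
  have a4 := harr aRow (by decide) (by decide)
  have h0 : Reducing G red k q base mem v p r (S.arr aBuf) S 0 S2 :=
    ⟨henv2, (hvar _ (by decide) (by decide)).trans hv, (hvar _ (by decide) (by decide)).trans hp,
      (hvar _ (by decide) (by decide)).trans hr, harr aBuf (by decide) (by decide),
      hval.of_arr a1 a2 a3 a4, Ext.of_arr a1 a2 a3 a4, fun j hj => (hvec j hj).1,
      fun j hj => by lia, fun l _ => by
        rw [Finset.sum_congr rfl fun j hj => by rw [(hvec j (Finset.mem_range.1 hj)).2]]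
        rfl⟩
  have key := Cmd.run_forTo (x := vB) (y := vD) (p := reduceStep) (S := S2) (2 ^ k) henv2.var_D
    (fun b S' => Reducing G red k q base mem v p r (S.arr aBuf) S b S')
    (h0.setVar (by decide) _)
    (fun b hb S' h hb' => (h.reduceStep hX hsp hp1 hpk hb hb').setVar (by decide) _)
  refine ⟨key.env, key.valid, key.ext, fun l hl => ?_⟩
  -- After all pivots the working vector is 0, so every form that kills the family kills the vector
  -- of X.
  refine (key.iff l hl).1 (Finset.sum_eq_zero fun j hj => ?_)
  have hj := Finset.mem_range.1 hj
  rw [key.zero j hj hj]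
  simp

end Insert

end Imp

/-! ### A loop rule for persistent properties, and the search for a prime -/

namespace Imp
open WordRAM Imp.Expr Imp.Cmd

/-- A loop whose body preserves `Inv`, moves along the preorder `R` and establishes `Φ j`. -/
theorem run_forTo_forall {x y : ℕ} {p : Cmd} {S : Store} (N : ℕ) (hN : S.var y = N)
    (Inv : Store → Prop) (R : Store → Store → Prop) (Φ : ℕ → Store → Prop)
    (hR : ∀ S₁ S₂ S₃, R S₁ S₂ → R S₂ S₃ → R S₁ S₃) (hΦ : ∀ j S₁ S₂, R S₁ S₂ → Φ j S₁ → Φ j S₂)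
    (hset : ∀ S' m, Inv S' → Inv (S'.setVar x m)) (hRset : ∀ S' m, R S' (S'.setVar x m))
    (h0 : Inv S)
    (hstep : ∀ j < N, ∀ S', Inv S' → R S S' → S'.var x = j →
      Inv (p.run S') ∧ R S' (p.run S') ∧ Φ j (p.run S')) :
    Inv ((forTo x y p).run S) ∧ R S ((forTo x y p).run S) ∧
      ∀ j < N, Φ j ((forTo x y p).run S) := by
  refine Cmd.run_forTo (x := x) (y := y) (p := p) (S := S) N hN
    (fun j S' => Inv S' ∧ R S S' ∧ ∀ i < j, Φ i S')
    ⟨hset _ _ h0, hRset _ _, fun i hi => by lia⟩ ?_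
  rintro j hj S' ⟨h1, h2, h3⟩ hx
  obtain ⟨g1, g2, g3⟩ := hstep j hj S' h1 h2 hx
  have hs := hRset (p.run S') (j + 1)
  refine ⟨hset _ _ g1, hR _ _ _ h2 (hR _ _ _ g2 hs), fun i hi => ?_⟩
  rcases Nat.lt_succ_iff_lt_or_eq.1 hi with hij | rfl
  · exact hΦ _ _ _ (hR _ _ _ g2 hs) (h3 i hij)
  · exact hΦ _ _ _ hs g3

theorem primeTest_spec {cand : ℕ} {S : Store} (hc : S.var vCand = cand) (h1 : S.var vIsPrime = 1)
    (h2 : 2 ≤ cand) :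
    ((forTo vDiv vCand (.ite (bin .lt (var vDiv + const 2) (var vCand) *
      bin .eq ((var vCand).modSucc (var vDiv + const 1)) (const 0))
      (.set vIsPrime (const 0)) .skip)).run S).var vIsPrime ≠ 0 ↔ cand.Prime := by
  have key := Cmd.run_forTo (x := vDiv) (y := vCand)
    (p := .ite (bin .lt (var vDiv + const 2) (var vCand) *
      bin .eq ((var vCand).modSucc (var vDiv + const 1)) (const 0))
      (.set vIsPrime (const 0)) .skip) (S := S) cand hc
    (fun d S' => S'.var vCand = cand ∧
      (S'.var vIsPrime ≠ 0 ↔ ∀ m < d, m + 2 < cand → ¬ m + 2 ∣ cand))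
    (by simp [hc, h1])
    (by
      rintro d hd S' ⟨h3, h4⟩ hx
      by_cases hdiv : d + 2 < cand ∧ d + 2 ∣ cand
      · rw [run_ite_pos]
        · refine ⟨by simp [h3], ?_⟩
          refine iff_of_false (by simp) fun h => h d (by lia) hdiv.1 hdiv.2
        · simp [hx, h3, hdiv.1, Nat.mod_eq_zero_of_dvd hdiv.2]
      · rw [run_ite_neg]
        · refine ⟨by simp [h3], ?_⟩
          simp only [run_skip, Store.var_setVar, OfNat.ofNat_eq_ofNat, Nat.reduceEqDiff, if_false, h4]
          refine ⟨fun h m hm => ?_, fun h m hm => h m (by lia)⟩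
          rcases Nat.lt_succ_iff_lt_or_eq.1 hm with hmd | rfl
          · exact h m hmd
          · exact fun g1 g2 => hdiv ⟨g1, g2⟩
        · simp only [eval_mul, eval_lt, eval_add, eval_var, eval_const, eval_eq, eval_modSucc, hx, h3]
          rw [mul_eq_zero]
          by_contra! hcon
          refine hdiv ⟨?_, ?_⟩
          · by_contra h; simp [h] at hcon
          · refine Nat.dvd_of_mod_eq_zero ?_
            by_contra h
            exact hcon.2 (by rw [if_neg (by simpa [add_assoc] using h)]))
  rw [key.2, Nat.prime_def_lt']
  constructor
  · refine fun h => ⟨h2, fun m hm hm' hdvd => h (m - 2) (by lia) (by lia) ?_⟩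
    rwa [Nat.sub_add_cancel hm]
  · exact fun h m _ hm' => h.2 (m + 2) (by lia) hm'

theorem primeCmd_spec {n : ℕ} {S : Store} (hn : S.var vN1 = n + 1) :
    ((primeCmd.run S).var vQ + 1).Prime ∧ n < (primeCmd.run S).var vQ + 1 := by
  have key := Cmd.run_forTo (x := vC) (y := vN1) (p := .set vCand (var vN1 + const 1 + var vC) ;;
    .set vIsPrime (const 1) ;;
    .forTo vDiv vCand (.ite (bin .lt (var vDiv + const 2) (var vCand) *
      bin .eq ((var vCand).modSucc (var vDiv + const 1)) (const 0))
      (.set vIsPrime (const 0)) .skip) ;;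
    .ite (var vIsPrime) (.set vQ (var vCand - const 1)) .skip) (S := S) (n + 1) hn
    (fun i S' => S'.var vN1 = n + 1 ∧ ∀ j < i, (n + 2 + j).Prime →
      (S'.var vQ + 1).Prime ∧ n < S'.var vQ + 1)
    (by simpa using hn)
    (by
      rintro i hi S' ⟨h1, h2⟩ hx
      set S1 := (S'.setVar vCand (n + 2 + i)).setVar vIsPrime 1 with hS1
      set c : Cmd := .forTo vDiv vCand (.ite (bin .lt (var vDiv + const 2) (var vCand) *
        bin .eq ((var vCand).modSucc (var vDiv + const 1)) (const 0))
        (.set vIsPrime (const 0)) .skip) with hcdef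
      have htest : (c.run S1).var vIsPrime ≠ 0 ↔ (n + 2 + i).Prime :=
        primeTest_spec (by simp [hS1]) (by simp [hS1]) (by lia)
      have hcand : (c.run S1).var vCand = n + 2 + i := by
        rw [Cmd.run_var _ (by decide)]; simp [hS1]
      have hQ : (c.run S1).var vQ = S'.var vQ := by
        rw [Cmd.run_var _ (by decide)]; simp [hS1]
      refine ⟨by rw [Store.var_setVar, if_neg (by decide), Cmd.run_var _ (by decide), h1], ?_⟩
      rw [run_seq, run_seq, run_seq, run_set, run_set]
      have e1 : ((var vN1 + const 1 + var vC : Expr)).eval S' = n + 2 + i := by simp [h1, hx]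
      rw [e1, eval_const, ← hS1]
      intro j hj hjp
      by_cases hprime : (n + 2 + i).Prime
      · rw [run_ite_pos _ _ (e := var vIsPrime) (htest.2 hprime)]
        simp only [run_set, Store.var_setVar, OfNat.ofNat_eq_ofNat, Nat.reduceEqDiff, if_false,
          if_true, eval_sub, eval_var, eval_const, hcand]
        rw [Nat.sub_add_cancel (by lia)]
        exact ⟨hprime, by lia⟩
      · rw [run_ite_neg _ _ (by rw [eval_var]; by_contra h; exact hprime (htest.1 h)), run_skip]
        simp only [Store.var_setVar, OfNat.ofNat_eq_ofNat, Nat.reduceEqDiff, if_false, hQ]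
        rcases Nat.lt_succ_iff_lt_or_eq.1 hj with hji | rfl
        · exact h2 j hji hjp
        · exact absurd hjp hprime)
  obtain ⟨p, hp, hp1, hp2⟩ := Nat.exists_prime_lt_and_le_two_mul (n + 1) (by lia)
  exact key.2 (p - (n + 2)) (by lia) (by rwa [Nat.add_sub_cancel' (by lia)])

theorem setupCmd_spec {n k : ℕ} {S : Store} (hn : S.var vN = n) (hk : S.var vK = k)
    (hD : S.var vD = 2 ^ k) :
    ∃ q, q.Prime ∧ n < q ∧ Env n k q S.base (S.arr aMem) (setupCmd.run S) := by
  set S1 := (((S.setVar vT (2 ^ k * 2 ^ k * 2 ^ k)).setVar vNT (n * (2 ^ k * 2 ^ k * 2 ^ k))).setVar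
    vN1 (n + 1)).setVar vK1 (k + 1) with hS1
  have hrun : setupCmd.run S = primeCmd.run S1 := by
    simp [setupCmd, hn, hk, hD, hS1]
  obtain ⟨h1, h2⟩ := primeCmd_spec (n := n) (S := S1) (by simp [hS1])
  rw [hrun]
  refine ⟨_, h1, h2, ?_, ?_, ?_, ?_, ?_, ?_, ?_, rfl, ?_⟩
  · rw [Cmd.run_base]; simp [hS1]
  · rw [Cmd.run_arr _ (by decide)]; simp [hS1]
  all_goals rw [Cmd.run_var _ (by decide)]; simp [hS1, hn, hk, hD]

theorem setupCmd_arr {a : ℕ} (S : Store) : (setupCmd.run S).arr a = S.arr a :=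
  Cmd.run_arr _ (by simp [setupCmd, primeCmd, amods]) S

end Imp

/-! ### Merging two disjoint sets -/

namespace Imp
open WordRAM Imp.Expr Imp.Cmd

/-- The slots of the root v form the block of length D^3 that starts at v D^3, so the root of a
stored set can be read off its address. -/
theorem slot_eq (D v p r b : ℕ) : slot D v p r b = v * (D * D * D) + ((p * D + r) * D + b) := by
  simp only [slot]; ring

theorem slot_offset_lt {D p r b : ℕ} (hp : p < D) (hr : r < D) (hb : b < D) :
    (p * D + r) * D + b < D * D * D := by
  have h1 : p * D + r + 1 ≤ D * D := by nlinarith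
  nlinarith

section Spells
variable {n p p' : ℕ} {x y : ℕ → ℕ} {X Y : Finset (Fin n)}

theorem Spells.mem_iff (h : Spells x p X) (a : Fin n) : a ∈ X ↔ ∃ i < p, x i = a := by
  have : a ∈ X ↔ (a : ℕ) ∈ X.map Fin.valEmbedding := by
    simp [Finset.mem_map, Fin.val_inj]
  rw [this, h.2]
  simp

theorem Spells.exists_mem (h : Spells x p X) {i : ℕ} (hi : i < p) : ∃ a ∈ X, x i = (a : ℕ) := by
  have : x i ∈ X.map Fin.valEmbedding := by
    rw [h.2]; exact Finset.mem_image_of_mem _ (Finset.mem_range.2 hi)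
  obtain ⟨a, ha, hax⟩ := Finset.mem_map.1 this
  exact ⟨a, ha, hax.symm⟩

theorem Spells.disjoint_iff (hX : Spells x p X) (hY : Spells y p' Y) :
    (∀ i < p, ∀ j < p', x i ≠ y j) ↔ Disjoint X Y := by
  rw [Finset.disjoint_left]
  constructor
  · intro h a ha hb
    obtain ⟨i, hi, hia⟩ := (hX.mem_iff a).1 ha
    obtain ⟨j, hj, hja⟩ := (hY.mem_iff a).1 hb
    exact h i hi j hj (hia.trans hja.symm)
  · intro h i hi j hj hij
    obtain ⟨a, ha, hax⟩ := hX.exists_mem hi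
    exact h ha ((hY.mem_iff a).2 ⟨j, hj, by rw [← hij, hax]⟩)

theorem Spells.union (hX : Spells x p X) (hY : Spells y p' Y) (hd : Disjoint X Y) {z : ℕ → ℕ}
    (hz : ∀ i < p, z i = x i) (hz' : ∀ i < p', z (p + i) = y i) : Spells z (p + p') (X ∪ Y) := by
  have hne := (hX.disjoint_iff hY).2 hd
  have hz2 : ∀ i < p + p', p ≤ i → z i = y (i - p) := fun i hi hpi => by
    rw [← hz' (i - p) (by lia), Nat.add_sub_cancel' hpi]
  refine ⟨fun i hi j hj hij => ?_, ?_⟩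
  · rcases lt_or_ge i p with h1 | h1 <;> rcases lt_or_ge j p with h2 | h2
    · rw [hz i h1, hz j h2] at hij; exact hX.1 i h1 j h2 hij
    · rw [hz i h1, hz2 j hj h2] at hij; exact absurd hij (hne i h1 _ (by lia))
    · rw [hz2 i hi h1, hz j h2] at hij; exact absurd hij.symm (hne j h2 _ (by lia))
    · rw [hz2 i hi h1, hz2 j hj h2] at hij
      have := hY.1 _ (by lia) _ (by lia) hij
      lia
  · rw [Finset.map_union, hX.2, hY.2]
    ext m
    simp only [Finset.mem_union, Finset.mem_image, Finset.mem_range]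
    constructor
    · rintro (⟨i, hi, rfl⟩ | ⟨i, hi, rfl⟩)
      · exact ⟨i, by lia, hz i hi⟩
      · exact ⟨p + i, by lia, hz' i hi⟩
    · rintro ⟨i, hi, rfl⟩
      rcases lt_or_ge i p with h1 | h1
      · exact Or.inl ⟨i, h1, (hz i h1).symm⟩
      · exact Or.inr ⟨i - p, by lia, (hz2 i hi h1).symm⟩

end Spells

theorem IsRooted.union {n : ℕ} {G : SimpleGraph (Fin n)} {red : Finset (Fin n)} {v u : Fin n}
    {p r p' r' : ℕ} {X Y : Finset (Fin n)} (hX : IsRooted G red v p r X)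
    (hY : IsRooted G red u p' r' Y) (hvu : G.Adj v u) (hd : Disjoint X Y) :
    IsRooted G red v (p + p') (r + r') (X ∪ Y) := by
  refine ⟨Finset.mem_union_left _ hX.mem, ?_, ?_, ?_⟩
  · rw [Finset.card_union_of_disjoint hd, hX.card, hY.card]
  · rw [Finset.union_inter_distrib_right, Finset.card_union_of_disjoint, hX.red, hY.red]
    exact hd.mono Finset.inter_subset_left Finset.inter_subset_left
  · rw [Finset.coe_union]
    exact SimpleGraph.connected_induce_union hX.conn.preconnected hY.conn.preconnected hX.mem hY.mem
      hvu

theorem disjointCmd_spec {k p₁ p₂ a₁ a₂ : ℕ} {S : Store} (hk : S.var vK = k) (h1 : S.var vP1 = p₁)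
    (h2 : S.var vP2 = p₂) (h3 : S.var vA1 = a₁) (h4 : S.var vA2 = a₂) :
    (disjointCmd.run S).var vOk ≠ 0 ↔
      ∀ i < p₁, ∀ j < p₂, slotList k S a₁ i ≠ slotList k S a₂ j := by
  set c : Cmd := .ite (bin .eq (read aList (var vA1 * var vK + var vI))
    (read aList (var vA2 * var vK + var vJ))) (.set vOk (const 0)) .skip with hc
  rw [disjointCmd, run_seq, run_set, eval_const]
  refine (Cmd.run_forTo (x := vI) (y := vP1) (p := forTo vJ vP2 c) (S := S.setVar vOk 1) p₁
    (by simpa using h1)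
    (fun i S' => S'.arr aList = S.arr aList ∧ (∀ y < 22, S'.var y = S.var y) ∧
      (S'.var vOk ≠ 0 ↔ ∀ i' < i, ∀ j < p₂, slotList k S a₁ i' ≠ slotList k S a₂ j))
    ⟨rfl, fun y hy => by
      rw [Store.var_setVar, if_neg (by lia), Store.var_setVar, if_neg (by lia)], by simp⟩ ?_).2.2
  rintro i hi S' ⟨g1, g2, g3⟩ hx
  have key := Cmd.run_forTo (x := vJ) (y := vP2) (p := c) (S := S') p₂
    ((g2 _ (by decide)).trans h2)
    (fun j S'' => S''.arr aList = S.arr aList ∧ (∀ y < 22, S''.var y = S.var y) ∧ S''.var vI = i ∧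
      (S''.var vOk ≠ 0 ↔ (∀ i' < i, ∀ j < p₂, slotList k S a₁ i' ≠ slotList k S a₂ j) ∧
        ∀ j' < j, slotList k S a₁ i ≠ slotList k S a₂ j'))
    ⟨by simpa using g1, fun y hy => by
      rw [Store.var_setVar, if_neg (by lia), g2 y hy], by simpa using hx, by simpa using g3⟩
    (by
      rintro j hj S'' ⟨f1, f2, f3, f4⟩ hy
      have e1 : (bin .eq (read aList (var vA1 * var vK + var vI))
          (read aList (var vA2 * var vK + var vJ))).eval S'' =
          if slotList k S a₁ i = slotList k S a₂ j then 1 else 0 := by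
        simp only [eval_eq, eval_read_ofNat, eval_add, eval_mul, eval_var, f1, f3, hy,
          f2 vA1 (by decide), f2 vK (by decide), f2 vA2 (by decide), hk, h3, h4, slotList]
        rfl
      by_cases heq : slotList k S a₁ i = slotList k S a₂ j
      · rw [hc, run_ite_pos _ _ (by rw [e1, if_pos heq]; exact one_ne_zero)]
        refine ⟨by simpa using f1, fun y hy => ?_, by simpa using f3, ?_⟩
        · rw [Store.var_setVar, if_neg (by lia), run_set, Store.var_setVar, if_neg (by lia), f2 y hy]
        · exact iff_of_false (by simp) fun h => h.2 j (by lia) heq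
      · rw [hc, run_ite_neg _ _ (by rw [e1, if_neg heq])]
        refine ⟨by simpa using f1, fun y hy => ?_, by simpa using f3, ?_⟩
        · rw [Store.var_setVar, if_neg (by lia), run_skip, f2 y hy]
        · simp only [run_skip, Store.var_setVar, OfNat.ofNat_eq_ofNat, Nat.reduceEqDiff, if_false, f4]
          refine and_congr_right fun _ => ⟨fun h j' hj' => ?_, fun h j' hj' => h j' (by lia)⟩
          rcases Nat.lt_succ_iff_lt_or_eq.1 hj' with hlt | rfl
          · exact h j' hlt
          · exact heq)
  refine ⟨by simpa using key.1, fun y hy => ?_, ?_⟩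
  · rw [Store.var_setVar, if_neg (by lia), key.2.1 y hy]
  · rw [Store.var_setVar, if_neg (by decide), key.2.2.2]
    constructor
    · rintro ⟨f1, f2⟩ i' hi'
      rcases Nat.lt_succ_iff_lt_or_eq.1 hi' with hlt | rfl
      · exact f1 i' hlt
      · exact f2
    · exact fun h => ⟨fun i' hi' => h i' (by lia), h i (by lia)⟩

theorem copyCmd_spec {k p₁ p₂ a₁ a₂ : ℕ} {S : Store} (hk : S.var vK = k) (h1 : S.var vP1 = p₁)
    (h2 : S.var vP2 = p₂) (h3 : S.var vA1 = a₁) (h4 : S.var vA2 = a₂) :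
    (∀ i < p₁, (copyCmd.run S).arr aBuf i = slotList k S a₁ i) ∧
      ∀ i < p₂, (copyCmd.run S).arr aBuf (p₁ + i) = slotList k S a₂ i := by
  set c1 : Cmd := .forTo vI vP1 (.write aBuf (var vI) (read aList (var vA1 * var vK + var vI)))
    with hc1
  have f1 := run_fill (x := vI) (y := vP1) (a := aBuf) (e := var vI)
    (f := read aList (var vA1 * var vK + var vI)) (S := S) p₁ h1 id (slotList k S a₁)
    (fun i _ j _ h => h) (fun j hj S' g1 g2 g3 g4 => by simp [g1, g2, g3, hk, h3, slotList])
  have hv : ∀ y, c1.mods y = false → (c1.run S).var y = S.var y := fun y hy => Cmd.run_var _ hy S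
  have ha : (c1.run S).arr aList = S.arr aList := Cmd.run_arr _ (by decide) S
  have f2 := run_fill (x := vI) (y := vP2) (a := aBuf) (e := var vP1 + var vI)
    (f := read aList (var vA2 * var vK + var vI)) (S := c1.run S) p₂
    ((hv _ (by decide)).trans h2) (fun i => p₁ + i) (slotList k S a₂)
    (fun i _ j _ h => by simpa using h) (fun j hj S' g1 g2 g3 g4 => by
      have e1 := (hv vP1 (by decide)).trans h1
      have e2 := (hv vA2 (by decide)).trans h4
      have e3 := (hv vK (by decide)).trans hk
      simp [g1, g2, g3, ha, e1, e2, e3, slotList])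
  refine ⟨fun i hi => ?_, f2.1⟩
  exact (f2.2 i fun j hj => by lia).trans (f1.1 i hi)

section Merge
variable {n : ℕ} {G : SimpleGraph (Fin n)} {red : Finset (Fin n)} {k q base : ℕ}
  {mem : ℕ → ℕ}

theorem Represented.of_ext {S S' : Store} {v p r : ℕ} {x : ℕ → ℕ}
    (h : Represented k q S v p r x) (hE : Ext k S S') (hp : p ≤ k) : Represented k q S' v p r x :=
  fun l hl => h l (hl.of_ext hE hp)

/-- If the sets in the slots `a₁` and `a₂` of `S₀` are disjoint, then their union is represented in
`S`. -/
def Combined (n k q : ℕ) (S₀ S : Store) (v a₁ a₂ : ℕ) : Prop :=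
  S₀.arr aSize a₁ ≠ 0 → S₀.arr aSize a₂ ≠ 0 → ∀ X₁ X₂ : Finset (Fin n),
    Spells (slotList k S₀ a₁) (S₀.arr aSize a₁) X₁ →
    Spells (slotList k S₀ a₂) (S₀.arr aSize a₂) X₂ → Disjoint X₁ X₂ →
    S₀.arr aSize a₁ + S₀.arr aSize a₂ ≤ k →
    ∃ x, Spells x (S₀.arr aSize a₁ + S₀.arr aSize a₂) (X₁ ∪ X₂) ∧
      Represented k q S v (S₀.arr aSize a₁ + S₀.arr aSize a₂) (S₀.arr aRed a₁ + S₀.arr aRed a₂) x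

theorem Combined.of_ext {S₀ S S' : Store} {v a₁ a₂ : ℕ} (h : Combined n k q S₀ S v a₁ a₂)
    (hE : Ext k S S') : Combined n k q S₀ S' v a₁ a₂ := by
  intro h1 h2 X₁ X₂ hX₁ hX₂ hd hk
  obtain ⟨x, hx, hrep⟩ := h h1 h2 X₁ X₂ hX₁ hX₂ hd hk
  exact ⟨x, hx, hrep.of_ext hE hk⟩

/-- A round fills slots while it scans them; a pair that was present at the start is still there,
unchanged, when its turn comes. -/
theorem Combined.of_ext_left {S₀ S₁ S : Store} {v a₁ a₂ : ℕ} (h : Combined n k q S₁ S v a₁ a₂)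
    (hE : Ext k S₀ S₁) : Combined n k q S₀ S v a₁ a₂ := by
  intro h1 h2 X₁ X₂ hX₁ hX₂ hd hk
  obtain ⟨e1, e2, e3, -⟩ := hE a₁ h1
  obtain ⟨g1, g2, g3, -⟩ := hE a₂ h2
  have := h (by rwa [e1]) (by rwa [g1]) X₁ X₂
    (by rw [e1]; exact hX₁.congr fun i hi => (e3 i (by lia)).symm)
    (by rw [g1]; exact hX₂.congr fun i hi => (g3 i (by lia)).symm) hd (by rwa [e1, g1])
  rwa [e1, e2, g1, g2] at this

theorem mergeCmd_spec [Fact q.Prime] {S : Store} {v u : Fin n} (hvu : G.Adj v u) {s₁ s₂ : ℕ}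
    (hs1 : s₁ < 2 ^ k * 2 ^ k * 2 ^ k) (hs2 : s₂ < 2 ^ k * 2 ^ k * 2 ^ k)
    (henv : Env n k q base mem S) (hval : Valid G red k q S) (hv : S.var vV = v)
    (hu : S.var vU = u) (h1 : S.var vS1 = s₁) (h2 : S.var vS2 = s₂) :
    Valid G red k q (mergeCmd.run S) ∧ Ext k S (mergeCmd.run S) ∧
      Combined n k q S (mergeCmd.run S) v (v * (2 ^ k * 2 ^ k * 2 ^ k) + s₁)
        (u * (2 ^ k * 2 ^ k * 2 ^ k) + s₂) := by
  set T := 2 ^ k * 2 ^ k * 2 ^ k with hT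
  set a₁ := v * T + s₁ with ha₁
  set a₂ := u * T + s₂ with ha₂
  set p₁ := S.arr aSize a₁ with hp₁
  set p₂ := S.arr aSize a₂ with hp₂
  set S1 := (((S.setVar vA1 a₁).setVar vA2 a₂).setVar vP1 p₁).setVar vP2 p₂ with hS1
  set test : Expr := bin .lt (const 0) (var vP1) * bin .lt (const 0) (var vP2) *
      bin .lt (var vP1 + var vP2) (var vK1) with htestdef
  set body : Cmd := copyCmd ;; .set vP ((var vP1 + var vP2).modSucc (var vK)) ;;
        .set vR ((read aRed (var vA1) + read aRed (var vA2)).modSucc (var vK)) ;; insertCmd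
    with hbody
  have hrun : mergeCmd.run S =
      (Cmd.ite test (disjointCmd ;; .ite (var vOk) body .skip) .skip).run S1 := by
    simp [mergeCmd, hS1, hv, hu, h1, h2, henv.var_T, htestdef, hbody, ← hT, ha₁, ha₂, hp₁, hp₂]
  have henv1 : Env n k q base mem S1 := (((henv.setVar (by decide) _).setVar (by decide) _).setVar
    (by decide) _).setVar (by decide) _
  have htest : test.eval S1 ≠ 0 ↔ p₁ ≠ 0 ∧ p₂ ≠ 0 ∧ p₁ + p₂ ≤ k := by
    have g1 : S1.var vP1 = p₁ := by simp [hS1]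
    have g2 : S1.var vP2 = p₂ := by simp [hS1]
    simp only [htestdef, eval_mul, eval_lt, eval_const, eval_var, eval_add, henv1.var_k1, g1, g2]
    rw [mul_ne_zero_iff, mul_ne_zero_iff]
    simp only [ne_eq, ite_eq_right_iff, one_ne_zero, imp_false, not_not]
    lia
  rw [hrun]
  by_cases hcond : p₁ ≠ 0 ∧ p₂ ≠ 0 ∧ p₁ + p₂ ≤ k
  swap
  · rw [run_ite_neg _ _ (by by_contra h; exact hcond (htest.1 h)), run_skip]
    exact ⟨hval, Ext.refl _ _, fun g1 g2 _ _ _ _ _ g3 => absurd ⟨g1, g2, g3⟩ hcond⟩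
  rw [run_ite_pos _ _ (htest.2 hcond), run_seq]
  have hok := disjointCmd_spec (k := k) (p₁ := p₁) (p₂ := p₂) (a₁ := a₁) (a₂ := a₂) (S := S1)
    henv1.var_k (by simp [hS1]) (by simp [hS1]) (by simp [hS1]) (by simp [hS1])
  set S2 := disjointCmd.run S1 with hS2
  have harr : S2.arr = S.arr := by
    funext a; exact Cmd.run_arr _ (by simp [disjointCmd, amods]) S1
  have hvar : ∀ y, disjointCmd.mods y = false → S2.var y = S1.var y :=
    fun y hy => Cmd.run_var _ hy S1
  have henv2 : Env n k q base mem S2 := henv1.run _ (by decide) (by decide)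
  have hval2 : Valid G red k q S2 := hval.of_arr (by rw [harr]) (by rw [harr]) (by rw [harr])
    (by rw [harr])
  have hE2 : Ext k S S2 := Ext.of_arr (by rw [harr]) (by rw [harr]) (by rw [harr]) (by rw [harr])
  by_cases hok2 : S2.var vOk = 0
  · rw [run_ite_neg _ _ (by simpa using hok2), run_skip]
    refine ⟨hval2, hE2, fun _ _ X₁ X₂ hX₁ hX₂ hd _ => ?_⟩
    exact absurd hok2 (hok.2 ((hX₁.disjoint_iff hX₂).2 hd))
  rw [run_ite_pos _ _ (by simpa using hok2)]
  have hne := hok.1 hok2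
  obtain ⟨hb1, hb2⟩ := copyCmd_spec (k := k) (p₁ := p₁) (p₂ := p₂) (a₁ := a₁) (a₂ := a₂) (S := S2)
    henv2.var_k ((hvar _ (by decide)).trans (by simp [hS1]))
    ((hvar _ (by decide)).trans (by simp [hS1])) ((hvar _ (by decide)).trans (by simp [hS1]))
    ((hvar _ (by decide)).trans (by simp [hS1]))
  set S3 := copyCmd.run S2 with hS3
  have harr3 : ∀ a, a ≠ aBuf → S3.arr a = S.arr a := fun a ha => by
    rw [← harr]; exact Cmd.run_arr _ (by simp [copyCmd, amods, ha]) S2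
  have hvar3 : ∀ y, disjointCmd.mods y = false → copyCmd.mods y = false → S3.var y = S1.var y :=
    fun y h h' => (Cmd.run_var _ h' S2).trans (hvar y h)
  have henv3 : Env n k q base mem S3 := henv2.run _ (by decide) (by decide)
  have hkk : k < 2 ^ k := Nat.lt_two_pow_self
  have hroot : ∀ {a s : ℕ} {w : Fin n}, a = w * T + s → s < T → S.arr aSize a ≠ 0 →
      ∃ X, IsRooted G red w (S.arr aSize a) (S.arr aRed a) X ∧
        Spells (slotList k S a) (S.arr aSize a) X := by
    intro a s w ha hs hfull
    obtain ⟨w', b, hb, hslot, ⟨X, hX, hsp⟩, hle, -⟩ := hval a hfull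
    have hr := hX.red_le
    rw [slot_eq, ← hT] at hslot
    have := (mul_add_inj hs (slot_offset_lt (by lia) (by lia) hb) (ha.symm.trans hslot)).1
    obtain rfl : w = w' := Fin.ext this
    exact ⟨X, hX, hsp⟩
  obtain ⟨X₁, hX₁, hsp₁⟩ := hroot ha₁ hs1 hcond.1
  obtain ⟨X₂, hX₂, hsp₂⟩ := hroot ha₂ hs2 hcond.2.1
  have hd : Disjoint X₁ X₂ := (hsp₁.disjoint_iff hsp₂).1 hne
  have hsl : ∀ a, slotList k S2 a = slotList k S a := fun a => by
    funext i; simp only [slotList, harr]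
  have hsp : Spells (S3.arr aBuf) (p₁ + p₂) (X₁ ∪ X₂) :=
    hsp₁.union hsp₂ hd (fun i hi => (hb1 i hi).trans (by rw [hsl]))
      (fun i hi => (hb2 i hi).trans (by rw [hsl]))
  have hX := hX₁.union hX₂ hvu hd
  set r := S.arr aRed a₁ + S.arr aRed a₂ with hr
  have hrk : r ≤ k := hX.red_le.trans hcond.2.2
  have hbodyrun : body.run S2 = insertCmd.run ((S3.setVar vP (p₁ + p₂)).setVar vR r) := by
    have g1 : S3.var vP1 = p₁ := by rw [hvar3 _ (by decide) (by decide)]; simp [hS1]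
    have g2 : S3.var vP2 = p₂ := by rw [hvar3 _ (by decide) (by decide)]; simp [hS1]
    have g3 : S3.var vA1 = a₁ := by rw [hvar3 _ (by decide) (by decide)]; simp [hS1]
    have g4 : S3.var vA2 = a₂ := by rw [hvar3 _ (by decide) (by decide)]; simp [hS1]
    have g5 : (p₁ + p₂) % (k + 1) = p₁ + p₂ := Nat.mod_eq_of_lt (by lia)
    have g6 : r % (k + 1) = r := Nat.mod_eq_of_lt (by lia)
    rw [hbody, run_seq, ← hS3]
    simp only [run_seq, run_set, eval_modSucc, eval_add, eval_var, eval_read_ofNat, Store.var_setVar,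
      Store.arr_setVar, OfNat.ofNat_eq_ofNat, Nat.reduceEqDiff, OfNat.one_ne_ofNat, if_false, g1, g2,
      g3, g4, henv3.var_k, g5, harr3 aRed (by decide), ← hr, g6]
  rw [hbodyrun]
  have hE3 : Ext k S ((S3.setVar vP (p₁ + p₂)).setVar vR r) :=
    Ext.of_arr (harr3 _ (by decide)) (harr3 _ (by decide)) (harr3 _ (by decide)) (harr3 _ (by decide))
  obtain ⟨-, i2, i3, i4⟩ := insertCmd_spec (S := (S3.setVar vP (p₁ + p₂)).setVar vR r) hX hsp
    (by lia) hcond.2.2 ((henv3.setVar (by decide) _).setVar (by decide) _)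
    (hval.of_arr (harr3 _ (by decide)) (harr3 _ (by decide)) (harr3 _ (by decide))
      (harr3 _ (by decide)))
    (by
      have : S3.var vV = S1.var vV := hvar3 _ (by decide) (by decide)
      simpa [this, hS1] using hv) (by simp [hp₁, hp₂]) (by simp)
  refine ⟨i2, hE3.trans i3, fun _ _ Y₁ Y₂ hY₁ hY₂ hdY _ => ⟨S3.arr aBuf, ?_, i4⟩⟩
  exact hY₁.union hY₂ hdY (fun i hi => (hb1 i hi).trans (by rw [hsl]))
      (fun i hi => (hb2 i hi).trans (by rw [hsl]))

end Merge

end Imp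

/-! ### Rounds over all edges and completeness of the families -/

namespace Imp
open WordRAM Imp.Expr Imp.Cmd Polynomial

section Instance
variable {n : ℕ} (G : SimpleGraph (Fin n)) (red : Finset (Fin n)) (k : ℕ)

theorem instanceMem_colour (v : Fin n) [Decidable (v ∈ red)] :
    instanceMem G red k (2 + v) = if v ∈ red then 0 else 1 := by
  have hv := v.2
  unfold instanceMem
  rw [if_neg (by lia), if_neg (by lia)]
  by_cases hred : v ∈ red
  · rw [if_pos hred, if_neg, if_neg]
    · rintro ⟨a, b, hab, -⟩
      generalize n * (a : ℕ) = m at hab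
      lia
    · rintro ⟨w, hw, hwr⟩
      obtain rfl : v = w := Fin.ext (by lia)
      exact hwr hred
  · rw [if_neg hred, if_pos ⟨v, rfl, hred⟩]

theorem instanceMem_adj (v u : Fin n) :
    instanceMem G red k (2 + n + (n * v + u)) ≠ 0 ↔ G.Adj v u := by
  unfold instanceMem
  rw [if_neg (by lia), if_neg (by lia), if_neg (by
    rintro ⟨w, hw, -⟩
    generalize n * (v : ℕ) = m at hw
    lia)]
  split_ifs with h
  · refine iff_of_true one_ne_zero ?_
    obtain ⟨a, b, hab, hadj⟩ := h
    obtain ⟨h1, h2⟩ := mul_add_inj (a := (v : ℕ)) (b := a) u.2 b.2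
      (by rw [mul_comm, mul_comm (a : ℕ)]; lia)
    obtain rfl : v = a := Fin.ext h1
    obtain rfl : u = b := Fin.ext h2
    exact hadj
  · exact iff_of_false (by simp) fun hadj => h ⟨v, u, rfl, hadj⟩

theorem instanceMem_le (i : ℕ) : instanceMem G red k i ≤ max n (max k 1) := by
  unfold instanceMem
  split_ifs <;> simp

theorem instanceMem_eq_zero {i : ℕ} (hi : 2 + n + n * n ≤ i) : instanceMem G red k i = 0 := by
  unfold instanceMem
  rw [if_neg (by lia), if_neg (by lia), if_neg (by rintro ⟨w, hw, -⟩; lia), if_neg]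
  rintro ⟨a, b, hab, -⟩
  have ha := a.2
  have : n * (a + 1) ≤ n * n := Nat.mul_le_mul_left _ ha
  rw [mul_add] at this
  lia

end Instance

section Rounds
variable {n : ℕ} {G : SimpleGraph (Fin n)} {red : Finset (Fin n)} {k q base : ℕ}

/-- One application of `run_forTo_forall` per nested loop; the inner invariants also carry the
counters of the outer loops. -/
theorem roundCmd_spec [Fact q.Prime] {S : Store} (hbase : 2 + n + n * n ≤ base)
    (henv : Env n k q base (instanceMem G red k) S) (hval : Valid G red k q S) :
    Valid G red k q (roundCmd.run S) ∧ Ext k S (roundCmd.run S) ∧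
      ∀ v u : Fin n, G.Adj v u → ∀ s₁ < 2 ^ k * 2 ^ k * 2 ^ k, ∀ s₂ < 2 ^ k * 2 ^ k * 2 ^ k,
        Combined n k q S (roundCmd.run S) v (v * (2 ^ k * 2 ^ k * 2 ^ k) + s₁)
          (u * (2 ^ k * 2 ^ k * 2 ^ k) + s₂) := by
  set T := 2 ^ k * 2 ^ k * 2 ^ k with hT
  have key := run_forTo_forall (x := vV) (y := vN) (S := S) n henv.var_n
    (p := .forTo vU vN (.ite (read aMem (const 2 + var vN + (var vN * var vV + var vU)))
      (.forTo vS1 vT (.forTo vS2 vT mergeCmd)) .skip))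
    (fun S' => Env n k q base (instanceMem G red k) S' ∧ Valid G red k q S') (Ext k)
    (fun v S' => ∀ hv : v < n, ∀ u : Fin n, G.Adj ⟨v, hv⟩ u → ∀ s₁ < T, ∀ s₂ < T,
        Combined n k q S S' v (v * T + s₁) (u * T + s₂))
    (fun _ _ _ => Ext.trans) (fun j S₁ S₂ hE h hv u hu s₁ h1 s₂ h2 => (h hv u hu s₁ h1 s₂ h2).of_ext hE)
    (fun S' m h => ⟨h.1.setVar (by decide) m, h.2⟩) (fun S' m => Ext.of_arr rfl rfl rfl rfl)
    ⟨henv, hval⟩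
    (by
      rintro v hv S1 ⟨henv1, hval1⟩ hE1 hv1
      have key := run_forTo_forall (x := vU) (y := vN) (S := S1) n henv1.var_n
        (p := .ite (read aMem (const 2 + var vN + (var vN * var vV + var vU)))
          (.forTo vS1 vT (.forTo vS2 vT mergeCmd)) .skip)
        (fun S' => Env n k q base (instanceMem G red k) S' ∧ Valid G red k q S' ∧ S'.var vV = v)
        (Ext k)
        (fun u S' => ∀ hu : u < n, G.Adj ⟨v, hv⟩ ⟨u, hu⟩ → ∀ s₁ < T, ∀ s₂ < T,
          Combined n k q S1 S' v (v * T + s₁) (u * T + s₂))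
        (fun _ _ _ => Ext.trans) (fun j S₁ S₂ hE h hu hadj s₁ h1 s₂ h2 =>
          (h hu hadj s₁ h1 s₂ h2).of_ext hE)
        (fun S' m h => ⟨h.1.setVar (by decide) m, h.2.1, by simpa using h.2.2⟩)
        (fun S' m => Ext.of_arr rfl rfl rfl rfl) ⟨henv1, hval1, hv1⟩
        (by
          rintro u hu S2 ⟨henv2, hval2, hv2⟩ hE2 hu2
          have htest : (read aMem (const 2 + var vN + (var vN * var vV + var vU))).eval S2 ≠ 0 ↔
              G.Adj ⟨v, hv⟩ ⟨u, hu⟩ := by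
            rw [← instanceMem_adj G red k, eval_read, cell, if_pos rfl]
            simp only [eval_add, eval_mul, eval_const, eval_var, henv2.var_n, hv2, hu2,
              henv2.base_eq, henv2.mem_eq]
            rw [Nat.mod_eq_of_lt]
            have : n * (v + 1) ≤ n * n := Nat.mul_le_mul_left _ hv
            rw [mul_add] at this
            lia
          by_cases hadj : G.Adj ⟨v, hv⟩ ⟨u, hu⟩
          swap
          · rw [run_ite_neg _ _ (by by_contra h; exact hadj (htest.1 h)), run_skip]
            exact ⟨⟨henv2, hval2, hv2⟩, Ext.refl _ _, fun _ h => absurd h hadj⟩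
          rw [run_ite_pos _ _ (htest.2 hadj)]
          have key := run_forTo_forall (x := vS1) (y := vT) (S := S2) T henv2.var_T
            (p := .forTo vS2 vT mergeCmd)
            (fun S' => Env n k q base (instanceMem G red k) S' ∧ Valid G red k q S' ∧
              S'.var vV = v ∧ S'.var vU = u)
            (Ext k)
            (fun s₁ S' => ∀ s₂ < T, Combined n k q S2 S' v (v * T + s₁) (u * T + s₂))
            (fun _ _ _ => Ext.trans) (fun j S₁ S₂ hE h s₂ h2 => (h s₂ h2).of_ext hE)
            (fun S' m h => ⟨h.1.setVar (by decide) m, h.2.1, by simpa using h.2.2.1,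
              by simpa using h.2.2.2⟩)
            (fun S' m => Ext.of_arr rfl rfl rfl rfl) ⟨henv2, hval2, hv2, hu2⟩
            (by
              rintro s₁ hs1 S3 ⟨henv3, hval3, hv3, hu3⟩ hE3 hs13
              have key := run_forTo_forall (x := vS2) (y := vT) (S := S3) T henv3.var_T
                (p := mergeCmd)
                (fun S' => Env n k q base (instanceMem G red k) S' ∧ Valid G red k q S' ∧
                  S'.var vV = v ∧ S'.var vU = u ∧ S'.var vS1 = s₁)
                (Ext k)
                (fun s₂ S' => Combined n k q S3 S' v (v * T + s₁) (u * T + s₂))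
                (fun _ _ _ => Ext.trans) (fun j S₁ S₂ hE h => h.of_ext hE)
                (fun S' m h => ⟨h.1.setVar (by decide) m, h.2.1, by simpa using h.2.2.1,
                  by simpa using h.2.2.2.1, by simpa using h.2.2.2.2⟩)
                (fun S' m => Ext.of_arr rfl rfl rfl rfl) ⟨henv3, hval3, hv3, hu3, hs13⟩
                (by
                  rintro s₂ hs2 S4 ⟨henv4, hval4, hv4, hu4, hs14⟩ hE4 hs24
                  obtain ⟨g1, g2, g3⟩ := mergeCmd_spec (S := S4) hadj hs1 hs2 henv4 hval4 hv4 hu4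
                    hs14 hs24
                  refine ⟨⟨henv4.run _ (by decide) (by decide), g1, ?_, ?_, ?_⟩, g2,
                    g3.of_ext_left hE4⟩
                  · rw [Cmd.run_var _ (by decide), hv4]
                  · rw [Cmd.run_var _ (by decide), hu4]
                  · rw [Cmd.run_var _ (by decide), hs14])
              obtain ⟨⟨g1, g2, g3, g4, -⟩, g5, g6⟩ := key
              exact ⟨⟨g1, g2, g3, g4⟩, g5, fun s₂ hs2 => (g6 s₂ hs2).of_ext_left hE3⟩)
          obtain ⟨⟨g1, g2, g3, -⟩, g5, g6⟩ := key
          exact ⟨⟨g1, g2, g3⟩, g5, fun _ _ s₁ hs1 s₂ hs2 => (g6 s₁ hs1 s₂ hs2).of_ext_left hE2⟩)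
      obtain ⟨⟨g1, g2, -⟩, g5, g6⟩ := key
      exact ⟨⟨g1, g2⟩, g5, fun _ u hadj s₁ hs1 s₂ hs2 =>
        (g6 u u.2 u.2 hadj s₁ hs1 s₂ hs2).of_ext_left hE1⟩)
  exact ⟨key.1.2, key.2.1, fun v u hadj => key.2.2 v v.2 v.2 u hadj⟩

open Classical in
theorem isRooted_singleton (v : Fin n) :
    IsRooted G red v 1 (if v ∈ red then 1 else 0) {v} := by
  refine ⟨by simp, by simp, ?_, ?_⟩
  · split_ifs with h <;> simp [Finset.singleton_inter_of_mem, Finset.singleton_inter_of_notMem, h]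
  · rw [Finset.coe_singleton]
    exact SimpleGraph.connected_induce_singleton v

theorem spells_singleton {x : ℕ → ℕ} {v : Fin n} (h : x 0 = v) : Spells x 1 {v} := by
  refine ⟨fun i hi j hj _ => by lia, ?_⟩
  simp [h]

open Classical in
theorem singletonsCmd_spec [Fact q.Prime] {S : Store} (hk : 1 ≤ k) (hbase : 2 + n + n * n ≤ base)
    (henv : Env n k q base (instanceMem G red k) S) (hval : Valid G red k q S) :
    Valid G red k q (singletonsCmd.run S) ∧
      ∀ v : Fin n, ∃ x, Spells x 1 {v} ∧
        Represented k q (singletonsCmd.run S) v 1 (if v ∈ red then 1 else 0) x := by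
  have key := run_forTo_forall (x := vV) (y := vN) (S := S) n henv.var_n
    (p := .write aBuf (const 0) (var vV) ;; .set vP (const 1) ;;
      .set vR (const 1 - read aMem (const 2 + var vV)) ;; insertCmd)
    (fun S' => Env n k q base (instanceMem G red k) S' ∧ Valid G red k q S') (Ext k)
    (fun v S' => ∀ hv : v < n, ∃ x, Spells x 1 {(⟨v, hv⟩ : Fin n)} ∧
        Represented k q S' v 1 (if (⟨v, hv⟩ : Fin n) ∈ red then 1 else 0) x)
    (fun _ _ _ => Ext.trans) (fun j S₁ S₂ hE h hv => by
      obtain ⟨x, h1, h2⟩ := h hv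
      exact ⟨x, h1, h2.of_ext hE hk⟩)
    (fun S' m h => ⟨h.1.setVar (by decide) m, h.2⟩) (fun S' m => Ext.of_arr rfl rfl rfl rfl)
    ⟨henv, hval⟩
    (by
      rintro v hv S1 ⟨henv1, hval1⟩ hE1 hv1
      set r := if (⟨v, hv⟩ : Fin n) ∈ red then 1 else 0 with hr
      have hsetup : Env n k q base (instanceMem G red k) (((S1.setArr aBuf 0 v).setVar vP 1).setVar vR r) := by
        refine (Env.setVar ?_ (by decide) _).setVar (by decide) _
        have := henv1.run (.write aBuf (const 0) (const v)) (fun _ _ => rfl) rfl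
        simpa using this
      have hred : (1 : ℕ) - instanceMem G red k (2 + v) = r := by
        have := instanceMem_colour G red k ⟨v, hv⟩
        simp only at this
        rw [this, hr]
        split_ifs <;> rfl
      have hlt : (2 + v) % base = 2 + v := Nat.mod_eq_of_lt (by lia)
      have hmem : (S1.setArr aBuf 0 v).arr aMem = instanceMem G red k := by
        rw [← henv1.mem_eq]; funext i; simp
      have hrun : (Cmd.write aBuf (const 0) (var vV) ;; .set vP (const 1) ;;
          .set vR (const 1 - read aMem (const 2 + var vV)) ;; insertCmd).run S1 =
          insertCmd.run (((S1.setArr aBuf 0 v).setVar vP 1).setVar vR r) := by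
        simp only [run_seq, run_write, run_set, eval_const, eval_var, eval_sub, eval_read, eval_add,
          cell_ofNat, hv1, Store.arr_setVar, Store.base_setVar, Store.var_setVar, Store.var_setArr,
          hmem, OfNat.ofNat_eq_ofNat, Nat.reduceEqDiff, if_false]
        rw [cell, if_pos rfl, Store.base_setArr, henv1.base_eq, hlt, hred]
      rw [hrun]
      have harr : ∀ a, a ≠ aBuf → (S1.setArr aBuf 0 v).arr a = S1.arr a := fun a ha => by
        funext i; simp [ha]
      have hbuf : Spells ((((S1.setArr aBuf 0 v).setVar vP 1).setVar vR r).arr aBuf) 1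
        {(⟨v, hv⟩ : Fin n)} := spells_singleton (by simp)
      obtain ⟨i1, i2, i3, i4⟩ := insertCmd_spec (isRooted_singleton (G := G) (red := red) ⟨v, hv⟩)
        hbuf le_rfl hk hsetup
        (hval1.of_arr (harr aSize (by decide)) (harr aRed (by decide))
          (harr aList (by decide)) (harr aRow (by decide)))
        (by simpa using hv1) (by simp) (by simp [hr])
      refine ⟨⟨i1, i2⟩, (Ext.of_arr (harr aSize (by decide)) (harr aRed (by decide))
          (harr aList (by decide)) (harr aRow (by decide))).trans i3, fun _ => ⟨_, hbuf, i4⟩⟩)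
  exact ⟨key.1.2, fun v => key.2.2 v v.2 v.2⟩

/-- The families contain representatives of all sets of size at most `t`. -/
def Complete {n : ℕ} (G : SimpleGraph (Fin n)) (red : Finset (Fin n)) (k t : ℕ) (S : Store) : Prop :=
  ∀ (v : Fin n) (p r : ℕ) (X : Finset (Fin n)), IsRooted G red v p r X → p ≤ t → p ≤ k →
    ∀ Y : Finset (Fin n), Y.card = k - p → Disjoint X Y →
    ∃ b < 2 ^ k, S.arr aSize (slot (2 ^ k) v p r b) = p ∧ S.arr aRed (slot (2 ^ k) v p r b) = r ∧
      ∃ X' : Finset (Fin n), IsRooted G red v p r X' ∧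
        Spells (slotList k S (slot (2 ^ k) v p r b)) p X' ∧ Disjoint X' Y

/-- If every kept set met Y, the linear form of Y at the points -y would kill the family, hence also
the vector of X. But its value there is the product of all a - y with a in X and y in Y, which is
nonzero: distinct vertices are distinct residues modulo q ≥ n. -/
theorem Represented.exists_disjoint [Fact q.Prime] (hnq : n ≤ q) {S : Store}
    (hval : Valid G red k q S) {v : Fin n} {p r : ℕ} {x : ℕ → ℕ} {X Y : Finset (Fin n)}
    (hrep : Represented k q S v p r x) (hsp : Spells x p X) (hX : IsRooted G red v p r X)
    (hp : p ≤ k) (hY : Y.card = k - p) (hd : Disjoint X Y) :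
    ∃ b < 2 ^ k, S.arr aSize (slot (2 ^ k) v p r b) = p ∧ S.arr aRed (slot (2 ^ k) v p r b) = r ∧
      ∃ X' : Finset (Fin n), IsRooted G red v p r X' ∧
        Spells (slotList k S (slot (2 ^ k) v p r b)) p X' ∧ Disjoint X' Y := by
  obtain ⟨l, hl⟩ := exists_linear_form (R := ZMod q) hp Y hY fun j => -((j : ℕ) : ZMod q)
  have hform : ∀ (z : ℕ → ℕ) (Z : Finset (Fin n)), Spells z p Z → Z.card = p →
      ∑ b ∈ Finset.range (2 ^ k), l b * vecOf q k z p b =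
        ∏ j ∈ Y, ∏ a ∈ Z, (-((j : ℕ) : ZMod q) + ((a : ℕ) : ZMod q)) := by
    intro z Z hz hcard
    have hdeg : (polyOf q z p).natDegree ≤ p := by
      refine (natDegree_prod_le _ _).trans ?_
      refine (Finset.sum_le_card_nsmul _ _ 1 fun i _ => ?_).trans (by simp)
      exact (natDegree_X_add_C _).le
    have := hl _ hdeg
    rw [hz.polyOf_eq] at this
    simp only [eval_prod, Polynomial.eval_add, eval_X, eval_C] at this
    rw [← this, ← hz.polyOf_eq]
    rfl
  by_contra! hcon
  have hkill : Kills k q S v p r l := by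
    intro b hb hfull
    have hkk : k < 2 ^ k := Nat.lt_two_pow_self
    obtain ⟨v', b', hb', hslot, ⟨X', hX', hsp'⟩, hle, -⟩ := hval _ hfull
    have h1 := hX'.red_le
    have h2 := hX.red_le
    obtain ⟨e1, e2, e3, e4⟩ := slot_inj (by lia) (by lia) hb (by lia) (by lia) hb' hslot
    obtain rfl : v = v' := Fin.ext e1
    rw [← e2, ← e3] at hX'
    rw [← e2] at hsp'
    have hnd := hcon b hb e2.symm e3.symm X' hX' hsp'
    obtain ⟨a, haX, haY⟩ := Finset.not_disjoint_iff.1 hnd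
    rw [hform _ _ hsp' hX'.card]
    exact Finset.prod_eq_zero haY (Finset.prod_eq_zero haX (by ring))
  have h0 := hrep l hkill
  rw [hform _ _ hsp hX.card] at h0
  obtain ⟨y, hy, h0⟩ := Finset.prod_eq_zero_iff.1 h0
  obtain ⟨a, ha, h0⟩ := Finset.prod_eq_zero_iff.1 h0
  have h1 : ((a : ℕ) : ZMod q) = ((y : ℕ) : ZMod q) := by linear_combination h0
  rw [ZMod.natCast_eq_natCast_iff'] at h1
  rw [Nat.mod_eq_of_lt (a.2.trans_le hnq), Nat.mod_eq_of_lt (y.2.trans_le hnq)] at h1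
  obtain rfl : a = y := Fin.ext h1
  exact Finset.disjoint_left.1 hd ha hy

theorem IsRooted.unique_red {v u : Fin n} {p p' r r' : ℕ} {X : Finset (Fin n)}
    (h : IsRooted G red v p r X) (h' : IsRooted G red u p' r' X) : p = p' ∧ r = r' :=
  ⟨h.card.symm.trans h'.card, h.red.symm.trans h'.red⟩

theorem Complete.one [Fact q.Prime] (hnq : n ≤ q) {S : Store} (hval : Valid G red k q S)
    (h : ∀ v : Fin n, ∀ r, IsRooted G red v 1 r {v} →
      ∃ x, Spells x 1 {v} ∧ Represented k q S v 1 r x) :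
    Complete G red k 1 S := by
  intro v p r X hX hp1 hpk Y hY hd
  have hpos : 0 < X.card := Finset.card_pos.2 ⟨v, hX.mem⟩
  obtain rfl : p = 1 := by have := hX.card; lia
  obtain ⟨w, rfl⟩ := Finset.card_eq_one.1 hX.card
  obtain rfl : v = w := by simpa using hX.mem
  obtain ⟨x, hsp, hrep⟩ := h v r hX
  exact hrep.exists_disjoint hnq hval hsp hX hpk hY hd

/-- Exchange argument: X splits into A and B along an edge. First A is replaced by a kept A' that
avoids B ∪ Y, then B by a kept B' that avoids A' ∪ Y; the sizes of the avoided sets are right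
because |A| + |B| + |Y| = k. The union A' ∪ B' need not be kept, but it is represented, so some kept
set avoids Y. -/
theorem Complete.succ [Fact q.Prime] (hnq : n ≤ q) {S S' : Store} {t : ℕ} (ht : 1 ≤ t)
    (h : Complete G red k t S) (hE : Ext k S S') (hval' : Valid G red k q S')
    (hcomb : ∀ v u : Fin n, G.Adj v u → ∀ s₁ < 2 ^ k * 2 ^ k * 2 ^ k,
      ∀ s₂ < 2 ^ k * 2 ^ k * 2 ^ k,
        Combined n k q S S' v (v * (2 ^ k * 2 ^ k * 2 ^ k) + s₁)
          (u * (2 ^ k * 2 ^ k * 2 ^ k) + s₂)) :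
    Complete G red k (t + 1) S' := by
  intro v p r X hX hpt hpk Y hY hd
  have hkk : k < 2 ^ k := Nat.lt_two_pow_self
  rcases lt_or_ge 1 p with hp1 | hp1
  swap
  -- A single vertex cannot be split; it is covered by the previous stage, as t ≥ 1.
  · have hpos : 0 < X.card := Finset.card_pos.2 ⟨v, hX.mem⟩
    have hcard := hX.card
    obtain ⟨b, hb, h1, h2, X', hX', hsp, hd'⟩ := h v p r X hX (by lia) hpk Y hY hd
    obtain ⟨e1, e2, e3, -⟩ := hE (slot (2 ^ k) v p r b) (by rw [h1]; lia)
    exact ⟨b, hb, e1.trans h1, e2.trans h2, X', hX', hsp.congr fun i hi => (e3 i (by lia)).symm, hd'⟩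
  obtain ⟨A, B, u, hvA, huB, hadj, hAB, hAuB, hA, hB⟩ :=
    SimpleGraph.exists_connected_partition hX.mem hX.conn (by rw [hX.card]; lia)
  have hA' : IsRooted G red v A.card (A ∩ red).card A := ⟨hvA, rfl, rfl, hA⟩
  have hB' : IsRooted G red u B.card (B ∩ red).card B := ⟨huB, rfl, rfl, hB⟩
  have hposA : 0 < A.card := Finset.card_pos.2 ⟨v, hvA⟩
  have hposB : 0 < B.card := Finset.card_pos.2 ⟨u, huB⟩
  have hunion := hA'.union hB' hadj hAB
  rw [hAuB] at hunion
  obtain ⟨hpe, hre⟩ := hX.unique_red hunion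
  have hdA : Disjoint A Y := hd.mono_left (hAuB ▸ Finset.subset_union_left)
  have hdB : Disjoint B Y := hd.mono_left (hAuB ▸ Finset.subset_union_right)
  obtain ⟨b₁, hb₁, hs₁, hr₁, A', hA'r, hA's, hA'd⟩ := h v _ _ A hA' (by lia) (by lia) (B ∪ Y)
    (by rw [Finset.card_union_of_disjoint hdB, hY]; lia)
    (Finset.disjoint_union_right.2 ⟨hAB, hdA⟩)
  rw [Finset.disjoint_union_right] at hA'd
  obtain ⟨b₂, hb₂, hs₂, hr₂, B', hB'r, hB's, hB'd⟩ := h u _ _ B hB' (by lia) (by lia) (A' ∪ Y)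
    (by rw [Finset.card_union_of_disjoint hA'd.2, hY, hA'r.card]; lia)
    (Finset.disjoint_union_right.2 ⟨hA'd.1.symm, hdB⟩)
  rw [Finset.disjoint_union_right] at hB'd
  have hrA := hA'.red_le
  have hrB := hB'.red_le
  have hc := hcomb v u hadj _ (slot_offset_lt (p := A.card) (r := (A ∩ red).card) (b := b₁)
    (by lia) (by lia) hb₁) _ (slot_offset_lt (p := B.card) (r := (B ∩ red).card) (b := b₂)
    (by lia) (by lia) hb₂)
  rw [← slot_eq, ← slot_eq] at hc
  obtain ⟨x, hx, hrep⟩ := hc (by lia) (by lia) A' B' (by rw [hs₁]; exact hA's)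
    (by rw [hs₂]; exact hB's) hB'd.1.symm (by lia)
  rw [hs₁, hs₂] at hx
  rw [hs₁, hs₂, hr₁, hr₂] at hrep
  have hfin := hA'r.union hB'r hadj hB'd.1.symm
  rw [← hpe] at hx
  rw [← hpe, ← hre] at hrep hfin
  exact hrep.exists_disjoint hnq hval' hx hfin hpk hY
    (Finset.disjoint_union_left.2 ⟨hA'd.2, hB'd.2⟩)

end Rounds

end Imp

/-! ### Output and correctness of the program -/

namespace Imp
open WordRAM Imp.Expr Imp.Cmd

section Output
variable {n : ℕ} {G : SimpleGraph (Fin n)} {red : Finset (Fin n)} {k q base : ℕ}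

theorem outputCmd_spec {mem : ℕ → ℕ} {S : Store} (hbase : k + 1 ≤ base)
    (henv : Env n k q base mem S) :
    ((outputCmd.run S).arr aMem 0 = 1 ∧ ∃ s, S.arr aSize s = k ∧ S.arr aRed s + S.arr aRed s = k ∧
      ∀ i < k, (outputCmd.run S).arr aMem (1 + i) = slotList k S s i) ∨
    ((outputCmd.run S).arr aMem 0 = 0 ∧ ∀ s < n * (2 ^ k * 2 ^ k * 2 ^ k),
      ¬ (S.arr aSize s = k ∧ S.arr aRed s + S.arr aRed s = k)) := by
  set M := n * (2 ^ k * 2 ^ k * 2 ^ k) with hM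
  rw [outputCmd, run_seq, run_write]
  set S1 := S.setArr aMem (cell S.base aMem ((const 0).eval S)) ((const 0).eval S) with hS1
  have hzero : cell base 0 0 = 0 := by simp [cell]
  have harr1 : ∀ a, a ≠ aMem → S1.arr a = S.arr a := fun a ha => by
    funext i; simp [hS1, ha]
  have key := Cmd.run_forTo (x := vS) (y := vNT) (S := S1)
    (p := .ite (bin .eq (read aSize (var vS)) (var vK) *
        bin .eq (read aRed (var vS) + read aRed (var vS)) (var vK))
      (.write aMem (const 0) (const 1) ;;
        .forTo vI vK (.write aMem (const 1 + var vI) (read aList (var vS * var vK + var vI))))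
      .skip) M henv.var_nT
    (fun m S' => S'.base = base ∧ S'.var vK = k ∧ (∀ a, a ≠ aMem → S'.arr a = S.arr a) ∧
      ((S'.arr aMem 0 = 1 ∧ ∃ s, S.arr aSize s = k ∧ S.arr aRed s + S.arr aRed s = k ∧
        ∀ i < k, S'.arr aMem (1 + i) = slotList k S s i) ∨
      (S'.arr aMem 0 = 0 ∧ ∀ s < m, ¬ (S.arr aSize s = k ∧ S.arr aRed s + S.arr aRed s = k))))
    (by
      refine ⟨henv.base_eq, by simpa [hS1] using henv.var_k, harr1, Or.inr ⟨?_, fun s hs => by lia⟩⟩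
      simp [hS1, henv.base_eq, hzero])
    (by
      rintro m hm S' ⟨h1, h2, h3, h4⟩ hx
      have etest : (bin .eq (read aSize (var vS)) (var vK) *
          bin .eq (read aRed (var vS) + read aRed (var vS)) (var vK)).eval S' ≠ 0 ↔
          S.arr aSize m = k ∧ S.arr aRed m + S.arr aRed m = k := by
        simp only [eval_mul, eval_eq, eval_read_one, eval_read_ofNat, eval_var, eval_add, hx, h2,
          h3 aSize (by decide), h3 aRed (by decide), mul_ne_zero_iff]
        simp only [ne_eq, ite_eq_right_iff, one_ne_zero, imp_false, not_not]
      by_cases htest : S.arr aSize m = k ∧ S.arr aRed m + S.arr aRed m = k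
      · rw [run_ite_pos _ _ (etest.2 htest), run_seq, run_write]
        simp only [eval_const, h1, hzero]
        have hcell : ∀ i < k, cell base aMem (1 + i) = 1 + i := fun i hi => by
          rw [cell, if_pos rfl]; exact Nat.mod_eq_of_lt (by lia)
        have f := run_fill (x := vI) (y := vK) (a := aMem) (e := const 1 + var vI)
          (f := read aList (var vS * var vK + var vI)) (S := S'.setArr aMem 0 1) k h2
          (fun i => 1 + i) (slotList k S m) (fun i _ j _ h => by simpa using h)
          (fun j hj S2 g1 g2 g3 g4 => by
            refine ⟨?_, ?_⟩
            · simp only [eval_add, eval_const, eval_var, g2, Store.base_setArr, h1]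
              exact hcell j hj
            · simp [g1, g2, g3, hx, h2, h3, slotList])
        refine ⟨?_, ?_, fun a ha => ?_, Or.inl ⟨?_, m, htest.1, htest.2, f.1⟩⟩
        · rw [Store.base_setVar, Cmd.run_base]; exact h1
        · rw [Store.var_setVar, if_neg (by decide), Cmd.run_var _ (by decide)]; exact h2
        · rw [Store.arr_setVar, Cmd.run_arr _ (by simp [amods, ha])]
          funext i
          simp [ha, h3 a ha]
        · rw [Store.arr_setVar, f.2 0 fun i _ => by lia]
          simp
      · rw [run_ite_neg _ _ (by by_contra h; exact htest (etest.1 h)), run_skip]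
        refine ⟨h1, by simpa using h2, h3, h4.imp_right fun h => ⟨h.1, fun s hs => ?_⟩⟩
        rcases Nat.lt_succ_iff_lt_or_eq.1 hs with hsm | rfl
        · exact h.2 s hsm
        · exact htest)
  exact key.2.2.2

theorem IsRooted.isBalancedConnected {v : Fin n} {r : ℕ} {X : Finset (Fin n)}
    (h : IsRooted G red v k r X) (hr : r + r = k) : IsBalancedConnected G red k X := by
  refine ⟨h.card, ?_, h.conn⟩
  have h1 := Finset.card_inter_add_card_sdiff X red
  rw [h.card, h.red] at h1
  rw [h.red]
  lia

theorem outputCmd_correct {mem : ℕ → ℕ} {S : Store} (hk : 1 ≤ k) (hbase : k + 1 ≤ base)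
    (henv : Env n k q base mem S) (hval : Valid G red k q S) (hcomp : Complete G red k k S) :
    IsCorrectAnswer G red k ((outputCmd.run S).arr aMem) := by
  rcases outputCmd_spec hbase henv with ⟨h0, s, hs, hr, hlist⟩ | ⟨h0, hno⟩
  · refine Or.inl ⟨h0, ?_⟩
    obtain ⟨v, b, hb, hslot, ⟨X, hX, hsp⟩, -⟩ := hval s (by lia)
    rw [hs] at hX hsp
    choose f hf hfs using fun i : Fin k => hsp.exists_mem i.2
    refine ⟨f, ?_, fun i => (hlist i i.2).trans (hfs i)⟩
    have himage : Finset.univ.image f = X := by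
      ext a
      rw [hsp.mem_iff, Finset.mem_image]
      constructor
      · rintro ⟨i, -, rfl⟩
        exact ⟨i, i.2, hfs i⟩
      · rintro ⟨i, hi, hia⟩
        exact ⟨⟨i, hi⟩, Finset.mem_univ _, Fin.ext ((hfs ⟨i, hi⟩).symm.trans hia)⟩
    rw [himage]
    exact hX.isBalancedConnected hr
  · refine Or.inr ⟨h0, ?_⟩
    rintro ⟨U, hcard, hbal, hconn⟩
    obtain ⟨v, hv⟩ := Finset.card_pos.1 (by lia : 0 < U.card)
    have hX : IsRooted G red v k (U ∩ red).card U := ⟨hv, hcard, rfl, hconn⟩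
    -- For p = k the set to be avoided is empty: completeness just says that some set with these
    -- parameters is kept.
    obtain ⟨b, hb, h1, h2, -⟩ := hcomp v k _ U hX le_rfl le_rfl ∅ (by simp) (by simp)
    have h3 := Finset.card_inter_add_card_sdiff U red
    have hkk : k < 2 ^ k := Nat.lt_two_pow_self
    refine hno _ ?_ ⟨h1, by rw [h2]; lia⟩
    have h4 := hX.red_le
    have h5 := slot_offset_lt (p := k) (r := (U ∩ red).card) (b := b) hkk (by lia) hb
    have h6 : ((v : ℕ) + 1) * (2 ^ k * 2 ^ k * 2 ^ k) ≤ n * (2 ^ k * 2 ^ k * 2 ^ k) :=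
      Nat.mul_le_mul_right _ v.2
    rw [slot_eq]
    rw [add_mul] at h6
    lia

theorem mainCmd_correct {S : Store} (hk : 1 ≤ k) (hbase : n * n + n + k + 3 ≤ S.base)
    (hmem : S.arr aMem = instanceMem G red k) (hempty : ∀ s, S.arr aSize s = 0) (hn : S.var vN = n)
    (hvk : S.var vK = k) (hD : S.var vD = 2 ^ k) :
    IsCorrectAnswer G red k ((mainCmd.run S).arr aMem) := by
  obtain ⟨q, hq, hnq, henv1⟩ := setupCmd_spec hn hvk hD
  have : Fact q.Prime := ⟨hq⟩
  rw [hmem] at henv1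
  have hval1 : Valid G red k q (setupCmd.run S) := by
    intro s hs
    rw [setupCmd_arr, hempty s] at hs
    exact absurd rfl hs
  obtain ⟨hval2, hrep2⟩ := singletonsCmd_spec hk (by lia) henv1 hval1
  set S2 := singletonsCmd.run (setupCmd.run S) with hS2
  have henv2 : Env n k q S.base (instanceMem G red k) S2 := henv1.run _ (by decide) (by decide)
  have hcomp2 : Complete G red k 1 S2 := Complete.one hnq.le hval2 fun v r hr => by
    obtain ⟨x, h1, h2⟩ := hrep2 v
    rw [(hr.unique_red (isRooted_singleton v)).2]
    exact ⟨x, h1, h2⟩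
  have hset : ∀ {t : ℕ} {S' : Store} (m : ℕ), Complete G red k t S' →
      Complete G red k t (S'.setVar vRound m) := fun m h => h
  have key := Cmd.run_forTo (x := vRound) (y := vK) (S := S2) (p := roundCmd) k henv2.var_k
    -- The singletons give size 1 before the first round, so k rounds reach k + 1, one more than
    -- necessary.
    (fun t S' => Env n k q S.base (instanceMem G red k) S' ∧ Valid G red k q S' ∧
      Complete G red k (t + 1) S')
    ⟨henv2.setVar (by decide) _, hval2, hset _ hcomp2⟩
    (by
      rintro t ht S' ⟨h1, h2, h3⟩ -
      obtain ⟨g1, g2, g3⟩ := roundCmd_spec (by lia) h1 h2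
      exact ⟨(h1.run _ (by decide) (by decide)).setVar (by decide) _, g1,
        hset _ (Complete.succ hnq.le (by lia) h3 g2 g1 g3)⟩)
  obtain ⟨henv3, hval3, hcomp3⟩ := key
  exact outputCmd_correct hk (by lia) henv3 hval3
    fun v p r X hX h1 h2 => hcomp3 v p r X hX (by lia) h2

theorem isCorrectAnswer_congr {mem mem' : ℕ → ℕ} (h : IsCorrectAnswer G red k mem)
    (heq : ∀ i ≤ k, mem' i = mem i) : IsCorrectAnswer G red k mem' := by
  refine h.imp ?_ ?_
  · rintro ⟨h0, f, hf, hm⟩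
    exact ⟨(heq 0 (by lia)).trans h0, f, hf, fun i => (heq _ (by lia)).trans (hm i)⟩
  · rintro ⟨h0, hno⟩
    exact ⟨(heq 0 (by lia)).trans h0, hno⟩

end Output

/-! ### Start of the machine and the final time bound -/

/-- Read `n` and `k` and compute `2 ^ k` and the base of the arrays. -/
def preamble : Prog := .seq (.load 2 0) (.seq (.const 1 1) (.seq (.load 4 1) (.seq (.op .shl 6 1 4)
  (.seq (.op .mul 0 2 2) (.seq (.op .add 0 0 2) (.seq (.op .add 0 0 4) (.seq (.const 1 3)
    (.op .add 0 0 1))))))))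

noncomputable def initialStore {n : ℕ} (G : SimpleGraph (Fin n)) (red : Finset (Fin n)) (k : ℕ) :
    Store where
  -- Room for the instance, n^2 + n + 2 cells, and for the answer, k + 1 cells.
  base := n * n + n + k + 3
  var x := if x = vN then n else if x = vK then k else if x = vD then 2 ^ k else 0
  arr a := if a = aMem then instanceMem G red k else fun _ => 0

section Initial
variable {n k : ℕ} (G : SimpleGraph (Fin n)) (red : Finset (Fin n))

theorem two_le_two_pow (hk : 1 ≤ k) : 2 ≤ 2 ^ k := by
  simpa using Nat.pow_le_pow_right (n := 2) (by decide) hk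

theorem base_le_scale (hk : 1 ≤ k) : n * n + n + k + 3 ≤ scale (2 ^ k) (n + 1) (3, 2) := by
  have h1 := two_le_two_pow hk
  have h2 : k < 2 ^ k := Nat.lt_two_pow_self
  set D := 2 ^ k
  have h3 : n * n + n + k + 3 ≤ (n + 1) ^ 2 + 2 * D := by nlinarith
  have h4 : 1 ≤ (n + 1) ^ 2 := Nat.one_le_pow _ _ (by lia)
  have h5 : (n + 1) ^ 2 + 2 * D ≤ (1 + 2 * D) * (n + 1) ^ 2 := by nlinarith
  have h6 : 1 + 2 * D ≤ D ^ 3 := by nlinarith [Nat.mul_le_mul h1 h1, sq_nonneg D]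
  exact h3.trans (h5.trans (Nat.mul_le_mul_right _ h6))

theorem initialStore_bounded (hk : 1 ≤ k) :
    Bounded (2 ^ k) (n + 1) mainTable (initialStore G red k) := by
  have hD := two_le_two_pow hk
  have hN : 1 ≤ n + 1 := by lia
  have hkk : k < 2 ^ k := Nat.lt_two_pow_self
  refine ⟨by simp [initialStore], base_le_scale hk, fun x => ?_, fun a i => ?_⟩
  · simp only [initialStore]
    split_ifs with h0 h1 h2
    · subst h0; simp [mainTable, scale]
    · subst h1; simp [mainTable, scale]; lia
    · subst h2; simp [mainTable, scale]
    · exact Nat.zero_le _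
  · simp only [initialStore]
    split_ifs with h0
    · subst h0
      refine (instanceMem_le G red k i).trans ?_
      have : scale (2 ^ k) (n + 1) (mainTable.arr aMem) = 2 ^ k * (n + 1) := by
        simp [mainTable, scale]
      rw [this]
      refine max_le (by nlinarith) (max_le (by nlinarith) (by nlinarith))
    · exact Nat.zero_le _

theorem preamble_exec (hk : 1 ≤ k) {c : ℕ} (hc : 4 ≤ c) :
    ∃ s, Exec ((2 ^ k * (n + 1)) ^ c) preamble (initialState G red k) 9 s ∧
      Rep (initialStore G red k) s := by
  have hD := two_le_two_pow hk
  have hN : 1 ≤ n + 1 := by lia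
  have hkk : k < 2 ^ k := Nat.lt_two_pow_self
  have hW : n * n + n + k + 3 < (2 ^ k * (n + 1)) ^ c :=
    (base_le_scale hk).trans_lt (scale_lt hD hN (by simp only; lia) (by simp only; lia))
  have hDW : 2 ^ k < (2 ^ k * (n + 1)) ^ c := by
    refine lt_of_le_of_lt (b := scale (2 ^ k) (n + 1) (1, 0)) (by simp [scale])
      (scale_lt hD hN ?_ ?_) <;> simp only <;> lia
  have m0 : instanceMem G red k 0 = n := by simp [instanceMem]
  have m1 : instanceMem G red k 1 = k := by simp [instanceMem]
  refine ⟨_, Exec.seq (t₁ := 1) (t₂ := 8) (.load _ _ _) (Exec.seq (t₁ := 1) (t₂ := 7)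
    (.const _ _ _ (by lia)) (Exec.seq (t₁ := 1) (t₂ := 6) (.load _ _ _)
    (Exec.seq (t₁ := 1) (t₂ := 5) (.op _ _ _ _ _ ?_) (Exec.seq (t₁ := 1) (t₂ := 4)
    (.op _ _ _ _ _ ?_) (Exec.seq (t₁ := 1) (t₂ := 3) (.op _ _ _ _ _ ?_) (Exec.seq (t₁ := 1)
    (t₂ := 2) (.op _ _ _ _ _ ?_) (Exec.seq (t₁ := 1) (t₂ := 1) (.const _ _ _ (by lia))
    (.op _ _ _ _ _ ?_)))))))), ?_⟩
  · simpa [initialState, State.setReg, Function.update_apply, Op.eval, m0, m1, Nat.one_shiftLeft]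
      using hDW
  · simp [initialState, State.setReg, Function.update_apply, Op.eval, m0, m1]
    lia
  · simp [initialState, State.setReg, Function.update_apply, Op.eval, m0, m1]
    lia
  · simp [initialState, State.setReg, Function.update_apply, Op.eval, m0, m1]
    lia
  · simpa [initialState, State.setReg, Function.update_apply, Op.eval, m0, m1] using hW
  · refine ⟨?_, fun x => ?_, fun a i _ hi => ?_⟩
    · simp [initialState, initialStore, State.setReg, Function.update_apply, Op.eval, m0, m1]
    · have e1 : 2 * x + 2 = 2 ↔ x = 0 := by lia
      have e2 : 2 * x + 2 = 4 ↔ x = 1 := by lia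
      have e3 : 2 * x + 2 = 6 ↔ x = 2 := by lia
      have e4 : 2 * x + 2 ≠ 1 := by lia
      have e5 : 2 * x + 2 ≠ 0 := by lia
      simp only [initialState, initialStore, State.setReg, Function.update_apply, Op.eval, e1, e2, e3,
        e4, e5, if_false]
      simp [m0, m1, Nat.one_shiftLeft]
      split_ifs <;> simp_all
    · simp only [initialState, initialStore, State.setReg, addr]
      split_ifs with h
      · rfl
      -- The memory beyond the base is still 0, so the other arrays start empty.
      · exact instanceMem_eq_zero G red k (by lia)

end Initial

theorem sq_le_max (n : ℕ) : ((n : ℝ) + 1) ^ 2 ≤ 4 * max 1 ((n : ℝ) ^ 2 * Real.log n) := by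
  rcases Nat.lt_or_ge n 2 with hn | hn
  · have h1 : (n : ℝ) ≤ 1 := by exact_mod_cast (by lia : n ≤ 1)
    have h2 : (0 : ℝ) ≤ n := Nat.cast_nonneg n
    have h3 := le_max_left 1 ((n : ℝ) ^ 2 * Real.log n)
    nlinarith
  · have h1 : (2 : ℝ) ≤ n := by exact_mod_cast hn
    have h2 : Real.log 2 ≤ Real.log n := Real.log_le_log (by norm_num) h1
    have h3 := Real.log_two_gt_d9
    have h4 := le_max_right 1 ((n : ℝ) ^ 2 * Real.log n)
    -- For n ≥ 2 one has (n + 1)^2 ≤ (9/4) n^2, and a quarter of 9/4 is 9/16 < log 2.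
    have h5 : (n : ℝ) ^ 2 * (9 / 16) ≤ (n : ℝ) ^ 2 * Real.log n :=
      mul_le_mul_of_nonneg_left (by linarith) (by positivity)
    nlinarith

end Imp

theorem mainTheorem4 :
    ∃ (p : WordRAM.Prog) (c : ℕ), ∀ (n k : ℕ), 1 ≤ k →
      ∀ (G : SimpleGraph (Fin n)) (red : Finset (Fin n)),
        ∃ (t : ℕ) (s : WordRAM.State),
          WordRAM.Exec ((2 ^ k * (n + 1)) ^ c) p (initialState G red k) t s ∧
          IsCorrectAnswer G red k s.mem ∧
          (t : ℝ) ≤ 2 ^ (c * k) * max 1 ((n : ℝ) ^ 2 * Real.log n) := by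
  refine ⟨.seq Imp.preamble Imp.mainCmd.compile, 200, fun n k hk G red => ?_⟩
  have hD := Imp.two_le_two_pow hk
  obtain ⟨s₁, h1, hR1⟩ := Imp.preamble_exec G red hk (c := 200) (by lia)
  obtain ⟨t, s, h2, ht, hR2, -⟩ := Imp.Cmd.exec hD (by lia) Imp.mainCmd Imp.mainCmd_legal
    (Imp.initialStore_bounded G red hk) s₁ hR1
  refine ⟨9 + t, s, .seq h1 h2, ?_, ?_⟩
  · have hcorrect : IsCorrectAnswer G red k
        ((Imp.mainCmd.run (Imp.initialStore G red k)).arr 0) :=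
      Imp.mainCmd_correct hk le_rfl rfl (fun _ => rfl) rfl rfl rfl
    refine Imp.isCorrectAnswer_congr hcorrect fun i hi => ?_
    have h3 := hR2.arr 0 i (by decide)
      (fun _ => by rw [Imp.Cmd.run_base]; simp only [Imp.initialStore]; lia)
    simpa [Imp.addr] using h3
  · have hcost := Imp.mainCmd_cost
    have h3 : t ≤ (2 ^ k) ^ 196 * (n + 1) ^ 2 := ht.trans
      (Imp.scale_mono hD (by lia) (f := (196, 2)) hcost.1 hcost.2.le)
    have h4 : (t : ℝ) ≤ (2 ^ k) ^ 196 * ((n : ℝ) + 1) ^ 2 := by exact_mod_cast h3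
    have h5 := Imp.sq_le_max n
    set M := max 1 ((n : ℝ) ^ 2 * Real.log n) with hM
    have hM1 : 1 ≤ M := le_max_left _ _
    have hD' : (2 : ℝ) ≤ 2 ^ k := by exact_mod_cast hD
    have hP : (1 : ℝ) ≤ (2 ^ k) ^ 196 := one_le_pow₀ (by linarith)
    have h6 : ((2 : ℝ) ^ k) ^ 196 * ((n : ℝ) + 1) ^ 2 ≤ (2 ^ k) ^ 196 * (4 * M) :=
      mul_le_mul_of_nonneg_left h5 (by positivity)
    have h7 : (1 : ℝ) ≤ (2 ^ k) ^ 196 * M := one_le_mul_of_one_le_of_one_le hP hM1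
    -- The 9 steps of the preamble and the factor 4 of `sq_le_max` add up to at most 13 ≤ 16, which
    -- is absorbed by the difference between the exponents 200 and 196.
    have h8 : (16 : ℝ) ≤ (2 ^ k) ^ 4 := by
      calc (16 : ℝ) = 2 ^ 4 := by norm_num
        _ ≤ (2 ^ k) ^ 4 := pow_le_pow_left₀ (by norm_num) hD' 4
    have h9 : (2 : ℝ) ^ (200 * k) = (2 ^ k) ^ 4 * (2 ^ k) ^ 196 := by
      rw [← pow_add, ← pow_mul, mul_comm k]
    push_cast
    rw [h9, mul_assoc]
    have h10 : 16 * ((2 ^ k) ^ 196 * M) ≤ (2 ^ k) ^ 4 * ((2 ^ k) ^ 196 * M) :=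
      mul_le_mul_of_nonneg_right h8 (by linarith)
    linarith
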